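/- Let $\Delta$ be the simplex category. Let $\Sigma$ be the category obtained from $\Delta\times\Delta$ by adding a new terminal object $[-1]$, and let $p\colon\Sigma\to\Delta$ be the functor extending the ordinal sum, with $p(q,r)=[q+1+r]$ and $p([-1])=[0]$. Precomposition with $p$ is a functor $p^*\colon \mathrm{sSet}=\mathrm{Fun}(\Delta^{\mathrm{op}},\mathrm{Set})\to \mathrm{Fun}(\Sigma^{\mathrm{op}},\mathrm{Set})$; its right adjoint $p_*$ is right Kan extension along $p$. A simplicial set $X$ is *2-Segal* if for every $n\ge 3$ and every triangulation $T$ of the convex $(n+1)$-gon with vertices $0,\dots,n$ the map from $X_n$ to the limit $X_2\times_{X_1}\cdots\times_{X_1}X_2$ over the triangles and segments of $T$ is a bijection. It is *unital* if moreover for all $n\ge 2$ and $0\le i\le n-1$ the square formed by $s_i\colon X_{n-1}\to X_n$, $s_0\colon X_0\to X_1$, the map $X_{n-1}\to X_0$ induced by $0\mapsto i$ and the map $X_n\to X_1$ induced by $0<1\mapsto i<i+1$ is a pullback. Let $\mathrm{U2Seg}\subset\mathrm{sSet}$ be the full subcategory of unital 2-Segal sets, with inclusion $\iota$. A (small, strict)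 double category $\mathcal D$ is *stable* if the maps $Sq\,\mathcal D\to Hor\,\mathcal D\times_{Ob\,\mathcal D}Ver\,\mathcal D$, sending a square to its (top, left) sides, and $Sq\,\mathcal D\to Ver\,\mathcal D\times_{Ob\,\mathcal D}Hor\,\mathcal D$, sending a square to its (right, bottom) sides, are bijections (fiber products over the sources, respectively over the targets). It is *augmented* by a subset $A\mathcal D\subset Ob\,\mathcal D$ if every object is the target of a unique horizontal morphism with source in $A\mathcal D$ and the source of a unique vertical morphism with target in $A\mathcal D$. Let $\mathrm{DCat}$ be the category of augmented stable double categories and of double functors that preserve the augmentation sets. For $n\ge0$ let $\mathcal W_n\in\mathrm{DCat}$ be the double category with objects $(i,j)$, $0\le i\le j\le n$, horizontal morphisms $(i,j,\ell)\colon(i,j)\to(i,\ell)$, $i\le j\le \ell$, vertical morphisms $(i,k,j)\colon(i,j)\to(k,j)$, $i\le k\le j$, squares $(i,k,j,\ell)$, $i\le k\le j\le\ell$, with corners $(i,j),(i,\ell),(k,j),(k,\ell)$, and augmentation $\{(i,i)\}$. Define: * the path construction $\mathcal P\colon\mathrm{U2Seg}\to\mathrm{DCat}$: $Ob\,(\mathcal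 PX)=X_1$, $Hor\,(\mathcal PX)=Ver\,(\mathcal PX)=X_2$, $Sq\,(\mathcal PX)=X_3$, and $A(\mathcal PX)=X_0$, regarded as a subset of $X_1$ via $s_0$. The source, target and identity maps are $d_2,d_1,s_1$ for horizontal morphisms, $d_1,d_0,s_0$ for vertical morphisms, $d_3,d_2,s_2$ for squares as horizontal morphisms between vertical ones, and $d_1,d_0,s_0$ for squares as vertical morphisms between horizontal ones. The compositions are induced by the inverses of 2-Segal maps; * the Waldhausen construction $S_\bullet\mathcal D=\mathrm{Hom}_{\mathrm{DCat}}(\mathcal W_\bullet,\mathcal D)$, a simplicial set functorial in $\mathcal D\in\mathrm{DCat}$; * the augmented double nerve $N^a\colon\mathrm{DCat}\to\mathrm{Fun}(\Sigma^{\mathrm{op}},\mathrm{Set})$, $N^a\mathcal D=\mathrm{Hom}_{\mathrm{DCat}}(\mathcal W_{p(-)},\mathcal D)$. **Proposition.** The simplicial set $S_\bullet\mathcal D$ is unital 2-Segal for every $\mathcal D\in\mathrm{DCat}$, so that $S_\bullet$ is a functor $\mathrm{DCat}\to\mathrm{U2Seg}$, and there are natural isomorphisms of functors $$N^a\circ\mathcal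 P\;\cong\;p^*\circ\iota\colon\ \mathrm{U2Seg}\to\mathrm{Fun}(\Sigma^{\mathrm{op}},\mathrm{Set}),\qquad \iota\circ S_\bullet\;\cong\;p_*\circ N^a\colon\ \mathrm{DCat}\to\mathrm{sSet}.$$ -/

import Mathlib

open CategoryTheory Opposite Simplicial

universe u v w

namespace Waldhausen

/-- A triangulation of the convex polygon with vertices `0, …, n` in cyclic order, given by the
relation `E i j`: "`i < j` and the segment `ij` is a side or a diagonal of the triangulation".
It is a maximal set of pairwise non-crossing segments between vertices (so it contains every side);
the segments `ij` and `kl` cross if and only if `i < k < j < l` or `k < i < l < j`. -/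
structure IsPolygonTriangulation {n : ℕ} (E : Fin (n + 1) → Fin (n + 1) → Prop) : Prop where
  lt : ∀ i j, E i j → i < j
  noncrossing : ∀ i j k l, E i j → E k l → ¬ (i < k ∧ k < j ∧ j < l)
  maximal : ∀ i j, i < j →
    (∀ k l, E k l → ¬ (i < k ∧ k < j ∧ j < l) ∧ ¬ (k < i ∧ i < l ∧ l < j)) → E i j

/-- The triangles of the triangulation `E`: triples of vertices `t 0 < t 1 < t 2` all of whose edges
belong to `E`. A triple is recorded as the corresponding map `[2] → [n]` in the simplex category. -/
def PolygonTriangle {n : ℕ} (E : Fin (n + 1) → Fin (n + 1) → Prop) : Type :=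
  {t : ⦋2⦌ ⟶ ⦋n⦌ // E (t 0) (t 1) ∧ E (t 1) (t 2) ∧ E (t 0) (t 2)}

/-- The limit of `X₂` over the triangles and `X₁` over the segments of the triangulation, ordered by
inclusion, i.e. the iterated fiber product `X₂ ×_{X₁} ⋯ ×_{X₁} X₂`: families of 2-simplices, one for
each triangle, whose restrictions to any common edge of two triangles agree. -/
def SegalLimit (X : SSet.{u}) {n : ℕ} (E : Fin (n + 1) → Fin (n + 1) → Prop) : Type u :=
  {x : PolygonTriangle E → X _⦋2⦌ //
    ∀ (t t' : PolygonTriangle E) (i j : Fin 3),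
      SimplexCategory.δ i ≫ t.1 = SimplexCategory.δ j ≫ t'.1 → X.δ i (x t) = X.δ j (x t')}

/-- The Segal map of a simplicial set `X` attached to a triangulation. -/
def segalMap (X : SSet.{u}) {n : ℕ} (E : Fin (n + 1) → Fin (n + 1) → Prop) (y : X _⦋n⦌) :
    SegalLimit X E :=
  ⟨fun t => X.map t.1.op y, by
    intro t t' i j h
    have := congrArg (fun f => X.map f.op y) h
    simpa [SimplicialObject.δ] using this⟩

/-- 2-Segal sets: for `n ≥ 3` the Segal map of every triangulation of the `(n + 1)`-gon is a bijection
(a weak equivalence for the trivial model structure on sets, where homotopy limits are limits). -/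
def IsTwoSegal (X : SSet.{u}) : Prop :=
  ∀ (n : ℕ), 3 ≤ n → ∀ E : Fin (n + 1) → Fin (n + 1) → Prop,
    IsPolygonTriangulation E → Function.Bijective (segalMap X E)

/-- Unital 2-Segal sets. In the field `unital` the square is the one with corners
`X_{N-1} → X₀` (restriction to the vertex `i`), `X_N → X₁` (restriction to the edge `i < i + 1`),
`s_i : X_{N-1} → X_N` and `s₀ : X₀ → X₁`, for all `N ≥ 2` (here `N = n + 2`) and `0 ≤ i ≤ N - 1`. -/
structure IsUnitalTwoSegal (X : SSet.{u}) : Prop where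
  twoSegal : IsTwoSegal X
  unital : ∀ (n : ℕ) (i : Fin (n + 2)),
    IsPullback (X.map (SimplexCategory.const ⦋0⦌ ⦋n + 1⦌ i).op) (X.σ i) (X.σ (0 : Fin 1))
      (X.map (SimplexCategory.mkOfSucc i).op)

theorem map_map_op (X : SSet.{u}) {a b c : SimplexCategory} (f : a ⟶ b) (g : b ⟶ c)
    (y : X.obj (op c)) : X.map f.op (X.map g.op y) = X.map (f ≫ g).op y := by simp

theorem simplexHom_ext {a b : SimplexCategory} (f g : a ⟶ b) (h : ∀ i, (f i).val = (g i).val) :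
    f = g := by
  apply SimplexCategory.Hom.ext
  apply OrderHom.ext
  funext i
  exact Fin.ext (h i)

theorem δ_val {n : ℕ} (i : Fin (n + 2)) (j : Fin (n + 1)) :
    ((SimplexCategory.δ i : ⦋n⦌ ⟶ ⦋n + 1⦌) j).val = if j.val < i.val then j.val else j.val + 1 := by
  change (Fin.succAbove i j).val = _
  simp only [Fin.succAbove, Fin.lt_def, Fin.val_castSucc]
  split_ifs <;> simp

theorem σ_val {n : ℕ} (i : Fin (n + 1)) (j : Fin (n + 2)) :
    ((SimplexCategory.σ i : ⦋n + 1⦌ ⟶ ⦋n⦌) j).val = if j.val ≤ i.val then j.val else j.val - 1 := by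
  change (Fin.predAbove i j).val = _
  simp only [Fin.predAbove, Fin.lt_def, Fin.val_castSucc]
  split_ifs <;> simp <;> omega

theorem mkOfSucc_val {n : ℕ} (k : Fin n) (i : Fin 2) :
    (SimplexCategory.mkOfSucc k i).val = k.val + i.val := by
  fin_cases i <;> rfl

theorem comp_val {a b c : SimplexCategory} (f : a ⟶ b) (g : b ⟶ c) (i : Fin (a.len + 1)) :
    ((f ≫ g) i).val = (g (f i)).val := rfl

/-- The triangulation with diagonals `0b` and one ear cut off at the vertex `k + 1`. -/
def earChords (n k : ℕ) (a b : Fin (n + 1)) : Prop :=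
  a.val < b.val ∧
    (b.val = a.val + 1 ∨ (a.val = k ∧ b.val = k + 2) ∨ (a.val = 0 ∧ b.val ≠ k + 1))

theorem earChords_isTriangulation (n k : ℕ) (hk : k + 2 ≤ n) :
    IsPolygonTriangulation (earChords n k) where
  lt i j h := h.1
  noncrossing i j k' l h h' := by
    simp only [earChords, Fin.lt_def] at *
    omega
  maximal i j hij H := by
    simp only [earChords, Fin.lt_def] at *
    refine ⟨hij, ?_⟩
    by_contra hc
    by_cases hi : i.val = 0
    · have := (H ⟨k, by omega⟩ ⟨k + 2, by omega⟩ (by simp)).1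
      simp only at this
      omega
    · by_cases hik : i.val = k
      · have := (H ⟨0, by omega⟩ ⟨k + 2, by omega⟩ (by simp)).2
        simp only at this
        omega
      · have := (H ⟨0, by omega⟩ ⟨i.val + 1, by omega⟩ (by simp; omega)).2
        simp only at this
        omega

/-- The triangle with vertices `k, k + 1, k + 2`. -/
def earTriangle {n : ℕ} (k : Fin (n + 1)) : ⦋2⦌ ⟶ ⦋n + 2⦌ :=
  SimplexCategory.subinterval k.val 2 (by omega)

theorem earTriangle_val {n : ℕ} (k : Fin (n + 1)) (i : Fin 3) :
    (earTriangle k i).val = i.val + k.val := rfl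

theorem IsTwoSegal.ext_ear {X : SSet.{u}} (hX : IsTwoSegal X) {n : ℕ} (hn : 2 ≤ n)
    {y y' : X _⦋n⦌}
    (h : ∀ t : PolygonTriangle (earChords n 0), X.map t.1.op y = X.map t.1.op y') : y = y' := by
  by_cases h3 : 3 ≤ n
  · apply (hX n h3 _ (earChords_isTriangulation n 0 (by omega))).1
    apply Subtype.ext
    funext t
    exact h t
  · obtain rfl : n = 2 := by omega
    have := h ⟨𝟙 _, by simp [earChords]⟩
    simpa using this

theorem IsTwoSegal.ear {X : SSet.{u}} (hX : IsTwoSegal X) {m : ℕ} (k : Fin (m + 2))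
    (y : X _⦋m + 2⦌) (t : X _⦋2⦌)
    (h : X.map (SimplexCategory.mkOfSucc k).op y = X.δ 1 t) :
    ∃! w : X _⦋m + 3⦌, X.δ k.succ.castSucc w = y ∧ X.map (earTriangle k).op w = t := by
  have hT := earChords_isTriangulation (m + 3) k.val (by omega)
  have key : ∀ s : PolygonTriangle (earChords (m + 3) k.val),
      (s.1 1).val = k.val + 1 → s.1 = earTriangle k := by
    rintro ⟨s, h01, h12, h02⟩ hs
    simp only [earChords] at h01 h12 h02 hs
    apply simplexHom_ext
    intro i
    rw [earTriangle_val]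
    fin_cases i <;> simp <;> omega
  have avoid : ∀ s : PolygonTriangle (earChords (m + 3) k.val),
      (s.1 1).val ≠ k.val + 1 → ∀ i, (s.1 i).val ≠ k.val + 1 := by
    rintro ⟨s, h01, h12, h02⟩ hs i
    simp only [earChords] at h01 h12 h02 hs
    fin_cases i <;> simp <;> omega
  classical
  let x : PolygonTriangle (earChords (m + 3) k.val) → X _⦋2⦌ := fun s =>
    if (s.1 1).val = k.val + 1 then t else X.map (s.1 ≫ SimplexCategory.σ k.castSucc).op y
  have hmix : ∀ s s' : PolygonTriangle (earChords (m + 3) k.val), ∀ i j : Fin 3,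
      (s.1 1).val = k.val + 1 → (s'.1 1).val ≠ k.val + 1 →
      SimplexCategory.δ i ≫ s.1 = SimplexCategory.δ j ≫ s'.1 → X.δ i (x s) = X.δ j (x s') := by
    intro s s' i j hs hs' he
    have e1 : x s = t := if_pos hs
    have e2 : x s' = X.map (s'.1 ≫ SimplexCategory.σ k.castSucc).op y := if_neg hs'
    rw [e1, e2]
    have hi : i = 1 := by
      have h0 := avoid s' hs' ((SimplexCategory.δ j : ⦋1⦌ ⟶ ⦋2⦌) 0)
      have h1 := avoid s' hs' ((SimplexCategory.δ j : ⦋1⦌ ⟶ ⦋2⦌) 1)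
      have g0 : s.1 ((SimplexCategory.δ i : ⦋1⦌ ⟶ ⦋2⦌) 0) =
        s'.1 ((SimplexCategory.δ j : ⦋1⦌ ⟶ ⦋2⦌) 0) := congrArg (fun f : ⦋1⦌ ⟶ ⦋m + 3⦌ => f 0) he
      have g1 : s.1 ((SimplexCategory.δ i : ⦋1⦌ ⟶ ⦋2⦌) 1) =
        s'.1 ((SimplexCategory.δ j : ⦋1⦌ ⟶ ⦋2⦌) 1) := congrArg (fun f : ⦋1⦌ ⟶ ⦋m + 3⦌ => f 1) he
      rw [← g0] at h0
      rw [← g1] at h1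
      fin_cases i
      · exact absurd hs h0
      · rfl
      · exact absurd hs h1
    subst hi
    rw [← h]
    simp only [SimplicialObject.δ, map_map_op]
    rw [← Category.assoc, ← he, key s hs]
    congr 3
    rw [show SimplexCategory.mkOfSucc k =
      (SimplexCategory.δ 1 ≫ earTriangle k) ≫ SimplexCategory.σ k.castSucc from ?_]
    apply simplexHom_ext
    intro i
    have := i.isLt
    simp only [comp_val, σ_val, earTriangle_val, δ_val, mkOfSucc_val, Fin.val_castSucc, Fin.val_one]
    simp only [SimplexCategory.len_mk] at this
    split_ifs <;> omega
  have hcompat : ∀ (s s' : PolygonTriangle (earChords (m + 3) k.val)) (i j : Fin 3),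
      SimplexCategory.δ i ≫ s.1 = SimplexCategory.δ j ≫ s'.1 → X.δ i (x s) = X.δ j (x s') := by
    intro s s' i j he
    by_cases hs : (s.1 1).val = k.val + 1 <;> by_cases hs' : (s'.1 1).val = k.val + 1
    · have e1 : x s = t := if_pos hs
      have e2 : x s' = t := if_pos hs'
      rw [key s hs, key s' hs'] at he
      rw [e1, e2]
      have g0 : (earTriangle k ((SimplexCategory.δ i : ⦋1⦌ ⟶ ⦋2⦌) 0)).val =
        (earTriangle k ((SimplexCategory.δ j : ⦋1⦌ ⟶ ⦋2⦌) 0)).val :=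
          congrArg (fun f : ⦋1⦌ ⟶ ⦋m + 3⦌ => (f 0).val) he
      have g1 : (earTriangle k ((SimplexCategory.δ i : ⦋1⦌ ⟶ ⦋2⦌) 1)).val =
        (earTriangle k ((SimplexCategory.δ j : ⦋1⦌ ⟶ ⦋2⦌) 1)).val :=
          congrArg (fun f : ⦋1⦌ ⟶ ⦋m + 3⦌ => (f 1).val) he
      simp only [earTriangle_val, δ_val, Fin.val_zero, Fin.val_one] at g0 g1
      obtain rfl : i = j := by
        apply Fin.ext
        split_ifs at g0 g1 <;> omega
      rfl
    · exact hmix s s' i j hs hs' he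
    · exact (hmix s' s j i hs' hs he.symm).symm
    · have e1 : x s = X.map (s.1 ≫ SimplexCategory.σ k.castSucc).op y := if_neg hs
      have e2 : x s' = X.map (s'.1 ≫ SimplexCategory.σ k.castSucc).op y := if_neg hs'
      rw [e1, e2]
      simp only [SimplicialObject.δ, map_map_op]
      rw [← Category.assoc, he, Category.assoc]
  have hb := hX (m + 3) (by omega) _ hT
  obtain ⟨w, hw⟩ := hb.2 ⟨x, hcompat⟩
  have hw' : ∀ s : PolygonTriangle (earChords (m + 3) k.val), X.map s.1.op w = x s :=
    fun s => congrFun (congrArg Subtype.val hw) s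
  refine ⟨w, ⟨?_, ?_⟩, ?_⟩
  · apply hX.ext_ear (by omega)
    intro s
    have hs : earChords (m + 3) k.val ((s.1 ≫ SimplexCategory.δ k.succ.castSucc) 0)
          ((s.1 ≫ SimplexCategory.δ k.succ.castSucc) 1) ∧
        earChords (m + 3) k.val ((s.1 ≫ SimplexCategory.δ k.succ.castSucc) 1)
          ((s.1 ≫ SimplexCategory.δ k.succ.castSucc) 2) ∧
        earChords (m + 3) k.val ((s.1 ≫ SimplexCategory.δ k.succ.castSucc) 0)
          ((s.1 ≫ SimplexCategory.δ k.succ.castSucc) 2) := by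
      obtain ⟨s, h01, h12, h02⟩ := s
      simp only [earChords] at h01 h12 h02
      simp only [earChords, comp_val, δ_val, Fin.val_castSucc, Fin.val_succ]
      refine ⟨?_, ?_, ?_⟩ <;> split_ifs <;> omega
    have e := hw' ⟨_, hs⟩
    simp only [SimplicialObject.δ, map_map_op]
    rw [e]
    have hne : ((s.1 ≫ SimplexCategory.δ k.succ.castSucc) 1).val ≠ k.val + 1 := by
      simp only [comp_val, δ_val, Fin.val_castSucc, Fin.val_succ]
      split_ifs <;> omega
    refine (if_neg hne).trans ?_
    congr 3
    rw [Category.assoc, SimplexCategory.δ_comp_σ_succ' (by simp)]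
    rw [Category.comp_id]
  · have hs : earChords (m + 3) k.val (earTriangle k 0) (earTriangle k 1) ∧
        earChords (m + 3) k.val (earTriangle k 1) (earTriangle k 2) ∧
        earChords (m + 3) k.val (earTriangle k 0) (earTriangle k 2) := by
      simp only [earChords, earTriangle_val]
      simp
      omega
    rw [hw' ⟨_, hs⟩]
    exact if_pos (by simp [earTriangle_val, add_comm])
  · rintro w' ⟨h1, h2⟩
    apply hb.1
    rw [hw]
    apply Subtype.ext
    funext s
    change X.map s.1.op w' = x s
    by_cases hs : (s.1 1).val = k.val + 1
    · rw [key s hs, h2]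
      exact (if_pos hs).symm
    · refine Eq.trans ?_ (if_neg hs).symm
      rw [← h1]
      simp only [SimplicialObject.δ, map_map_op]
      have e : s.1 =
          s.1 ≫ SimplexCategory.σ k.castSucc ≫ SimplexCategory.δ k.succ.castSucc := by
        apply simplexHom_ext
        intro i
        have := avoid s hs i
        simp only [comp_val, σ_val, δ_val, Fin.val_castSucc, Fin.val_succ]
        split_ifs <;> omega
      rw [Category.assoc, ← e]

/-- The structure of a category with set of objects `O` and set of all morphisms `M`; `comp f g` is
"first `f`, then `g`". -/
structure CatStr (O M : Type u) where
  src : M → O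
  tgt : M → O
  one : O → M
  comp : ∀ f g : M, tgt f = src g → M
  src_one : ∀ x, src (one x) = x
  tgt_one : ∀ x, tgt (one x) = x
  src_comp : ∀ f g h, src (comp f g h) = src f
  tgt_comp : ∀ f g h, tgt (comp f g h) = tgt g
  one_comp : ∀ f, comp (one (src f)) f (tgt_one _) = f
  comp_one : ∀ f, comp f (one (tgt f)) (src_one _).symm = f
  assoc : ∀ f g k (hfg : tgt f = src g) (hgk : tgt g = src k),
    comp (comp f g hfg) k ((tgt_comp f g hfg).trans hgk) =
      comp f (comp g k hgk) (hfg.trans (src_comp g k hgk).symm)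

/-- The maps `F₀` on objects and `F₁` on morphisms form a functor. -/
structure CatStr.IsFunctor {O M : Type u} {O' M' : Type v} (C : CatStr O M) (C' : CatStr O' M')
    (F₀ : O → O') (F₁ : M → M') : Prop where
  src : ∀ f, C'.src (F₁ f) = F₀ (C.src f)
  tgt : ∀ f, C'.tgt (F₁ f) = F₀ (C.tgt f)
  one : ∀ x, F₁ (C.one x) = C'.one (F₀ x)
  comp : ∀ f g (h : C.tgt f = C.src g) (h' : C'.tgt (F₁ f) = C'.src (F₁ g)),
    F₁ (C.comp f g h) = C'.comp (F₁ f) (F₁ g) h'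

/-- A (small, strict) double category: a category internal to categories. The category of objects is
`ver`, with objects `Ob` and morphisms `Ver`; the category of morphisms is `vsq`, with objects `Hor`
and morphisms `Sq` (vertical composition of squares; `vsq.src`, `vsq.tgt` are the vertical source and
target, i.e. the top and bottom horizontal morphisms). The internal source, target, identity and
composition are those of `hor` on objects and those of `hsq` on morphisms (horizontal composition of
squares; `hsq.src`, `hsq.tgt` are the horizontal source and target, i.e. the left and right vertical
morphisms). The fields after `vsq` say that source, target, identity and composition are functors.
The proofs `h'`, `h` of composability quantified over there always exist, by the preceding fields. -/
structure DoubleCat where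
  Ob : Type u
  Hor : Type u
  Ver : Type u
  Sq : Type u
  hor : CatStr Ob Hor
  ver : CatStr Ob Ver
  hsq : CatStr Ver Sq
  vsq : CatStr Hor Sq
  src_functor : vsq.IsFunctor ver hor.src hsq.src
  tgt_functor : vsq.IsFunctor ver hor.tgt hsq.tgt
  one_functor : ver.IsFunctor vsq hor.one hsq.one
  comp_src : ∀ a b (h : hsq.tgt a = hsq.src b) (h' : hor.tgt (vsq.src a) = hor.src (vsq.src b)),
    vsq.src (hsq.comp a b h) = hor.comp (vsq.src a) (vsq.src b) h'
  comp_tgt : ∀ a b (h : hsq.tgt a = hsq.src b) (h' : hor.tgt (vsq.tgt a) = hor.src (vsq.tgt b)),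
    vsq.tgt (hsq.comp a b h) = hor.comp (vsq.tgt a) (vsq.tgt b) h'
  comp_one : ∀ f g (h : hor.tgt f = hor.src g) (h' : hsq.tgt (vsq.one f) = hsq.src (vsq.one g)),
    hsq.comp (vsq.one f) (vsq.one g) h' = vsq.one (hor.comp f g h)
  interchange : ∀ a b c d (hab : hsq.tgt a = hsq.src b) (hcd : hsq.tgt c = hsq.src d)
    (hac : vsq.tgt a = vsq.src c) (hbd : vsq.tgt b = vsq.src d)
    (h : vsq.tgt (hsq.comp a b hab) = vsq.src (hsq.comp c d hcd))
    (h' : hsq.tgt (vsq.comp a c hac) = hsq.src (vsq.comp b d hbd)),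
    vsq.comp (hsq.comp a b hab) (hsq.comp c d hcd) h =
      hsq.comp (vsq.comp a c hac) (vsq.comp b d hbd) h'

/-- Stability: `Sq → Hor ×_{Ob} Ver`, `a ↦ (top, left)`, and `Sq → Ver ×_{Ob} Hor`,
`a ↦ (right, bottom)`, are bijections onto the fiber products over sources, resp. targets. -/
structure DoubleCat.IsStable (D : DoubleCat.{u}) : Prop where
  span : ∀ (f : D.Hor) (v : D.Ver), D.hor.src f = D.ver.src v →
    ∃! a : D.Sq, D.vsq.src a = f ∧ D.hsq.src a = v
  cospan : ∀ (v : D.Ver) (f : D.Hor), D.ver.tgt v = D.hor.tgt f →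
    ∃! a : D.Sq, D.hsq.tgt a = v ∧ D.vsq.tgt a = f

/-- `A` is an augmentation: `A ×_{Ob} Hor → Ob` (target of the horizontal morphism) and
`Ver ×_{Ob} A → Ob` (source of the vertical morphism) are bijections. -/
structure DoubleCat.IsAugmented (D : DoubleCat.{u}) (A : Set D.Ob) : Prop where
  hor : ∀ x : D.Ob, ∃! f : D.Hor, D.hor.src f ∈ A ∧ D.hor.tgt f = x
  ver : ∀ x : D.Ob, ∃! v : D.Ver, D.ver.tgt v ∈ A ∧ D.ver.src v = x

/-- Augmented stable double categories. -/
structure AugStDoubleCat extends DoubleCat.{u} where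
  A : Set Ob
  stable : toDoubleCat.IsStable
  augmented : toDoubleCat.IsAugmented A

/-- Augmented double functors: double functors that map the augmentation set into the augmentation
set. The two double categories may live in different universes. -/
@[ext]
structure AugDoubleFunctor (D : AugStDoubleCat.{u}) (E : AugStDoubleCat.{v}) where
  ob : D.Ob → E.Ob
  onHor : D.Hor → E.Hor
  onVer : D.Ver → E.Ver
  onSq : D.Sq → E.Sq
  hor : D.hor.IsFunctor E.hor ob onHor
  ver : D.ver.IsFunctor E.ver ob onVer
  hsq : D.hsq.IsFunctor E.hsq onVer onSq
  vsq : D.vsq.IsFunctor E.vsq onHor onSq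
  aug : ∀ x ∈ D.A, ob x ∈ E.A

theorem CatStr.IsFunctor.id {O M : Type u} (C : CatStr O M) : C.IsFunctor C id id :=
  ⟨fun _ => rfl, fun _ => rfl, fun _ => rfl, fun _ _ _ _ => rfl⟩

theorem CatStr.IsFunctor.trans {O M : Type u} {O' M' : Type v} {O'' M'' : Type w}
    {C : CatStr O M} {C' : CatStr O' M'} {C'' : CatStr O'' M''}
    {F₀ : O → O'} {F₁ : M → M'} {G₀ : O' → O''} {G₁ : M' → M''}
    (hF : C.IsFunctor C' F₀ F₁) (hG : C'.IsFunctor C'' G₀ G₁) :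
    C.IsFunctor C'' (G₀ ∘ F₀) (G₁ ∘ F₁) where
  src f := by simp [hF.src, hG.src]
  tgt f := by simp [hF.tgt, hG.tgt]
  one x := by simp [hF.one, hG.one]
  comp f g h h' := by
    have h1 : C'.tgt (F₁ f) = C'.src (F₁ g) := by rw [hF.tgt, hF.src, h]
    simp only [Function.comp]
    rw [hF.comp f g h h1, hG.comp _ _ h1 h']

/-- The identity double functor. -/
def AugDoubleFunctor.id (D : AugStDoubleCat.{u}) : AugDoubleFunctor D D where
  ob := _root_.id
  onHor := _root_.id
  onVer := _root_.id
  onSq := _root_.id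
  hor := .id _
  ver := .id _
  hsq := .id _
  vsq := .id _
  aug _ h := h

/-- Composition of augmented double functors: first `F`, then `G`. -/
def AugDoubleFunctor.comp {D : AugStDoubleCat.{u}} {E : AugStDoubleCat.{v}} {K : AugStDoubleCat.{w}}
    (F : AugDoubleFunctor D E) (G : AugDoubleFunctor E K) : AugDoubleFunctor D K where
  ob := G.ob ∘ F.ob
  onHor := G.onHor ∘ F.onHor
  onVer := G.onVer ∘ F.onVer
  onSq := G.onSq ∘ F.onSq
  hor := F.hor.trans G.hor
  ver := F.ver.trans G.ver
  hsq := F.hsq.trans G.hsq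
  vsq := F.vsq.trans G.vsq
  aug x h := G.aug _ (F.aug x h)

/-- The category of augmented stable double categories and augmented double functors. -/
instance : Category AugStDoubleCat.{u} where
  Hom D E := AugDoubleFunctor D E
  id D := AugDoubleFunctor.id D
  comp F G := AugDoubleFunctor.comp F G

/-- Objects `(i, j)`, `i ≤ j`, of `W n`. -/
@[ext]
structure WOb (n : ℕ) where
  i : Fin (n + 1)
  j : Fin (n + 1)
  hij : i ≤ j

/-- Horizontal morphisms `(i, j, l) : (i, j) → (i, l)`, `i ≤ j ≤ l`, of `W n`. -/
@[ext]
structure WHor (n : ℕ) where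
  i : Fin (n + 1)
  j : Fin (n + 1)
  l : Fin (n + 1)
  hij : i ≤ j
  hjl : j ≤ l

/-- Vertical morphisms `(i, k, j) : (i, j) → (k, j)`, `i ≤ k ≤ j`, of `W n`. -/
@[ext]
structure WVer (n : ℕ) where
  i : Fin (n + 1)
  k : Fin (n + 1)
  j : Fin (n + 1)
  hik : i ≤ k
  hkj : k ≤ j

/-- Squares `(i, k, j, l)`, `i ≤ k ≤ j ≤ l`, of `W n`, with corners `(i, j)`, `(i, l)`, `(k, j)`,
`(k, l)`. -/
@[ext]
structure WSq (n : ℕ) where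
  i : Fin (n + 1)
  k : Fin (n + 1)
  j : Fin (n + 1)
  l : Fin (n + 1)
  hik : i ≤ k
  hkj : k ≤ j
  hjl : j ≤ l

/-- The category of objects and horizontal morphisms of `W n`. -/
def wHor (n : ℕ) : CatStr (WOb n) (WHor n) where
  src f := ⟨f.i, f.j, f.hij⟩
  tgt f := ⟨f.i, f.l, f.hij.trans f.hjl⟩
  one x := ⟨x.i, x.j, x.j, x.hij, le_rfl⟩
  comp f g h := ⟨f.i, f.j, g.l, f.hij, f.hjl.trans ((congrArg WOb.j h).trans_le g.hjl)⟩
  src_one _ := rfl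
  tgt_one _ := rfl
  src_comp _ _ _ := rfl
  tgt_comp f g h := WOb.ext (show f.i = g.i from congrArg WOb.i h) rfl
  one_comp _ := rfl
  comp_one _ := rfl
  assoc _ _ _ _ _ := rfl

/-- The category of objects and vertical morphisms of `W n`. -/
def wVer (n : ℕ) : CatStr (WOb n) (WVer n) where
  src v := ⟨v.i, v.j, v.hik.trans v.hkj⟩
  tgt v := ⟨v.k, v.j, v.hkj⟩
  one x := ⟨x.i, x.i, x.j, le_rfl, x.hij⟩
  comp v w h := ⟨v.i, w.k, w.j, (v.hik.trans_eq (congrArg WOb.i h)).trans w.hik, w.hkj⟩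
  src_one _ := rfl
  tgt_one _ := rfl
  src_comp _ _ h := WOb.ext rfl (congrArg WOb.j h).symm
  tgt_comp _ _ _ := rfl
  one_comp _ := rfl
  comp_one _ := rfl
  assoc _ _ _ _ _ := rfl

/-- Horizontal composition of squares of `W n`. -/
def wHsq (n : ℕ) : CatStr (WVer n) (WSq n) where
  src a := ⟨a.i, a.k, a.j, a.hik, a.hkj⟩
  tgt a := ⟨a.i, a.k, a.l, a.hik, a.hkj.trans a.hjl⟩
  one v := ⟨v.i, v.k, v.j, v.j, v.hik, v.hkj, le_rfl⟩
  comp a b h := ⟨a.i, a.k, a.j, b.l, a.hik, a.hkj,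
    a.hjl.trans ((congrArg WVer.j h).trans_le b.hjl)⟩
  src_one _ := rfl
  tgt_one _ := rfl
  src_comp _ _ _ := rfl
  tgt_comp a b h := WVer.ext (show a.i = b.i from congrArg WVer.i h)
    (show a.k = b.k from congrArg WVer.k h) rfl
  one_comp _ := rfl
  comp_one _ := rfl
  assoc _ _ _ _ _ := rfl

/-- Vertical composition of squares of `W n`. -/
def wVsq (n : ℕ) : CatStr (WHor n) (WSq n) where
  src a := ⟨a.i, a.j, a.l, a.hik.trans a.hkj, a.hjl⟩
  tgt a := ⟨a.k, a.j, a.l, a.hkj, a.hjl⟩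
  one f := ⟨f.i, f.i, f.j, f.l, le_rfl, f.hij, f.hjl⟩
  comp a b h := ⟨a.i, b.k, b.j, b.l, (a.hik.trans_eq (congrArg WHor.i h)).trans b.hik,
    b.hkj, b.hjl⟩
  src_one _ := rfl
  tgt_one _ := rfl
  src_comp _ _ h := WHor.ext rfl (congrArg WHor.j h).symm (congrArg WHor.l h).symm
  tgt_comp _ _ _ := rfl
  one_comp _ := rfl
  comp_one _ := rfl
  assoc _ _ _ _ _ := rfl

/-- The augmented stable double category `W n`, with augmentation set `{(i, i)}`. -/
def W (n : ℕ) : AugStDoubleCat.{0} where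
  Ob := WOb n
  Hor := WHor n
  Ver := WVer n
  Sq := WSq n
  hor := wHor n
  ver := wVer n
  hsq := wHsq n
  vsq := wVsq n
  src_functor := ⟨fun _ => rfl, fun _ => rfl, fun _ => rfl, fun _ _ _ _ => rfl⟩
  tgt_functor := ⟨fun _ => rfl, fun _ => rfl, fun _ => rfl, fun _ _ _ _ => rfl⟩
  one_functor := ⟨fun _ => rfl, fun _ => rfl, fun _ => rfl, fun _ _ _ _ => rfl⟩
  comp_src _ _ _ _ := rfl
  comp_tgt _ _ _ _ := rfl
  comp_one _ _ _ _ := rfl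
  interchange a b c d hab hcd hac hbd h h' := by
    rfl
  A := {x | x.i = x.j}
  stable :=
    { span := fun f v h => by
        have h1 : f.i = v.i := congrArg WOb.i h
        have h2 : f.j = v.j := congrArg WOb.j h
        refine ⟨⟨v.i, v.k, v.j, f.l, v.hik, v.hkj, h2 ▸ f.hjl⟩, ⟨?_, rfl⟩, ?_⟩
        · exact WHor.ext h1.symm h2.symm rfl
        · rintro a ⟨rfl, rfl⟩
          rfl
      cospan := fun v f h => by
        have h1 : v.k = f.i := congrArg WOb.i h
        have h2 : v.j = f.l := congrArg WOb.j h
        refine ⟨⟨v.i, v.k, f.j, f.l, v.hik, h1 ▸ f.hij, f.hjl⟩, ⟨?_, ?_⟩, ?_⟩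
        · exact WVer.ext rfl rfl h2.symm
        · exact WHor.ext h1 rfl rfl
        · rintro a ⟨rfl, rfl⟩
          rfl }
  augmented :=
    { hor := fun x => by
        refine ⟨⟨x.i, x.i, x.j, le_rfl, x.hij⟩, ⟨rfl, rfl⟩, ?_⟩
        rintro f ⟨h, rfl⟩
        exact WHor.ext rfl (Eq.symm h) rfl
      ver := fun x => by
        refine ⟨⟨x.i, x.j, x.j, x.hij, le_rfl⟩, ⟨rfl, rfl⟩, ?_⟩
        rintro f ⟨h, rfl⟩
        exact WVer.ext rfl h rfl }

/-- The functoriality of `W n` in the ordinal `[n]`. -/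
def W.map {m n : ℕ} (φ : Fin (m + 1) →o Fin (n + 1)) : AugDoubleFunctor (W m) (W n) where
  ob x := ⟨φ x.i, φ x.j, φ.monotone x.hij⟩
  onHor f := ⟨φ f.i, φ f.j, φ f.l, φ.monotone f.hij, φ.monotone f.hjl⟩
  onVer v := ⟨φ v.i, φ v.k, φ v.j, φ.monotone v.hik, φ.monotone v.hkj⟩
  onSq a := ⟨φ a.i, φ a.k, φ a.j, φ a.l, φ.monotone a.hik, φ.monotone a.hkj, φ.monotone a.hjl⟩
  hor := ⟨fun _ => rfl, fun _ => rfl, fun _ => rfl, fun _ _ _ _ => rfl⟩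
  ver := ⟨fun _ => rfl, fun _ => rfl, fun _ => rfl, fun _ _ _ _ => rfl⟩
  hsq := ⟨fun _ => rfl, fun _ => rfl, fun _ => rfl, fun _ _ _ _ => rfl⟩
  vsq := ⟨fun _ => rfl, fun _ => rfl, fun _ => rfl, fun _ _ _ _ => rfl⟩
  aug _ h := congrArg φ h

/-- The cosimplicial augmented stable double category `[n] ↦ W n`. -/
def wFunctor : SimplexCategory ⥤ AugStDoubleCat.{0} where
  obj n := W n.len
  map φ := W.map φ.toOrderHom

/-- The functor `Hom(-, D)`, restricted to double categories in the lowest universe. -/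
def homInto (D : AugStDoubleCat.{u}) : AugStDoubleCat.{0}ᵒᵖ ⥤ Type u where
  obj C := AugDoubleFunctor C.unop D
  map F := ↾(fun G => AugDoubleFunctor.comp F.unop G)

/-- Postcomposition `Hom(-, D) → Hom(-, E)`. -/
def homIntoMap {D E : AugStDoubleCat.{u}} (G : D ⟶ E) : homInto D ⟶ homInto E where
  app C := ↾(fun F => AugDoubleFunctor.comp F G)

/-- The functor `D ↦ Hom(-, D)`. -/
def homIntoFunctor : AugStDoubleCat.{u} ⥤ AugStDoubleCat.{0}ᵒᵖ ⥤ Type u where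
  obj D := homInto D
  map G := homIntoMap G

/-- The category `Σ`: the product `Δ × Δ` with a new terminal object `[-1]` added. -/
abbrev SigmaCat := WithTerminal (SimplexCategory × SimplexCategory)

/-- The ordinal sum `f + g : [a] + [b] → [c] + [d]` of two monotone maps, with `[a] + [b] = [a + 1 + b]`. -/
def ordinalSumHom {a b c d : ℕ} (f : Fin (a + 1) →o Fin (c + 1)) (g : Fin (b + 1) →o Fin (d + 1)) :
    Fin (a + 1 + b + 1) →o Fin (c + 1 + d + 1) where
  toFun i := if h : i.val < a + 1 then ⟨(f ⟨i.val, h⟩).val, by omega⟩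
    else ⟨c + 1 + (g ⟨i.val - (a + 1), by omega⟩).val, by omega⟩
  monotone' i j hij := by
    have hij' : i.val ≤ j.val := hij
    dsimp only
    split_ifs with h1 h2 h2
    · exact f.monotone (show (⟨i.val, h1⟩ : Fin (a + 1)) ≤ ⟨j.val, h2⟩ from hij')
    · rw [Fin.le_def]; dsimp only; omega
    · omega
    · have := g.monotone (show (⟨i.val - (a + 1), by omega⟩ : Fin (b + 1)) ≤
        ⟨j.val - (a + 1), by omega⟩ from Nat.sub_le_sub_right hij' _)
      rw [Fin.le_def] at this ⊢
      dsimp only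
      omega

/-- The ordinal sum functor `Δ × Δ → Δ`. -/
def ordinalSum : SimplexCategory × SimplexCategory ⥤ SimplexCategory where
  obj x := ⦋x.1.len + 1 + x.2.len⦌
  map f := SimplexCategory.mkHom (ordinalSumHom f.1.toOrderHom f.2.toOrderHom)
  map_id x := by
    apply simplexHom_ext
    intro i
    change (ordinalSumHom (OrderHom.id) (OrderHom.id) i).val = i.val
    simp only [ordinalSumHom, OrderHom.coe_mk, OrderHom.id_coe, id]
    split_ifs
    · rfl
    · simp only
      omega
  map_comp {x _ _} f g := by
    apply simplexHom_ext
    intro i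
    change (ordinalSumHom (g.1.toOrderHom.comp f.1.toOrderHom)
      (g.2.toOrderHom.comp f.2.toOrderHom) i).val =
      (ordinalSumHom g.1.toOrderHom g.2.toOrderHom
        (ordinalSumHom f.1.toOrderHom f.2.toOrderHom i)).val
    by_cases h : i.val < x.1.len + 1
    · have h1 : ordinalSumHom f.1.toOrderHom f.2.toOrderHom i = ⟨_, _⟩ := dif_pos h
      rw [h1]
      refine (congrArg Fin.val (dif_pos h)).trans
        (Eq.trans ?_ (congrArg Fin.val (dif_pos ?_)).symm)
      rfl
    · have h1 : ordinalSumHom f.1.toOrderHom f.2.toOrderHom i = ⟨_, _⟩ := dif_neg h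
      rw [h1]
      refine (congrArg Fin.val (dif_neg h)).trans
        (Eq.trans ?_ (congrArg Fin.val (dif_neg ?_)).symm)
      · simp
      · simp only
        omega

/-- The functor `p : Σ → Δ` that extends the ordinal sum: `p(q, r) = [q + 1 + r]`, `p(-1) = [0]`, and
`(q, r) → [-1]` is mapped to the unique map to `[0]`. -/
def ordinalSumExt : SigmaCat ⥤ SimplexCategory :=
  WithTerminal.liftToTerminal ordinalSum SimplexCategory.isTerminalZero

/-- Preaugmented bisimplicial sets: functors `Σᵒᵖ → Set`. -/
abbrev PreaugBisimplicialSet := SigmaCatᵒᵖ ⥤ Type u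

/-- The generalized path construction `p^*`: precomposition with `p`. -/
def pUpper : SSet.{u} ⥤ PreaugBisimplicialSet.{u} :=
  (Functor.whiskeringLeft _ _ _).obj ordinalSumExt.op

/-- The generalized Waldhausen construction `p_*`: right Kan extension along `p`. -/
noncomputable def pLower : PreaugBisimplicialSet.{u} ⥤ SSet.{u} := ordinalSumExt.op.ran

/-- The adjunction `p^* ⊣ p_*`. -/
noncomputable def pAdjunction : pUpper.{u} ⊣ pLower.{u} := ordinalSumExt.op.ranAdjunction (Type u)

/-- The augmented double nerve `N^a`: the functor `Hom(-, D)` applied to `Σ → Δ → DCat`,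
the composite of `p` and `[n] ↦ W n`. -/
def augNerve : AugStDoubleCat.{u} ⥤ PreaugBisimplicialSet.{u} :=
  homIntoFunctor ⋙ (Functor.whiskeringLeft _ _ _).obj (ordinalSumExt ⋙ wFunctor).op

/-- The Waldhausen construction `S_•`, as a functor to simplicial sets: `S_n D = Hom(W n, D)`. -/
def waldhausenConstruction : AugStDoubleCat.{u} ⥤ SSet.{u} :=
  homIntoFunctor ⋙ (Functor.whiskeringLeft _ _ _).obj wFunctor.op

theorem map_map_eq (X : SSet.{u}) {a b b' c : SimplexCategory} {f : a ⟶ b} {g : b ⟶ c}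
    {f' : a ⟶ b'} {g' : b' ⟶ c} (h : f ≫ g = f' ≫ g') (y : X.obj (op c)) :
    X.map f.op (X.map g.op y) = X.map f'.op (X.map g'.op y) := by
  rw [map_map_op, map_map_op, h]

theorem map_map_eq_self (X : SSet.{u}) {a b : SimplexCategory} {f : a ⟶ b} {g : b ⟶ a}
    (h : f ≫ g = 𝟙 a) (y : X.obj (op a)) : X.map f.op (X.map g.op y) = y := by
  rw [map_map_op, h]; simp

/-- A category structure whose composition is defined by unique fillers: `T` is a set of "composable
pairs with a composite", `fst`, `snd`, `cmp` extract the two morphisms and their composite, every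
composable pair `f`, `g` has a unique filler `z` in `T`, and the composite of `f` and `g` is `cmp z`.
The elements `L f` and `R f` of `T` and the hypothesis `assoc` give the unit and associativity laws. -/
noncomputable def CatStr.ofFillers {O M T : Type u} (s t : M → O) (e : O → M)
    (fst snd cmp : T → M) (L R : M → T)
    (s_e : ∀ x, s (e x) = x) (t_e : ∀ x, t (e x) = x)
    (s_cmp : ∀ z, s (cmp z) = s (fst z)) (t_cmp : ∀ z, t (cmp z) = t (snd z))
    (fst_L : ∀ f, fst (L f) = e (s f)) (snd_L : ∀ f, snd (L f) = f) (cmp_L : ∀ f, cmp (L f) = f)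
    (fst_R : ∀ f, fst (R f) = f) (snd_R : ∀ f, snd (R f) = e (t f)) (cmp_R : ∀ f, cmp (R f) = f)
    (fill : ∀ f g, t f = s g → ∃! z, fst z = f ∧ snd z = g)
    (assoc : ∀ f g k, t f = s g → t g = s k → ∃ z₁ z₂ z₃ z₄,
      (fst z₁ = f ∧ snd z₁ = g) ∧ (fst z₂ = cmp z₁ ∧ snd z₂ = k) ∧
      (fst z₃ = g ∧ snd z₃ = k) ∧ (fst z₄ = f ∧ snd z₄ = cmp z₃) ∧ cmp z₂ = cmp z₄) : CatStr O M :=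
  have key : ∀ z z', fst z = fst z' → snd z = snd z' → t (fst z') = s (snd z') → z = z' :=
    fun z z' h1 h2 h => (fill _ _ h).unique ⟨h1, h2⟩ ⟨rfl, rfl⟩
  { src := s
    tgt := t
    one := e
    comp := fun f g h => cmp (fill f g h).choose
    src_one := s_e
    tgt_one := t_e
    src_comp := fun f g h => by rw [s_cmp, (fill f g h).choose_spec.1.1]
    tgt_comp := fun f g h => by rw [t_cmp, (fill f g h).choose_spec.1.2]
    one_comp := fun f => by
      have h := (fill (e (s f)) f (t_e _)).choose_spec.1
      rw [key _ (L f) (h.1.trans (fst_L f).symm) (h.2.trans (snd_L f).symm)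
        (by rw [fst_L, snd_L, t_e]), cmp_L]
    comp_one := fun f => by
      have h := (fill f (e (t f)) (s_e _).symm).choose_spec.1
      rw [key _ (R f) (h.1.trans (fst_R f).symm) (h.2.trans (snd_R f).symm)
        (by rw [fst_R, snd_R, s_e]), cmp_R]
    assoc := fun f g k hfg hgk => by
      obtain ⟨z₁, z₂, z₃, z₄, h1, h2, h3, h4, e⟩ := assoc f g k hfg hgk
      obtain rfl : (fill f g hfg).choose = z₁ := ((fill f g hfg).choose_spec.2 z₁ h1).symm
      obtain rfl : (fill g k hgk).choose = z₃ := ((fill g k hgk).choose_spec.2 z₃ h3).symm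
      exact (congrArg cmp ((fill _ k (by rw [t_cmp, h1.2, hgk])).choose_spec.2 z₂ h2).symm).trans
        (e.trans (congrArg cmp ((fill f _ (by rw [s_cmp, h3.1, hfg])).choose_spec.2 z₄ h4))) }

section Path

variable {X : SSet.{u}}

theorem map_id_op (X : SSet.{u}) {a : SimplexCategory} (y : X.obj (op a)) :
    X.map (𝟙 a).op y = y := by simp

theorem face_face (X : SSet.{u}) {n : ℕ} {i i' : Fin (n + 2)} {j j' : Fin (n + 3)}
    (h : SimplexCategory.δ i ≫ SimplexCategory.δ j = SimplexCategory.δ i' ≫ SimplexCategory.δ j')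
    (y : X _⦋n + 2⦌) : X.δ i (X.δ j y) = X.δ i' (X.δ j' y) :=
  map_map_eq X h y

theorem IsTwoSegal.ear' (hX : IsTwoSegal X) {m : ℕ} (k : Fin (m + 2)) {c : SimplexCategory}
    {d : ⦋m + 2⦌ ⟶ ⦋m + 3⦌} {r : ⦋2⦌ ⟶ c} {s : c ⟶ ⦋m + 3⦌} {e : ⦋1⦌ ⟶ ⦋m + 2⦌}
    {e' : ⦋1⦌ ⟶ c}
    (hd : d = SimplexCategory.δ k.succ.castSucc) (ht : r ≫ s = earTriangle k)
    (he : e = SimplexCategory.mkOfSucc k) (y : X _⦋m + 2⦌) (t : X.obj (op c))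
    (he' : SimplexCategory.δ 1 ≫ r = e')
    (h : X.map e.op y = X.map e'.op t) :
    ∃ w : X _⦋m + 3⦌, X.map d.op w = y ∧ X.map r.op (X.map s.op w) = X.map r.op t ∧
      ∀ w', X.map d.op w' = y → X.map r.op (X.map s.op w') = X.map r.op t → w' = w := by
  subst hd he he'
  obtain ⟨w, ⟨h1, h2⟩, h3⟩ := hX.ear k y (X.map r.op t) (by
    rw [h]; simp only [SimplicialObject.δ, map_map_op])
  refine ⟨w, h1, by rw [map_map_op, ht, h2], fun w' h1' h2' => h3 w' ⟨h1', ?_⟩⟩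
  rw [← ht, ← map_map_op, h2']

theorem fill_hor (hX : IsTwoSegal X) (f g : X _⦋2⦌) (h : X.δ 1 f = X.δ 2 g) :
    ∃! z : X _⦋3⦌, X.δ 3 z = f ∧ X.δ 1 z = g := by
  obtain ⟨w, h1, h2, h3⟩ := hX.ear' (m := 0) 0 (d := SimplexCategory.δ 1) (r := 𝟙 _)
    (s := SimplexCategory.δ 3) (e := SimplexCategory.δ 2) (e' := SimplexCategory.δ 1)
    (by decide) (by decide) (by decide) g f (by decide) h.symm
  simp only [map_id_op] at h2 h3
  exact ⟨w, ⟨h2, h1⟩, fun w' h' => h3 w' h'.2 h'.1⟩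

theorem fill_ver (hX : IsTwoSegal X) (f g : X _⦋2⦌) (h : X.δ 0 f = X.δ 1 g) :
    ∃! z : X _⦋3⦌, X.δ 2 z = f ∧ X.δ 0 z = g := by
  obtain ⟨w, h1, h2, h3⟩ := hX.ear' (m := 0) 1 (d := SimplexCategory.δ 2) (r := 𝟙 _)
    (s := SimplexCategory.δ 0) (e := SimplexCategory.δ 0) (e' := SimplexCategory.δ 1)
    (by decide) (by decide) (by decide) f g (by decide) h
  simp only [map_id_op] at h2 h3
  exact ⟨w, ⟨h1, h2⟩, fun w' h' => h3 w' h'.1 h'.2⟩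

theorem ext_hor (hX : IsTwoSegal X) {z z' : X _⦋3⦌} (h₁ : X.δ 1 z = X.δ 1 z')
    (h₂ : X.δ 3 z = X.δ 3 z') : z = z' :=
  (fill_hor hX (X.δ 3 z') (X.δ 1 z') (face_face X (by decide) z')).unique ⟨h₂, h₁⟩ ⟨rfl, rfl⟩

theorem ext_ver (hX : IsTwoSegal X) {z z' : X _⦋3⦌} (h₁ : X.δ 2 z = X.δ 2 z')
    (h₂ : X.δ 0 z = X.δ 0 z') : z = z' :=
  (fill_ver hX (X.δ 2 z') (X.δ 0 z') (face_face X (by decide) z')).unique ⟨h₁, h₂⟩ ⟨rfl, rfl⟩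

theorem fill_hsq (hX : IsTwoSegal X) (f g : X _⦋3⦌) (h : X.δ 2 f = X.δ 3 g) :
    ∃! z : X _⦋4⦌, X.δ 4 z = f ∧ X.δ 2 z = g := by
  obtain ⟨w, h1, h2, h3⟩ := hX.ear' (m := 1) 1 (d := SimplexCategory.δ 2)
    (r := SimplexCategory.δ 0) (s := SimplexCategory.δ 4)
    (e := SimplexCategory.δ 0 ≫ SimplexCategory.δ 3)
    (e' := SimplexCategory.δ 0 ≫ SimplexCategory.δ 2)
    (by decide) (by decide) (by decide) g f (by decide)
    (by
      rw [← map_map_op, ← map_map_op]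
      exact congrArg (X.δ (0 : Fin 3)) h.symm)
  refine ⟨w, ⟨ext_ver hX ?_ h2, h1⟩, fun w' h' => h3 w' h'.2 (congrArg (X.δ (0 : Fin 4)) h'.1)⟩
  exact ((face_face X (by decide) w).trans (congrArg (X.δ (3 : Fin 4)) h1)).trans h.symm

theorem fill_vsq (hX : IsTwoSegal X) (f g : X _⦋3⦌) (h : X.δ 0 f = X.δ 1 g) :
    ∃! z : X _⦋4⦌, X.δ 2 z = f ∧ X.δ 0 z = g := by
  obtain ⟨w, h1, h2, h3⟩ := hX.ear' (m := 1) 1 (d := SimplexCategory.δ 2)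
    (r := SimplexCategory.δ 3) (s := SimplexCategory.δ 0)
    (e := SimplexCategory.δ 2 ≫ SimplexCategory.δ 0)
    (e' := SimplexCategory.δ 2 ≫ SimplexCategory.δ 1)
    (by decide) (by decide) (by decide) f g (by decide)
    (by
      rw [← map_map_op, ← map_map_op]
      exact congrArg (X.δ (2 : Fin 3)) h)
  refine ⟨w, ⟨h1, ext_hor hX ?_ h2⟩, fun w' h' => h3 w' h'.1 (congrArg (X.δ (3 : Fin 4)) h'.2)⟩
  exact ((face_face X (by decide) w).trans (congrArg (X.δ (0 : Fin 4)) h1)).trans h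

theorem fill_hsq₃ (hX : IsTwoSegal X) (f g : X _⦋4⦌) (h : X.δ 3 f = X.δ 4 g) :
    ∃ z : X _⦋5⦌, X.δ 5 z = f ∧ X.δ 3 z = g := by
  obtain ⟨w, h1, h2, -⟩ := hX.ear' (m := 2) 2 (d := SimplexCategory.δ 3)
    (r := SimplexCategory.δ 0 ≫ SimplexCategory.δ 0) (s := SimplexCategory.δ 5)
    (e := (SimplexCategory.δ 0 ≫ SimplexCategory.δ 0) ≫ SimplexCategory.δ 4)
    (e' := (SimplexCategory.δ 0 ≫ SimplexCategory.δ 0) ≫ SimplexCategory.δ 3)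
    (by decide) (by decide) (by decide) g f (by decide)
    (by
      have := congrArg (X.map (SimplexCategory.δ (0 : Fin 3) ≫ SimplexCategory.δ (0 : Fin 4)).op)
        h.symm
      simp only [SimplicialObject.δ, map_map_op] at this
      exact this)
  refine ⟨w, ?_, h1⟩
  have h4 : X.δ 3 (X.δ 5 w) = X.δ 3 f :=
    ((face_face X (by decide) w).trans (congrArg (X.δ (4 : Fin 5)) h1)).trans h.symm
  obtain ⟨u, -, -, h3⟩ := hX.ear' (m := 1) 2 (d := SimplexCategory.δ 3)
    (r := SimplexCategory.δ 0) (s := SimplexCategory.δ 0)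
    (e := SimplexCategory.δ 0 ≫ SimplexCategory.δ 0)
    (e' := SimplexCategory.δ 0 ≫ SimplexCategory.δ 2)
    (by decide) (by decide) (by decide) (X.δ (3 : Fin 5) f) (X.δ (0 : Fin 5) f) (by decide)
    (by
      simp only [SimplicialObject.δ, map_map_op]
      exact congrArg (fun a => X.map (Quiver.Hom.op a) f) (by decide))
  rw [h3 f rfl rfl]
  refine h3 _ h4 ?_
  simp only [SimplicialObject.δ, map_map_op] at h2 ⊢
  exact h2

theorem fill_vsq₃ (hX : IsTwoSegal X) (f g : X _⦋4⦌) (h : X.δ 0 f = X.δ 1 g) :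
    ∃ z : X _⦋5⦌, X.δ 2 z = f ∧ X.δ 0 z = g := by
  obtain ⟨w, h1, h2, -⟩ := hX.ear' (m := 2) 1 (d := SimplexCategory.δ 2)
    (r := SimplexCategory.δ 3 ≫ SimplexCategory.δ 3) (s := SimplexCategory.δ 0)
    (e := (SimplexCategory.δ 2 ≫ SimplexCategory.δ 2) ≫ SimplexCategory.δ 0)
    (e' := (SimplexCategory.δ 2 ≫ SimplexCategory.δ 2) ≫ SimplexCategory.δ 1)
    (by decide) (by decide) (by decide) f g (by decide)
    (by
      have := congrArg (X.map (SimplexCategory.δ (2 : Fin 3) ≫ SimplexCategory.δ (2 : Fin 4)).op) h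
      simp only [SimplicialObject.δ, map_map_op] at this
      exact this)
  refine ⟨w, h1, ?_⟩
  have h4 : X.δ 1 (X.δ 0 w) = X.δ 1 g :=
    ((face_face X (by decide) w).trans (congrArg (X.δ (0 : Fin 5)) h1)).trans h
  obtain ⟨u, -, -, h3⟩ := hX.ear' (m := 1) 0 (d := SimplexCategory.δ 1)
    (r := SimplexCategory.δ 3) (s := SimplexCategory.δ 3)
    (e := SimplexCategory.δ 2 ≫ SimplexCategory.δ 2)
    (e' := SimplexCategory.δ 1 ≫ SimplexCategory.δ 3)
    (by decide) (by decide) (by decide) (X.δ (1 : Fin 5) g) (X.δ (3 : Fin 5) g) (by decide)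
    (by
      simp only [SimplicialObject.δ, map_map_op]
      exact congrArg (fun a => X.map (Quiver.Hom.op a) g) (by decide))
  rw [h3 g rfl rfl]
  refine h3 _ h4 ?_
  simp only [SimplicialObject.δ, map_map_op] at h2 ⊢
  exact h2

theorem deg_face (X : SSet.{u}) {n : ℕ} {i : Fin (n + 2)} {j : Fin (n + 1)}
    (h : SimplexCategory.δ i ≫ SimplexCategory.σ j = 𝟙 ⦋n⦌) (y : X _⦋n⦌) :
    X.δ i (X.σ j y) = y :=
  map_map_eq_self X h y

theorem face_deg (X : SSet.{u}) {n : ℕ} {i : Fin (n + 3)} {j : Fin (n + 2)}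
    {i' : Fin (n + 2)} {j' : Fin (n + 1)}
    (h : SimplexCategory.δ i ≫ SimplexCategory.σ j = SimplexCategory.σ j' ≫ SimplexCategory.δ i')
    (y : X _⦋n + 1⦌) : X.δ i (X.σ j y) = X.σ j' (X.δ i' y) :=
  map_map_eq X h y

/-- Objects `X₁`, morphisms `X₂`; source `d₂`, target `d₁`, identity `s₁`. The composite is `d₂ z` for
the unique 3-simplex `z` with `d₃ z` the first and `d₁ z` the second morphism. -/
noncomputable def pathHor (hX : IsTwoSegal X) : CatStr (X _⦋1⦌) (X _⦋2⦌) :=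
  CatStr.ofFillers (X.δ 2) (X.δ 1) (X.σ 1) (X.δ (3 : Fin 4)) (X.δ (1 : Fin 4)) (X.δ (2 : Fin 4))
    (X.σ (1 : Fin 3)) (X.σ (2 : Fin 3))
    (deg_face X (by decide)) (deg_face X (by decide))
    (face_face X (by decide)) (face_face X (by decide))
    (face_deg X (by decide)) (deg_face X (by decide)) (deg_face X (by decide))
    (deg_face X (by decide)) (face_deg X (by decide)) (deg_face X (by decide))
    (fill_hor hX)
    (fun f g k hfg hgk => by
      obtain ⟨z₁, ⟨rfl, rfl⟩, -⟩ := fill_hor hX f g hfg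
      obtain ⟨z₂, ⟨h, rfl⟩, -⟩ := fill_hor hX (X.δ (2 : Fin 4) z₁) k
        ((face_face X (by decide) z₁).trans hgk)
      obtain ⟨w, ⟨rfl, rfl⟩, -⟩ := fill_hsq hX z₁ z₂ h.symm
      exact ⟨_, _, X.δ (1 : Fin 5) w, X.δ (3 : Fin 5) w, ⟨rfl, rfl⟩, ⟨h, rfl⟩,
        ⟨face_face X (by decide) w, face_face X (by decide) w⟩,
        ⟨face_face X (by decide) w, face_face X (by decide) w⟩, face_face X (by decide) w⟩)

/-- Objects `X₁`, morphisms `X₂`; source `d₁`, target `d₀`, identity `s₀`. The composite is `d₁ z` for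
the unique 3-simplex `z` with `d₂ z` the first and `d₀ z` the second morphism. -/
noncomputable def pathVer (hX : IsTwoSegal X) : CatStr (X _⦋1⦌) (X _⦋2⦌) :=
  CatStr.ofFillers (X.δ 1) (X.δ 0) (X.σ 0) (X.δ (2 : Fin 4)) (X.δ (0 : Fin 4)) (X.δ (1 : Fin 4))
    (X.σ (0 : Fin 3)) (X.σ (1 : Fin 3))
    (deg_face X (by decide)) (deg_face X (by decide))
    (face_face X (by decide)) (face_face X (by decide))
    (face_deg X (by decide)) (deg_face X (by decide)) (deg_face X (by decide))
    (deg_face X (by decide)) (face_deg X (by decide)) (deg_face X (by decide))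
    (fill_ver hX)
    (fun f g k hfg hgk => by
      obtain ⟨z₃, ⟨rfl, rfl⟩, -⟩ := fill_ver hX g k hgk
      obtain ⟨z₄, ⟨rfl, h⟩, -⟩ := fill_ver hX f (X.δ (1 : Fin 4) z₃)
        (hfg.trans (face_face X (by decide) z₃))
      obtain ⟨w, ⟨rfl, rfl⟩, -⟩ := fill_vsq hX z₄ z₃ h
      exact ⟨X.δ (3 : Fin 5) w, X.δ (1 : Fin 5) w, _, _,
        ⟨face_face X (by decide) w, face_face X (by decide) w⟩,
        ⟨face_face X (by decide) w, face_face X (by decide) w⟩, ⟨rfl, rfl⟩, ⟨rfl, h⟩,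
        face_face X (by decide) w⟩)

/-- Objects `X₂`, morphisms `X₃`; source `d₃`, target `d₂`, identity `s₂`. The composite is `d₃ z` for
the unique 4-simplex `z` with `d₄ z` the first and `d₂ z` the second morphism. -/
noncomputable def pathHsq (hX : IsTwoSegal X) : CatStr (X _⦋2⦌) (X _⦋3⦌) :=
  CatStr.ofFillers (X.δ 3) (X.δ 2) (X.σ 2) (X.δ (4 : Fin 5)) (X.δ (2 : Fin 5)) (X.δ (3 : Fin 5))
    (X.σ (2 : Fin 4)) (X.σ (3 : Fin 4))
    (deg_face X (by decide)) (deg_face X (by decide))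
    (face_face X (by decide)) (face_face X (by decide))
    (face_deg X (by decide)) (deg_face X (by decide)) (deg_face X (by decide))
    (deg_face X (by decide)) (face_deg X (by decide)) (deg_face X (by decide))
    (fill_hsq hX)
    (fun f g k hfg hgk => by
      obtain ⟨z₁, ⟨rfl, rfl⟩, -⟩ := fill_hsq hX f g hfg
      obtain ⟨z₂, ⟨h, rfl⟩, -⟩ := fill_hsq hX (X.δ (3 : Fin 5) z₁) k
        ((face_face X (by decide) z₁).trans hgk)
      obtain ⟨w, rfl, rfl⟩ := fill_hsq₃ hX z₁ z₂ h.symm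
      exact ⟨_, _, X.δ (2 : Fin 6) w, X.δ (4 : Fin 6) w, ⟨rfl, rfl⟩, ⟨h, rfl⟩,
        ⟨face_face X (by decide) w, face_face X (by decide) w⟩,
        ⟨face_face X (by decide) w, face_face X (by decide) w⟩, face_face X (by decide) w⟩)

/-- Objects `X₂`, morphisms `X₃`; source `d₁`, target `d₀`, identity `s₀`. The composite is `d₁ z` for
the unique 4-simplex `z` with `d₂ z` the first and `d₀ z` the second morphism. -/
noncomputable def pathVsq (hX : IsTwoSegal X) : CatStr (X _⦋2⦌) (X _⦋3⦌) :=
  CatStr.ofFillers (X.δ 1) (X.δ 0) (X.σ 0) (X.δ (2 : Fin 5)) (X.δ (0 : Fin 5)) (X.δ (1 : Fin 5))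
    (X.σ (0 : Fin 4)) (X.σ (1 : Fin 4))
    (deg_face X (by decide)) (deg_face X (by decide))
    (face_face X (by decide)) (face_face X (by decide))
    (face_deg X (by decide)) (deg_face X (by decide)) (deg_face X (by decide))
    (deg_face X (by decide)) (face_deg X (by decide)) (deg_face X (by decide))
    (fill_vsq hX)
    (fun f g k hfg hgk => by
      obtain ⟨z₃, ⟨rfl, rfl⟩, -⟩ := fill_vsq hX g k hgk
      obtain ⟨z₄, ⟨rfl, h⟩, -⟩ := fill_vsq hX f (X.δ (1 : Fin 5) z₃)
        (hfg.trans (face_face X (by decide) z₃))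
      obtain ⟨w, rfl, rfl⟩ := fill_vsq₃ hX z₄ z₃ h
      exact ⟨X.δ (3 : Fin 6) w, X.δ (1 : Fin 6) w, _, _,
        ⟨face_face X (by decide) w, face_face X (by decide) w⟩,
        ⟨face_face X (by decide) w, face_face X (by decide) w⟩, ⟨rfl, rfl⟩, ⟨rfl, h⟩,
        face_face X (by decide) w⟩)

theorem pathHor_comp (hX : IsTwoSegal X) {f g : X _⦋2⦌} (z : X _⦋3⦌)
    (hf : X.δ 3 z = f) (hg : X.δ 1 z = g) (h : (pathHor hX).tgt f = (pathHor hX).src g) :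
    (pathHor hX).comp f g h = X.δ 2 z :=
  congrArg (X.δ 2) ((fill_hor hX f g h).choose_spec.2 z ⟨hf, hg⟩).symm

theorem pathVer_comp (hX : IsTwoSegal X) {f g : X _⦋2⦌} (z : X _⦋3⦌)
    (hf : X.δ 2 z = f) (hg : X.δ 0 z = g) (h : (pathVer hX).tgt f = (pathVer hX).src g) :
    (pathVer hX).comp f g h = X.δ 1 z :=
  congrArg (X.δ 1) ((fill_ver hX f g h).choose_spec.2 z ⟨hf, hg⟩).symm

theorem pathHsq_comp (hX : IsTwoSegal X) {f g : X _⦋3⦌} (z : X _⦋4⦌)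
    (hf : X.δ 4 z = f) (hg : X.δ 2 z = g) (h : (pathHsq hX).tgt f = (pathHsq hX).src g) :
    (pathHsq hX).comp f g h = X.δ 3 z :=
  congrArg (X.δ 3) ((fill_hsq hX f g h).choose_spec.2 z ⟨hf, hg⟩).symm

theorem pathVsq_comp (hX : IsTwoSegal X) {f g : X _⦋3⦌} (z : X _⦋4⦌)
    (hf : X.δ 2 z = f) (hg : X.δ 0 z = g) (h : (pathVsq hX).tgt f = (pathVsq hX).src g) :
    (pathVsq hX).comp f g h = X.δ 1 z :=
  congrArg (X.δ 1) ((fill_vsq hX f g h).choose_spec.2 z ⟨hf, hg⟩).symm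

/-- The double category of the path construction: `Ob = X₁`, `Hor = Ver = X₂`, `Sq = X₃`. -/
noncomputable def pathDoubleCat (hX : IsTwoSegal X) : DoubleCat.{u} where
  Ob := X _⦋1⦌
  Hor := X _⦋2⦌
  Ver := X _⦋2⦌
  Sq := X _⦋3⦌
  hor := pathHor hX
  ver := pathVer hX
  hsq := pathHsq hX
  vsq := pathVsq hX
  src_functor :=
    { src := fun a => face_face X (by decide) a
      tgt := fun a => face_face X (by decide) a
      one := fun f => face_deg X (by decide) f
      comp := fun a b h h' => by
        obtain ⟨w, ⟨rfl, rfl⟩, -⟩ := fill_vsq hX a b h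
        rw [pathVsq_comp hX w rfl rfl]
        refine Eq.trans ?_ (pathVer_comp hX (X.δ 4 w) ?_ ?_ h').symm <;>
          exact face_face X (by decide) w }
  tgt_functor :=
    { src := fun a => face_face X (by decide) a
      tgt := fun a => face_face X (by decide) a
      one := fun f => face_deg X (by decide) f
      comp := fun a b h h' => by
        obtain ⟨w, ⟨rfl, rfl⟩, -⟩ := fill_vsq hX a b h
        rw [pathVsq_comp hX w rfl rfl]
        refine Eq.trans ?_ (pathVer_comp hX (X.δ 3 w) ?_ ?_ h').symm <;>
          exact face_face X (by decide) w }
  one_functor :=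
    { src := fun v => face_deg X (by decide) v
      tgt := fun v => face_deg X (by decide) v
      one := fun x => map_map_eq X (by decide) x
      comp := fun a b h h' => by
        obtain ⟨w, ⟨rfl, rfl⟩, -⟩ := fill_ver hX a b h
        rw [pathVer_comp hX w rfl rfl]
        refine Eq.trans ?_ (pathVsq_comp hX (X.σ 3 w) ?_ ?_ h').symm
        · exact (face_deg X (by decide) w).symm
        · exact face_deg X (by decide) w
        · exact face_deg X (by decide) w }
  comp_src := fun a b h h' => by
    obtain ⟨w, ⟨rfl, rfl⟩, -⟩ := fill_hsq hX a b h
    rw [pathHsq_comp hX w rfl rfl]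
    refine Eq.trans ?_ (pathHor_comp hX (X.δ 1 w) ?_ ?_ h').symm <;>
      exact face_face X (by decide) w
  comp_tgt := fun a b h h' => by
    obtain ⟨w, ⟨rfl, rfl⟩, -⟩ := fill_hsq hX a b h
    rw [pathHsq_comp hX w rfl rfl]
    refine Eq.trans ?_ (pathHor_comp hX (X.δ 0 w) ?_ ?_ h').symm <;>
      exact face_face X (by decide) w
  comp_one := fun f g h h' => by
    obtain ⟨w, ⟨rfl, rfl⟩, -⟩ := fill_hor hX f g h
    rw [pathHor_comp hX w rfl rfl]
    refine (pathHsq_comp hX (X.σ 0 w) ?_ ?_ h').trans ?_ <;>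
      exact face_deg X (by decide) w
  interchange := fun a b c d hab hcd hac hbd h h' => by
    obtain ⟨x, ⟨rfl, rfl⟩, -⟩ := fill_hsq hX a b hab
    obtain ⟨y, ⟨rfl, rfl⟩, -⟩ := fill_hsq hX c d hcd
    have hxy : X.δ 0 x = X.δ 1 y := by
      apply ext_hor hX
      · exact ((face_face X (by decide) x).trans hbd).trans (face_face X (by decide) y)
      · exact ((face_face X (by decide) x).trans hac).trans (face_face X (by decide) y)
    obtain ⟨w, rfl, rfl⟩ := fill_vsq₃ hX x y hxy
    have e1 := pathHsq_comp hX (X.δ 2 w) rfl rfl hab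
    have e2 := pathHsq_comp hX (X.δ 0 w) rfl rfl hcd
    have e3 := pathVsq_comp hX (X.δ 5 w) (face_face X (by decide) w)
      (face_face X (by decide) w) hac
    have e4 := pathVsq_comp hX (X.δ 3 w) (face_face X (by decide) w)
      (face_face X (by decide) w) hbd
    refine (pathVsq_comp hX (X.δ 4 w) ?_ ?_ h).trans
      (Eq.trans ?_ (pathHsq_comp hX (X.δ 1 w) ?_ ?_ h').symm)
    · exact Eq.trans (face_face X (by decide) w) e1.symm
    · exact Eq.trans (face_face X (by decide) w) e2.symm
    · exact face_face X (by decide) w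
    · exact Eq.trans (face_face X (by decide) w) e3.symm
    · exact Eq.trans (face_face X (by decide) w) e4.symm

theorem pathDoubleCat_isStable (hX : IsTwoSegal X) : (pathDoubleCat hX).IsStable where
  span f v h := by
    obtain ⟨z, ⟨h1, h2⟩, hz⟩ := fill_hor hX v f (Eq.symm h)
    exact ⟨z, ⟨h2, h1⟩, fun z' h' => hz z' ⟨h'.2, h'.1⟩⟩
  cospan v f h := fill_ver hX v f h

theorem eq_of_degenerate_edge (hX : IsUnitalTwoSegal X) {n : ℕ} (i : Fin (n + 2))
    (y : X _⦋n + 2⦌) (z : X _⦋0⦌)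
    (h : X.σ 0 z = X.map (SimplexCategory.mkOfSucc i).op y) : ∃ w, X.σ i w = y := by
  obtain ⟨w, -, hw⟩ := Limits.Types.exists_of_isPullback (hX.unital n i) z y h
  exact ⟨w, hw⟩

theorem pathDoubleCat_isAugmented (hX : IsUnitalTwoSegal X) :
    (pathDoubleCat hX.twoSegal).IsAugmented (Set.range (X.σ (0 : Fin 1))) where
  hor x := by
    refine ⟨X.σ (0 : Fin 2) x, ⟨⟨X.δ (1 : Fin 2) x, ?_⟩, ?_⟩, ?_⟩
    · exact (face_deg X (by decide) x).symm
    · exact deg_face X (by decide) x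
    · rintro f ⟨⟨z, hz⟩, rfl⟩
      obtain ⟨w, rfl⟩ := eq_of_degenerate_edge hX (n := 0) 0 f z
        (hz.trans (congrArg (fun a => X.map (Quiver.Hom.op a) f) (by decide)))
      exact congrArg (X.σ 0) (deg_face X (by decide) w).symm
  ver x := by
    refine ⟨X.σ (1 : Fin 2) x, ⟨⟨X.δ (0 : Fin 2) x, ?_⟩, ?_⟩, ?_⟩
    · exact (face_deg X (by decide) x).symm
    · exact deg_face X (by decide) x
    · rintro f ⟨⟨z, hz⟩, rfl⟩
      obtain ⟨w, rfl⟩ := eq_of_degenerate_edge hX (n := 0) 1 f z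
        (hz.trans (congrArg (fun a => X.map (Quiver.Hom.op a) f) (by decide)))
      exact congrArg (X.σ 1) (deg_face X (by decide) w).symm

end Path

/-- The path construction of a unital 2-Segal set; the augmentation set is `X₀`, regarded as a subset
of `X₁` through the (injective) degeneracy map. -/
noncomputable def pathObj (X : SSet.{u}) (hX : IsUnitalTwoSegal X) : AugStDoubleCat.{u} where
  toDoubleCat := pathDoubleCat hX.twoSegal
  A := Set.range (X.σ (0 : Fin 1))
  stable := pathDoubleCat_isStable hX.twoSegal
  augmented := pathDoubleCat_isAugmented hX

theorem nat_face {X Y : SSet.{u}} (φ : X ⟶ Y) {n : ℕ} (i : Fin (n + 2)) (y : X _⦋n + 1⦌) :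
    Y.δ i (φ.app _ y) = φ.app _ (X.δ i y) :=
  (NatTrans.naturality_apply φ (SimplexCategory.δ i).op y).symm

theorem nat_deg {X Y : SSet.{u}} (φ : X ⟶ Y) {n : ℕ} (i : Fin (n + 1)) (y : X _⦋n⦌) :
    φ.app _ (X.σ i y) = Y.σ i (φ.app _ y) :=
  NatTrans.naturality_apply φ (SimplexCategory.σ i).op y

/-- The double functor induced by a simplicial map. -/
def pathMap {X Y : SSet.{u}} (hX : IsUnitalTwoSegal X) (hY : IsUnitalTwoSegal Y) (φ : X ⟶ Y) :
    AugDoubleFunctor (pathObj X hX) (pathObj Y hY) where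
  ob := φ.app (op ⦋1⦌)
  onHor := φ.app (op ⦋2⦌)
  onVer := φ.app (op ⦋2⦌)
  onSq := φ.app (op ⦋3⦌)
  hor :=
    { src := fun f => nat_face φ _ f
      tgt := fun f => nat_face φ _ f
      one := fun x => nat_deg φ _ x
      comp := fun f g h h' => by
        obtain ⟨z, ⟨rfl, rfl⟩, -⟩ := fill_hor hX.twoSegal f g h
        exact (congrArg _ (pathHor_comp hX.twoSegal z rfl rfl h)).trans
          ((nat_face φ _ z).symm.trans (pathHor_comp hY.twoSegal (φ.app _ z)
            (nat_face φ _ z) (nat_face φ _ z) h').symm) }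
  ver :=
    { src := fun f => nat_face φ _ f
      tgt := fun f => nat_face φ _ f
      one := fun x => nat_deg φ _ x
      comp := fun f g h h' => by
        obtain ⟨z, ⟨rfl, rfl⟩, -⟩ := fill_ver hX.twoSegal f g h
        exact (congrArg _ (pathVer_comp hX.twoSegal z rfl rfl h)).trans
          ((nat_face φ _ z).symm.trans (pathVer_comp hY.twoSegal (φ.app _ z)
            (nat_face φ _ z) (nat_face φ _ z) h').symm) }
  hsq :=
    { src := fun f => nat_face φ _ f
      tgt := fun f => nat_face φ _ f
      one := fun x => nat_deg φ _ x
      comp := fun f g h h' => by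
        obtain ⟨z, ⟨rfl, rfl⟩, -⟩ := fill_hsq hX.twoSegal f g h
        exact (congrArg _ (pathHsq_comp hX.twoSegal z rfl rfl h)).trans
          ((nat_face φ _ z).symm.trans (pathHsq_comp hY.twoSegal (φ.app _ z)
            (nat_face φ _ z) (nat_face φ _ z) h').symm) }
  vsq :=
    { src := fun f => nat_face φ _ f
      tgt := fun f => nat_face φ _ f
      one := fun x => nat_deg φ _ x
      comp := fun f g h h' => by
        obtain ⟨z, ⟨rfl, rfl⟩, -⟩ := fill_vsq hX.twoSegal f g h
        exact (congrArg _ (pathVsq_comp hX.twoSegal z rfl rfl h)).trans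
          ((nat_face φ _ z).symm.trans (pathVsq_comp hY.twoSegal (φ.app _ z)
            (nat_face φ _ z) (nat_face φ _ z) h').symm) }
  aug := by
    rintro _ ⟨z, rfl⟩
    exact ⟨φ.app _ z, (nat_deg φ _ z).symm⟩

/-- The property of being a unital 2-Segal set. -/
abbrev unitalTwoSegal : ObjectProperty SSet.{u} := IsUnitalTwoSegal

/-- The category of unital 2-Segal sets, a full subcategory of simplicial sets. -/
abbrev UnitalTwoSegalSet := unitalTwoSegal.{u}.FullSubcategory

/-- The path construction, a functor from unital 2-Segal sets to augmented stable double categories. -/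
noncomputable def pathConstruction : UnitalTwoSegalSet.{u} ⥤ AugStDoubleCat.{u} where
  obj X := pathObj X.obj X.property
  map {X Y} φ := pathMap X.property Y.property φ.hom

end Waldhausen

namespace Waldhausen

/-! The functor `augNerve` unfolds to `waldhausenConstruction ⋙ pUpper`: the augmented double nerve
is `p^* S_•`. So everything follows from three facts. (1) `S_• D` is unital 2-Segal. (2) For unital
2-Segal `X` there is a natural isomorphism `X ≅ S_• (P X)`; applying `p^*` gives the first
isomorphism of the theorem. (3) For unital 2-Segal `X` the unit `X → p_* p^* X` is an isomorphism;
taking `X = S_• D` gives the second one.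

For (1): by stability and augmentation, a double functor `W n → D` is the same as a chain of
horizontal morphisms `(0,0) → (0,1) → ⋯ → (0,n)` starting in the augmentation set (`ext_wHor_succ`,
`Chain.toDoubleFunctor`). Its first arrow is determined by its target, so only the arrows `(0,j+1) →
(0,j+2)` are free, and they are the triangles `0, j+1, j+2`. This is the Segal condition for the fan
at `0`. Filling squares from their right and bottom sides gives the condition for the other
triangulation of the square (`waldhausen_isFanSegal`). Together they allow a triangle to be glued
onto any side `k, k+1` (`IsFanSegal.hasEarFillers`), and every triangulation is built by gluing ears
(`HasEarFillers.isTwoSegal`). For unitality, if `F (i,i+1)` lies in the augmentation set, then the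
arrow `(0,i,i+1)` goes to an identity and `F` is degenerate (`σ_eq_of_mem`).

For (2): a simplex `y` of `X` defines a double functor by restricting `y` to edges, triangles and
3-simplices. The resulting simplicial map is bijective in degrees `0, 1, 2` by the definition of `P
X`, hence everywhere because both sides are 2-Segal (`pathUnitApp_bijective`).

For (3): a map `α : p^* G → p^* X` has one component for each splitting `n = q + 1 + r`. Unitality
forces these to agree and to commute with all maps of the simplex category
(`SumTransformation.sum_map`): after inserting a degeneracy at the cut, any map splits there as an
ordinal sum. So `α` extends uniquely to `G → X`, which says that `X` is the right Kan extension of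
`p^* X`. -/

theorem CatStr.comp_congr {O M : Type u} (C : CatStr O M) {f f' g g' : M} (hf : f = f')
    (hg : g = g') (h : C.tgt f = C.src g) (h' : C.tgt f' = C.src g') : C.comp f g h = C.comp f' g' h' := by
  subst hf hg
  rfl

/-! ### Squares and augmentation morphisms in an augmented stable double category. -/

namespace AugStDoubleCat

variable (D : AugStDoubleCat.{u})

/-- The square with given top and left sides. -/
noncomputable def fill (f : D.Hor) (v : D.Ver) (h : D.hor.src f = D.ver.src v) : D.Sq :=
  (D.stable.span f v h).choose

variable {D}

theorem fill_top {f : D.Hor} {v : D.Ver} (h : D.hor.src f = D.ver.src v) :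
    D.vsq.src (D.fill f v h) = f :=
  (D.stable.span f v h).choose_spec.1.1

theorem fill_left {f : D.Hor} {v : D.Ver} (h : D.hor.src f = D.ver.src v) :
    D.hsq.src (D.fill f v h) = v :=
  (D.stable.span f v h).choose_spec.1.2

theorem hor_src_top (a : D.Sq) : D.hor.src (D.vsq.src a) = D.ver.src (D.hsq.src a) :=
  (D.src_functor.src a).symm

theorem hor_src_bottom (a : D.Sq) : D.hor.src (D.vsq.tgt a) = D.ver.tgt (D.hsq.src a) :=
  (D.src_functor.tgt a).symm

theorem ver_src_right (a : D.Sq) : D.ver.src (D.hsq.tgt a) = D.hor.tgt (D.vsq.src a) :=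
  D.tgt_functor.src a

theorem ver_tgt_right (a : D.Sq) : D.ver.tgt (D.hsq.tgt a) = D.hor.tgt (D.vsq.tgt a) :=
  D.tgt_functor.tgt a

theorem eq_fill {a : D.Sq} {f : D.Hor} {v : D.Ver} (h : D.hor.src f = D.ver.src v)
    (h₁ : D.vsq.src a = f) (h₂ : D.hsq.src a = v) : a = D.fill f v h :=
  (D.stable.span f v h).choose_spec.2 a ⟨h₁, h₂⟩

theorem sq_ext_span {a b : D.Sq} (h₁ : D.vsq.src a = D.vsq.src b) (h₂ : D.hsq.src a = D.hsq.src b) :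
    a = b :=
  (D.stable.span _ _ (hor_src_top b)).unique ⟨h₁, h₂⟩ ⟨rfl, rfl⟩

theorem sq_ext_cospan {a b : D.Sq} (h₁ : D.hsq.tgt a = D.hsq.tgt b)
    (h₂ : D.vsq.tgt a = D.vsq.tgt b) : a = b :=
  (D.stable.cospan _ _ (ver_tgt_right b)).unique ⟨h₁, h₂⟩ ⟨rfl, rfl⟩

variable (D) in
/-- The vertical morphism from `x` to the augmentation set. -/
noncomputable def augVer (x : D.Ob) : D.Ver := (D.augmented.ver x).choose

theorem src_augVer (x : D.Ob) : D.ver.src (D.augVer x) = x := (D.augmented.ver x).choose_spec.1.2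

theorem tgt_augVer (x : D.Ob) : D.ver.tgt (D.augVer x) ∈ D.A := (D.augmented.ver x).choose_spec.1.1

theorem eq_augVer {x : D.Ob} {v : D.Ver} (h₁ : D.ver.src v = x) (h₂ : D.ver.tgt v ∈ D.A) :
    v = D.augVer x :=
  (D.augmented.ver x).choose_spec.2 v ⟨h₂, h₁⟩

theorem augVer_of_mem {x : D.Ob} (h : x ∈ D.A) : D.augVer x = D.ver.one x :=
  (eq_augVer (D.ver.src_one x) (by rwa [D.ver.tgt_one])).symm

variable (D) in
/-- The horizontal morphism to `x` from the augmentation set. -/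
noncomputable def augHor (x : D.Ob) : D.Hor := (D.augmented.hor x).choose

theorem tgt_augHor (x : D.Ob) : D.hor.tgt (D.augHor x) = x := (D.augmented.hor x).choose_spec.1.2

theorem src_augHor (x : D.Ob) : D.hor.src (D.augHor x) ∈ D.A := (D.augmented.hor x).choose_spec.1.1

theorem eq_augHor {x : D.Ob} {f : D.Hor} (h₁ : D.hor.tgt f = x) (h₂ : D.hor.src f ∈ D.A) :
    f = D.augHor x :=
  (D.augmented.hor x).choose_spec.2 f ⟨h₂, h₁⟩

theorem augHor_of_mem {x : D.Ob} (h : x ∈ D.A) : D.augHor x = D.hor.one x :=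
  (eq_augHor (D.hor.tgt_one x) (by rwa [D.hor.src_one])).symm

end AugStDoubleCat

open AugStDoubleCat

/-! ### Double functors out of `W n`: values, construction from values, extensionality. -/

namespace AugDoubleFunctor

variable {D : AugStDoubleCat.{u}} {n : ℕ} (F : AugDoubleFunctor (W n) D)

/-- The value at the object `(i, j)`. -/
def wOb (i j : Fin (n + 1)) (hij : i ≤ j) : D.Ob := F.ob ⟨i, j, hij⟩

/-- The value at the horizontal morphism `(i, j, l)`. -/
def wHor (i j l : Fin (n + 1)) (hij : i ≤ j) (hjl : j ≤ l) : D.Hor := F.onHor ⟨i, j, l, hij, hjl⟩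

/-- The value at the vertical morphism `(i, k, j)`. -/
def wVer (i k j : Fin (n + 1)) (hik : i ≤ k) (hkj : k ≤ j) : D.Ver := F.onVer ⟨i, k, j, hik, hkj⟩

/-- The value at the square `(i, k, j, l)`. -/
def wSq (i k j l : Fin (n + 1)) (hik : i ≤ k) (hkj : k ≤ j) (hjl : j ≤ l) : D.Sq :=
  F.onSq ⟨i, k, j, l, hik, hkj, hjl⟩

variable (i k j l m : Fin (n + 1)) (hik : i ≤ k) (hij : i ≤ j) (hkj : k ≤ j) (hjl : j ≤ l)
  (hlm : l ≤ m)

theorem src_wHor : D.hor.src (F.wHor i j l hij hjl) = F.wOb i j hij := F.hor.src _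

theorem tgt_wHor : D.hor.tgt (F.wHor i j l hij hjl) = F.wOb i l (hij.trans hjl) := F.hor.tgt _

theorem wHor_one : F.wHor i j j hij le_rfl = D.hor.one (F.wOb i j hij) := F.hor.one ⟨i, j, hij⟩

theorem wHor_comp (h) :
    D.hor.comp (F.wHor i j l hij hjl) (F.wHor i l m (hij.trans hjl) hlm) h =
      F.wHor i j m hij (hjl.trans hlm) :=
  (F.hor.comp ⟨i, j, l, hij, hjl⟩ ⟨i, l, m, hij.trans hjl, hlm⟩ rfl h).symm

theorem src_wVer : D.ver.src (F.wVer i k j hik hkj) = F.wOb i j (hik.trans hkj) := F.ver.src _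

theorem tgt_wVer : D.ver.tgt (F.wVer i k j hik hkj) = F.wOb k j hkj := F.ver.tgt _

theorem wSq_top : D.vsq.src (F.wSq i k j l hik hkj hjl) = F.wHor i j l (hik.trans hkj) hjl :=
  F.vsq.src _

theorem wSq_bottom : D.vsq.tgt (F.wSq i k j l hik hkj hjl) = F.wHor k j l hkj hjl := F.vsq.tgt _

theorem wSq_left : D.hsq.src (F.wSq i k j l hik hkj hjl) = F.wVer i k j hik hkj := F.hsq.src _

theorem wSq_right : D.hsq.tgt (F.wSq i k j l hik hkj hjl) = F.wVer i k l hik (hkj.trans hjl) :=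
  F.hsq.tgt _

theorem wOb_self_mem : F.wOb i i le_rfl ∈ D.A := F.aug ⟨i, i, le_rfl⟩ rfl

theorem wVer_aug : F.wVer i j j hij le_rfl = D.augVer (F.wOb i j hij) :=
  eq_augVer (F.src_wVer ..) (by rw [F.tgt_wVer]; exact F.wOb_self_mem _)

theorem wHor_aug : F.wHor i i j le_rfl hij = D.augHor (F.wOb i j hij) :=
  eq_augHor (F.tgt_wHor ..) (by rw [F.src_wHor]; exact F.wOb_self_mem _)

/-- An augmented double functor from `W n` given by its values. -/
def ofValues (ob : ∀ i j : Fin (n + 1), i ≤ j → D.Ob)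
    (hor : ∀ i j l : Fin (n + 1), i ≤ j → j ≤ l → D.Hor)
    (ver : ∀ i k j : Fin (n + 1), i ≤ k → k ≤ j → D.Ver)
    (sq : ∀ i k j l : Fin (n + 1), i ≤ k → k ≤ j → j ≤ l → D.Sq)
    (src_hor : ∀ i j l hij hjl, D.hor.src (hor i j l hij hjl) = ob i j hij)
    (tgt_hor : ∀ i j l hij hjl, D.hor.tgt (hor i j l hij hjl) = ob i l (hij.trans hjl))
    (one_hor : ∀ i j hij, hor i j j hij le_rfl = D.hor.one (ob i j hij))
    (comp_hor : ∀ i j l m (hij : i ≤ j) (hjl : j ≤ l) (hlm : l ≤ m) h,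
      D.hor.comp (hor i j l hij hjl) (hor i l m (hij.trans hjl) hlm) h =
        hor i j m hij (hjl.trans hlm))
    (src_ver : ∀ i k j hik hkj, D.ver.src (ver i k j hik hkj) = ob i j (hik.trans hkj))
    (tgt_ver : ∀ i k j hik hkj, D.ver.tgt (ver i k j hik hkj) = ob k j hkj)
    (one_ver : ∀ i j hij, ver i i j le_rfl hij = D.ver.one (ob i j hij))
    (comp_ver : ∀ i k m j (hik : i ≤ k) (hkm : k ≤ m) (hmj : m ≤ j) h,
      D.ver.comp (ver i k j hik (hkm.trans hmj)) (ver k m j hkm hmj) h =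
        ver i m j (hik.trans hkm) hmj)
    (src_hsq : ∀ i k j l hik hkj hjl, D.hsq.src (sq i k j l hik hkj hjl) = ver i k j hik hkj)
    (tgt_hsq : ∀ i k j l hik hkj hjl,
      D.hsq.tgt (sq i k j l hik hkj hjl) = ver i k l hik (hkj.trans hjl))
    (one_hsq : ∀ i k j hik hkj, sq i k j j hik hkj le_rfl = D.hsq.one (ver i k j hik hkj))
    (comp_hsq : ∀ i k j l m (hik : i ≤ k) (hkj : k ≤ j) (hjl : j ≤ l) (hlm : l ≤ m) h,
      D.hsq.comp (sq i k j l hik hkj hjl) (sq i k l m hik (hkj.trans hjl) hlm) h =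
        sq i k j m hik hkj (hjl.trans hlm))
    (src_vsq : ∀ i k j l hik hkj hjl,
      D.vsq.src (sq i k j l hik hkj hjl) = hor i j l (hik.trans hkj) hjl)
    (tgt_vsq : ∀ i k j l hik hkj hjl, D.vsq.tgt (sq i k j l hik hkj hjl) = hor k j l hkj hjl)
    (one_vsq : ∀ i j l hij hjl, sq i i j l le_rfl hij hjl = D.vsq.one (hor i j l hij hjl))
    (comp_vsq : ∀ i k m j l (hik : i ≤ k) (hkm : k ≤ m) (hmj : m ≤ j) (hjl : j ≤ l) h,
      D.vsq.comp (sq i k j l hik (hkm.trans hmj) hjl) (sq k m j l hkm hmj hjl) h =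
        sq i m j l (hik.trans hkm) hmj hjl)
    (aug : ∀ i, ob i i le_rfl ∈ D.A) : AugDoubleFunctor (W n) D where
  ob x := ob x.i x.j x.hij
  onHor f := hor f.i f.j f.l f.hij f.hjl
  onVer v := ver v.i v.k v.j v.hik v.hkj
  onSq a := sq a.i a.k a.j a.l a.hik a.hkj a.hjl
  hor :=
    { src := fun _ => src_hor ..
      tgt := fun _ => tgt_hor ..
      one := fun _ => one_hor ..
      comp := by
        rintro ⟨i, j, l, hij, hjl⟩ ⟨i', j', l', hij', hjl'⟩ h h'
        obtain ⟨rfl, rfl⟩ := WOb.mk.inj h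
        exact (comp_hor ..).symm }
  ver :=
    { src := fun _ => src_ver ..
      tgt := fun _ => tgt_ver ..
      one := fun _ => one_ver ..
      comp := by
        rintro ⟨i, k, j, hik, hkj⟩ ⟨i', k', j', hik', hkj'⟩ h h'
        obtain ⟨rfl, rfl⟩ := WOb.mk.inj h
        exact (comp_ver ..).symm }
  hsq :=
    { src := fun _ => src_hsq ..
      tgt := fun _ => tgt_hsq ..
      one := fun _ => one_hsq ..
      comp := by
        rintro ⟨i, k, j, l, hik, hkj, hjl⟩ ⟨i', k', j', l', hik', hkj', hjl'⟩ h h'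
        obtain ⟨rfl, rfl, rfl⟩ := WVer.mk.inj h
        exact (comp_hsq ..).symm }
  vsq :=
    { src := fun _ => src_vsq ..
      tgt := fun _ => tgt_vsq ..
      one := fun _ => one_vsq ..
      comp := by
        rintro ⟨i, k, j, l, hik, hkj, hjl⟩ ⟨i', k', j', l', hik', hkj', hjl'⟩ h h'
        obtain ⟨rfl, rfl, rfl⟩ := WHor.mk.inj h
        exact (comp_vsq ..).symm }
  aug := by
    rintro ⟨i, j, hij⟩ h
    obtain rfl : i = j := h
    exact aug i

variable {F} {F' : AugDoubleFunctor (W n) D}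

/-- The vertical morphism `(i,k,j)` is the right side of the square `(i,k,k,j)`. By stability that
square is determined by its top, which is horizontal, and its left side `(i,k,k)`, which is the
augmentation morphism of the object `(i,k)`. -/
theorem ext_wHor (h : ∀ i j l hij hjl, F.wHor i j l hij hjl = F'.wHor i j l hij hjl) : F = F' := by
  have hob : ∀ i j hij, F.wOb i j hij = F'.wOb i j hij := fun i j hij => by
    rw [← F.src_wHor i j j hij le_rfl, h, F'.src_wHor]
  have hver : ∀ i k j hik hkj, F.wVer i k j hik hkj = F'.wVer i k j hik hkj := by
    intro i k j hik hkj
    rw [← F.wSq_right i k k j hik le_rfl hkj, ← F'.wSq_right i k k j hik le_rfl hkj]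
    congr 1
    apply sq_ext_span
    · rw [wSq_top, wSq_top, h]
    · rw [wSq_left, wSq_left, wVer_aug, wVer_aug, hob]
  have hsq : ∀ i k j l hik hkj hjl, F.wSq i k j l hik hkj hjl = F'.wSq i k j l hik hkj hjl := by
    intros
    apply sq_ext_span
    · rw [wSq_top, wSq_top, h]
    · rw [wSq_left, wSq_left, hver]
  apply AugDoubleFunctor.ext
  · exact funext fun _ => hob ..
  · exact funext fun _ => h ..
  · exact funext fun _ => hver ..
  · exact funext fun _ => hsq ..

/-- Row `i` consists of the bottoms of the squares `(0,i,j,l)`. Their tops lie in row `0`, and their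
left sides are recovered from row `0` as in `ext_wHor`. -/
theorem ext_wHor_zero
    (h : ∀ j l hj hl, F.wHor 0 j l hj hl = F'.wHor 0 j l hj hl) : F = F' := by
  have hob : ∀ j hj, F.wOb 0 j hj = F'.wOb 0 j hj := fun j hj => by
    rw [← F.src_wHor 0 j j hj le_rfl, h, F'.src_wHor]
  have hver : ∀ k j hk hkj, F.wVer 0 k j hk hkj = F'.wVer 0 k j hk hkj := by
    intro k j hk hkj
    rw [← F.wSq_right 0 k k j hk le_rfl hkj, ← F'.wSq_right 0 k k j hk le_rfl hkj]
    congr 1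
    apply sq_ext_span
    · rw [wSq_top, wSq_top, h]
    · rw [wSq_left, wSq_left, wVer_aug, wVer_aug, hob]
  apply ext_wHor
  intro i j l hij hjl
  rw [← F.wSq_bottom 0 i j l (Fin.zero_le _), ← F'.wSq_bottom 0 i j l (Fin.zero_le _)]
  congr 1
  apply sq_ext_span
  · rw [wSq_top, wSq_top, h]
  · rw [wSq_left, wSq_left, hver]

/-- A double functor from `W n` is determined by the consecutive horizontal morphisms of its first
row and its value at `(0, 0)`. -/
theorem ext_wHor_succ (h₀ : F.wOb 0 0 le_rfl = F'.wOb 0 0 le_rfl)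
    (h : ∀ j l hj hl, l.val = j.val + 1 → F.wHor 0 j l hj hl = F'.wHor 0 j l hj hl) : F = F' := by
  have hob : ∀ j, F.wOb 0 j (Fin.zero_le _) = F'.wOb 0 j (Fin.zero_le _) := by
    intro j
    by_cases hj : j = 0
    · subst hj
      exact h₀
    · have hj' : j.val ≠ 0 := fun e => hj (Fin.ext e)
      let j' : Fin (n + 1) := ⟨j.val - 1, by omega⟩
      have hl : j' ≤ j := Nat.sub_le _ _
      rw [← F.tgt_wHor 0 j' j (Fin.zero_le _) hl, h _ _ _ _ (by simp only [j']; omega), tgt_wHor]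
  apply ext_wHor_zero
  intro j l hj hl
  obtain ⟨d, hd⟩ : ∃ d, l.val = j.val + d := ⟨l.val - j.val, by have : j.val ≤ l.val := hl; omega⟩
  induction d generalizing l with
  | zero =>
    obtain rfl : l = j := Fin.ext hd
    rw [wHor_one, wHor_one, hob]
  | succ d ih =>
    let l' : Fin (n + 1) := ⟨j.val + d, by omega⟩
    have hl' : j ≤ l' := Nat.le_add_right _ _
    have hll : l' ≤ l := by rw [Fin.le_def]; simp only [l']; omega
    rw [← F.wHor_comp 0 j l' l hj hl' hll (by rw [tgt_wHor, src_wHor]),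
      ← F'.wHor_comp 0 j l' l hj hl' hll (by rw [tgt_wHor, src_wHor])]
    exact D.hor.comp_congr (ih l' hl' rfl) (h l' l _ hll (by simp only [l']; omega)) _ _

end AugDoubleFunctor

/-! ### Extending a chain of horizontal morphisms to a double functor. -/

/-- A functor from the linearly ordered set `{j | i ≤ j}` of natural numbers to the category `C`. -/
@[ext]
structure Chain {O M : Type u} (C : CatStr O M) (i : ℕ) where
  ob : ∀ j, i ≤ j → O
  hor : ∀ j l, i ≤ j → j ≤ l → M
  src : ∀ j l hj hl, C.src (hor j l hj hl) = ob j hj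
  tgt : ∀ j l hj hl, C.tgt (hor j l hj hl) = ob l (hj.trans hl)
  one : ∀ j hj, hor j j hj le_rfl = C.one (ob j hj)
  comp : ∀ j l m hj hl hm h,
    C.comp (hor j l hj hl) (hor l m (hj.trans hl) hm) h = hor j m hj (hl.trans hm)

namespace Chain

variable {D : AugStDoubleCat.{u}} {i : ℕ} (c : Chain D.hor i)

/-- The square with top side `c.hor k j` and left side the augmentation morphism at `k`. -/
noncomputable def augSq (k j : ℕ) (hk : i ≤ k) (hj : k ≤ j) : D.Sq :=
  D.fill (c.hor k j hk hj) (D.augVer (c.ob k hk)) (by rw [c.src, src_augVer])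

/-- The vertical morphism from row `i` to row `k` in column `j`. -/
noncomputable def ver (k j : ℕ) (hk : i ≤ k) (hj : k ≤ j) : D.Ver :=
  D.hsq.tgt (c.augSq k j hk hj)

theorem augSq_top (k j : ℕ) (hk : i ≤ k) (hj : k ≤ j) :
    D.vsq.src (c.augSq k j hk hj) = c.hor k j hk hj := fill_top _

theorem augSq_left (k j : ℕ) (hk : i ≤ k) (hj : k ≤ j) :
    D.hsq.src (c.augSq k j hk hj) = D.augVer (c.ob k hk) := fill_left _

theorem augSq_right (k j : ℕ) (hk : i ≤ k) (hj : k ≤ j) :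
    D.hsq.tgt (c.augSq k j hk hj) = c.ver k j hk hj := rfl

theorem src_ver (k j : ℕ) (hk : i ≤ k) (hj : k ≤ j) :
    D.ver.src (c.ver k j hk hj) = c.ob j (hk.trans hj) := by
  rw [← augSq_right, ver_src_right, augSq_top, c.tgt]

/-- The square between rows `i` and `k` and columns `j` and `l`. -/
noncomputable def sq (k j l : ℕ) (hk : i ≤ k) (hj : k ≤ j) (hl : j ≤ l) : D.Sq :=
  D.fill (c.hor j l (hk.trans hj) hl) (c.ver k j hk hj) (by rw [c.src, c.src_ver])

theorem sq_top (k j l : ℕ) (hk : i ≤ k) (hj : k ≤ j) (hl : j ≤ l) :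
    D.vsq.src (c.sq k j l hk hj hl) = c.hor j l (hk.trans hj) hl := fill_top _

theorem sq_left (k j l : ℕ) (hk : i ≤ k) (hj : k ≤ j) (hl : j ≤ l) :
    D.hsq.src (c.sq k j l hk hj hl) = c.ver k j hk hj := fill_left _

/-- The pasted square has top `c.hor k l` and the augmentation morphism as left side, so stability
identifies it. Consequently the right side of `sq k j l` does not depend on the column `j` where the
square starts. -/
theorem augSq_comp_sq (k j l : ℕ) (hk : i ≤ k) (hj : k ≤ j) (hl : j ≤ l) :
    D.hsq.comp (c.augSq k j hk hj) (c.sq k j l hk hj hl) 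
      ((c.augSq_right k j hk hj).trans (c.sq_left k j l hk hj hl).symm) =
      c.augSq k l hk (hj.trans hl) := by
  apply eq_fill
  · have h' : D.hor.tgt (c.hor k j hk hj) = D.hor.src (c.hor j l (hk.trans hj) hl) := by
      rw [c.tgt, c.src]
    rw [D.comp_src _ _ _ (by rw [augSq_top, c.sq_top, h']),
      D.hor.comp_congr (c.augSq_top ..) (c.sq_top ..) _ h', c.comp]
  · rw [D.hsq.src_comp, augSq_left]

theorem sq_right (k j l : ℕ) (hk : i ≤ k) (hj : k ≤ j) (hl : j ≤ l) :
    D.hsq.tgt (c.sq k j l hk hj hl) = c.ver k l hk (hj.trans hl) := by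
  rw [← augSq_right, ← c.augSq_comp_sq k j l hk hj hl, D.hsq.tgt_comp]

theorem sq_self (k j : ℕ) (hk : i ≤ k) (hj : k ≤ j) :
    c.sq k j j hk hj le_rfl = D.hsq.one (c.ver k j hk hj) := by
  symm
  apply eq_fill
  · rw [D.one_functor.src, c.one, c.src_ver]
  · rw [D.hsq.src_one]

theorem sq_comp (k j l m : ℕ) (hk : i ≤ k) (hj : k ≤ j) (hl : j ≤ l) (hm : l ≤ m) (h) :
    D.hsq.comp (c.sq k j l hk hj hl) (c.sq k l m hk (hj.trans hl) hm) h =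
      c.sq k j m hk hj (hl.trans hm) := by
  apply eq_fill
  · have h' : D.hor.tgt (c.hor j l (hk.trans hj) hl) =
        D.hor.src (c.hor l m ((hk.trans hj).trans hl) hm) := by
      rw [c.tgt, c.src]
    rw [D.comp_src _ _ _ (by rw [c.sq_top, c.sq_top, h']),
      D.hor.comp_congr (c.sq_top ..) (c.sq_top ..) _ h', c.comp]
  · rw [D.hsq.src_comp, sq_left]

/-- The row `k` of the double functor attached to `c`. -/
noncomputable def row (k : ℕ) (hk : i ≤ k) : Chain D.hor k where
  ob j hj := D.ver.tgt (c.ver k j hk hj)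
  hor j l hj hl := D.vsq.tgt (c.sq k j l hk hj hl)
  src j l hj hl := by rw [hor_src_bottom, sq_left]
  tgt j l hj hl := by rw [← ver_tgt_right, sq_right]
  one j hj := by rw [sq_self, D.one_functor.tgt]
  comp j l m hj hl hm h := by
    rw [← c.sq_comp k j l m hk hj hl hm (by rw [c.sq_right, c.sq_left]), D.comp_tgt]

theorem ver_self (k : ℕ) (hk : i ≤ k) : c.ver k k hk le_rfl = D.augVer (c.ob k hk) := by
  have : c.augSq k k hk le_rfl = D.hsq.one (D.augVer (c.ob k hk)) := by
    symm
    apply eq_fill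
    · rw [D.one_functor.src, src_augVer, c.one]
    · rw [D.hsq.src_one]
  rw [← augSq_right, this, D.hsq.tgt_one]

theorem row_ob_self_mem (k : ℕ) (hk : i ≤ k) : (c.row k hk).ob k le_rfl ∈ D.A := by
  change D.ver.tgt (c.ver k k hk le_rfl) ∈ D.A
  rw [ver_self]
  exact tgt_augVer _

/-- When the chain starts in the augmentation set, its first augmentation morphism is an identity,
so the square `augSq i j` is a vertical identity. This is why such a chain is its own first row. -/
theorem ver_first (h : c.ob i le_rfl ∈ D.A) (j : ℕ) (hj : i ≤ j) :
    c.ver i j le_rfl hj = D.ver.one (c.ob j hj) := by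
  have : c.augSq i j le_rfl hj = D.vsq.one (c.hor i j le_rfl hj) := by
    symm
    apply eq_fill
    · rw [D.vsq.src_one]
    · rw [D.src_functor.one, augVer_of_mem h, c.src]
  rw [← augSq_right, this, D.tgt_functor.one, c.tgt]

theorem sq_first (h : c.ob i le_rfl ∈ D.A) (j l : ℕ) (hj : i ≤ j) (hl : j ≤ l) :
    c.sq i j l le_rfl hj hl = D.vsq.one (c.hor j l hj hl) := by
  symm
  apply eq_fill
  · rw [D.vsq.src_one]
  · rw [D.src_functor.one, ver_first c h, c.src]

theorem row_first (h : c.ob i le_rfl ∈ D.A) : c.row i le_rfl = c := by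
  apply Chain.ext
  · funext j hj
    change D.ver.tgt (c.ver i j le_rfl hj) = _
    rw [ver_first c h, D.ver.tgt_one]
  · funext j l hj hl
    change D.vsq.tgt (c.sq i j l le_rfl hj hl) = _
    rw [sq_first c h, D.vsq.tgt_one]

/-- In column `m`, the descent to row `k` followed by the augmentation morphism is again the
augmentation morphism, by uniqueness. Hence `sq k m j` stacked on the `augSq m j` of row `k` is the
`augSq m j` of `c`; the claim compares right sides. -/
theorem ver_comp (k m j : ℕ) (hk : i ≤ k) (hm : k ≤ m) (hj : m ≤ j) (h) :
    D.ver.comp (c.ver k j hk (hm.trans hj)) ((c.row k hk).ver m j hm hj) h =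
      c.ver m j (hk.trans hm) hj := by
  have h₁ : D.ver.tgt (c.ver k m hk hm) = D.ver.src (D.augVer ((c.row k hk).ob m hm)) := by
    rw [src_augVer]
    rfl
  have h₂ : D.ver.comp (c.ver k m hk hm) (D.augVer ((c.row k hk).ob m hm)) h₁ =
      D.augVer (c.ob m (hk.trans hm)) := by
    apply eq_augVer
    · rw [D.ver.src_comp, c.src_ver]
    · rw [D.ver.tgt_comp]
      exact tgt_augVer _
  have h₃ : D.vsq.tgt (c.sq k m j hk hm hj) = D.vsq.src ((c.row k hk).augSq m j hm hj) :=
    ((c.row k hk).augSq_top m j hm hj).symm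
  have h₄ : D.vsq.comp (c.sq k m j hk hm hj) ((c.row k hk).augSq m j hm hj) h₃ =
      c.augSq m j (hk.trans hm) hj := by
    apply eq_fill
    · rw [D.vsq.src_comp, c.sq_top]
    · rw [← h₂, D.src_functor.comp _ _ _ (by rw [c.sq_left, augSq_left, h₁])]
      exact D.ver.comp_congr (c.sq_left ..) (augSq_left ..) _ _
  rw [← c.augSq_right m j, ← h₄, D.tgt_functor.comp _ _ _ (by rw [c.sq_right]; exact h)]
  exact D.ver.comp_congr (c.sq_right ..).symm rfl _ _

theorem sq_vcomp (k m j l : ℕ) (hk : i ≤ k) (hm : k ≤ m) (hj : m ≤ j) (hl : j ≤ l) (h) :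
    D.vsq.comp (c.sq k j l hk (hm.trans hj) hl) ((c.row k hk).sq m j l hm hj hl) h =
      c.sq m j l (hk.trans hm) hj hl := by
  have h' : D.ver.tgt (c.ver k j hk (hm.trans hj)) =
      D.ver.src ((c.row k hk).ver m j hm hj) := by
    rw [src_ver]
    rfl
  apply eq_fill
  · rw [D.vsq.src_comp, sq_top]
  · rw [← c.ver_comp k m j hk hm hj h', D.src_functor.comp _ _ _ (by rw [sq_left, sq_left, h'])]
    exact D.ver.comp_congr (sq_left ..) (sq_left ..) _ _

/-- Targets of the two composition laws `ver_comp` and `sq_vcomp`. It makes the rows coherent: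
vertical morphisms leaving row `k` land in the rows already constructed from `c`. -/
theorem row_row (k m : ℕ) (hk : i ≤ k) (hm : k ≤ m) :
    (c.row k hk).row m hm = c.row m (hk.trans hm) := by
  apply Chain.ext
  · funext j hj
    change D.ver.tgt _ = D.ver.tgt _
    rw [← c.ver_comp k m j hk hm hj (by rw [src_ver]; rfl), D.ver.tgt_comp]
  · funext j l hj hl
    change D.vsq.tgt _ = D.vsq.tgt _
    rw [← c.sq_vcomp k m j l hk hm hj hl (by rw [sq_top]; rfl), D.vsq.tgt_comp]

theorem ver_row_self (k j : ℕ) (hk : i ≤ k) (hj : k ≤ j) :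
    (c.row k hk).ver k j le_rfl hj = D.ver.one ((c.row k hk).ob j hj) :=
  ver_first _ (c.row_ob_self_mem k hk) j hj

theorem sq_row_self (k j l : ℕ) (hk : i ≤ k) (hj : k ≤ j) (hl : j ≤ l) :
    (c.row k hk).sq k j l le_rfl hj hl = D.vsq.one ((c.row k hk).hor j l hj hl) :=
  sq_first _ (c.row_ob_self_mem k hk) j l hj hl

/-- The double functor from `W n` with rows `c.row k`. -/
noncomputable def toDoubleFunctor (c : Chain D.hor 0) (n : ℕ) : AugDoubleFunctor (W n) D :=
  AugDoubleFunctor.ofValues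
    -- Even the top row is `c.row 0` and not `c`: any `c.row i` starts in the augmentation set, so
    -- no hypothesis on `c` is needed. The two agree when `c` itself starts there, by `row_first`.
    (fun i j hij => (c.row i (Nat.zero_le _)).ob j hij)
    (fun i j l hij hjl => (c.row i (Nat.zero_le _)).hor j l hij hjl)
    (fun i k j hik hkj => (c.row i (Nat.zero_le _)).ver k j hik hkj)
    (fun i k j l hik hkj hjl => (c.row i (Nat.zero_le _)).sq k j l hik hkj hjl)
    (fun _ _ _ _ _ => Chain.src ..)
    (fun _ _ _ _ _ => Chain.tgt ..)
    (fun _ _ _ => Chain.one ..)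
    (fun _ _ _ _ _ _ _ _ => Chain.comp ..)
    (fun _ _ _ _ _ => src_ver ..)
    -- Reading row `k` as the row `k` of row `i` turns the claim into the definition of `row`.
    (fun i k j hik hkj => by
      rw [← c.row_row i k (Nat.zero_le _) hik]
      rfl)
    (fun _ _ _ => ver_row_self ..)
    (fun i k m j hik hkm hmj h => by
      simp only [← c.row_row i k (Nat.zero_le _) hik] at h ⊢
      exact ver_comp ..)
    (fun _ _ _ _ _ _ _ => sq_left ..)
    (fun _ _ _ _ _ _ _ => sq_right ..)
    (fun _ _ _ _ _ => sq_self ..)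
    (fun _ _ _ _ _ _ _ _ _ _ => sq_comp ..)
    (fun _ _ _ _ _ _ _ => sq_top ..)
    (fun i k j l hik hkj hjl => by
      rw [← c.row_row i k (Nat.zero_le _) hik]
      rfl)
    (fun _ _ _ _ _ => sq_row_self ..)
    (fun i k m j l hik hkm hmj hjl h => by
      simp only [← c.row_row i k (Nat.zero_le _) hik] at h ⊢
      exact sq_vcomp ..)
    (fun _ => c.row_ob_self_mem ..)

theorem toDoubleFunctor_wHor_zero (c : Chain D.hor 0) (h : c.ob 0 le_rfl ∈ D.A) (n : ℕ)
    (j l : Fin (n + 1)) (hj : 0 ≤ j) (hl : j ≤ l) :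
    (c.toDoubleFunctor n).wHor 0 j l hj hl = c.hor j l (Nat.zero_le _) hl := by
  change (c.row 0 _).hor j l _ _ = _
  rw [c.row_first h]

theorem toDoubleFunctor_wOb_zero (c : Chain D.hor 0) (h : c.ob 0 le_rfl ∈ D.A) (n : ℕ)
    (j : Fin (n + 1)) (hj : 0 ≤ j) :
    (c.toDoubleFunctor n).wOb 0 j hj = c.ob j (Nat.zero_le _) := by
  change (c.row 0 _).ob j _ = _
  rw [c.row_first h]

/-- The composite of `d` consecutive morphisms of a sequence. -/
def seqComp {O M : Type u} (C : CatStr O M) (f : ℕ → M) (hf : ∀ j, C.tgt (f j) = C.src (f (j + 1)))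
    (j d : ℕ) : {g : M // C.src g = C.src (f j) ∧ C.tgt g = C.src (f (j + d))} :=
  Nat.rec ⟨C.one (C.src (f j)), C.src_one _, C.tgt_one _⟩
    (fun d g => ⟨C.comp g.1 (f (j + d)) g.2.2,
      (C.src_comp _ _ _).trans g.2.1, (C.tgt_comp _ _ _).trans (hf _)⟩) d

theorem seqComp_comp {O M : Type u} (C : CatStr O M) (f : ℕ → M)
    (hf : ∀ j, C.tgt (f j) = C.src (f (j + 1))) (j l d e : ℕ) (hl : l = j + d) (h) :
    C.comp (seqComp C f hf j d).1 (seqComp C f hf l e).1 h = (seqComp C f hf j (d + e)).1 := by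
  subst hl
  induction e with
  | zero =>
    refine Eq.trans (C.comp_congr rfl ?_ _ (C.src_one _).symm) (C.comp_one _)
    rw [(seqComp C f hf j d).2.2]
    rfl
  | succ e ih =>
    have h' := (seqComp C f hf j d).2.2.trans (seqComp C f hf (j + d) e).2.1.symm
    refine (C.assoc (seqComp C f hf j d).1 (seqComp C f hf (j + d) e).1 (f (j + d + e)) h'
      (seqComp C f hf (j + d) e).2.2).symm.trans (C.comp_congr (ih h') ?_ _ _)
    rw [Nat.add_assoc]
    rfl

/-- The chain of composites of a sequence of composable morphisms. -/
def ofSeq {O M : Type u} (C : CatStr O M) (f : ℕ → M)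
    (hf : ∀ j, C.tgt (f j) = C.src (f (j + 1))) : Chain C 0 where
  ob j _ := C.src (f j)
  hor j l _ _ := (seqComp C f hf j (l - j)).1
  src j l _ _ := (seqComp C f hf j (l - j)).2.1
  tgt j l _ h := by rw [(seqComp C f hf j (l - j)).2.2, Nat.add_sub_cancel' h]
  one j _ := by rw [Nat.sub_self]; rfl
  comp j l m _ hl hm h := by
    rw [seqComp_comp C f hf j l _ _ (by omega) h, show l - j + (m - l) = m - j by omega]

theorem ofSeq_hor_succ {O M : Type u} (C : CatStr O M) (f : ℕ → M)
    (hf : ∀ j, C.tgt (f j) = C.src (f (j + 1))) (j l : ℕ) (hl : l = j + 1) (h) (h') :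
    (ofSeq C f hf).hor j l h h' = f j := by
  subst hl
  change (seqComp C f hf j (j + 1 - j)).1 = _
  rw [show j + 1 - j = 0 + 1 by omega]
  exact C.one_comp (f j)

end Chain

/-! ### From the fan triangulation and the square to gluing a triangle onto any side. -/

/-- The map `[a] → [n]` sending `0` to `0` and `1, 2, …` to `k, k + 1, …`. -/
def cone (a n k : ℕ) (h : k + a ≤ n + 1) : ⦋a⦌ ⟶ ⦋n⦌ :=
  SimplexCategory.mkHom
    { toFun := fun i => ⟨if i.val = 0 then 0 else k + i.val - 1, by split_ifs <;> omega⟩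
      monotone' := fun i j hij => by
        rw [Fin.le_def] at hij ⊢
        dsimp only
        split_ifs <;> omega }

theorem cone_val (a n k : ℕ) (h : k + a ≤ n + 1) (i : Fin (a + 1)) :
    (cone a n k h i).val = if i.val = 0 then 0 else k + i.val - 1 := rfl

/-- The Segal conditions for the triangulations of polygons by the triangles `0, j + 1, j + 2` and
for the other triangulation of the square. -/
structure IsFanSegal (X : SSet.{u}) : Prop where
  ext : ∀ (n : ℕ) (y y' : X _⦋n + 2⦌),
    (∀ j : Fin (n + 1), X.map (cone 2 (n + 2) (j + 1) (by omega)).op y =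
      X.map (cone 2 (n + 2) (j + 1) (by omega)).op y') → y = y'
  fill : ∀ (n : ℕ) (t : Fin (n + 1) → X _⦋2⦌),
    (∀ i j : Fin (n + 1), j.val = i.val + 1 → X.δ 1 (t i) = X.δ 2 (t j)) →
      ∃ y : X _⦋n + 2⦌, ∀ j : Fin (n + 1), X.map (cone 2 (n + 2) (j + 1) (by omega)).op y = t j
  square : ∀ f g : X _⦋2⦌, X.δ 0 f = X.δ 1 g → ∃! z : X _⦋3⦌, X.δ 2 z = f ∧ X.δ 0 z = g

/-- The Segal condition for gluing a triangle along an edge `k < k + 1` of a polygon. -/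
def HasEarFillers (X : SSet.{u}) : Prop :=
  ∀ {m : ℕ} (k : Fin (m + 2)) (y : X _⦋m + 2⦌) (t : X _⦋2⦌),
    X.map (SimplexCategory.mkOfSucc k).op y = X.δ 1 t →
      ∃! w : X _⦋m + 3⦌, X.δ k.succ.castSucc w = y ∧ X.map (earTriangle k).op w = t

theorem map_δ (X : SSet.{u}) {n : ℕ} (i : Fin (n + 2)) {c : SimplexCategory} (f : ⦋n + 1⦌ ⟶ c)
    (y : X.obj (op c)) : X.δ i (X.map f.op y) = X.map (SimplexCategory.δ i ≫ f).op y :=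
  map_map_op X _ _ y

theorem map_δ' (X : SSet.{u}) {n : ℕ} (i : Fin (n + 2)) {c : SimplexCategory} (f : c ⟶ ⦋n⦌)
    (y : X _⦋n + 1⦌) : X.map f.op (X.δ i y) = X.map (f ≫ SimplexCategory.δ i).op y :=
  map_map_op X _ _ y

theorem map_congr (X : SSet.{u}) {a b : SimplexCategory} {f g : a ⟶ b}
    (h : ∀ i, (f i).val = (g i).val) (y : X.obj (op b)) : X.map f.op y = X.map g.op y := by
  rw [simplexHom_ext f g h]

theorem cone_two_three_one (h) : cone 2 3 (0 + 1) h = SimplexCategory.δ 3 := by decide +revert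

theorem cone_two_three_two (h) : cone 2 3 (1 + 1) h = SimplexCategory.δ 1 := by decide +revert

/-- The `square` condition glues `t` to the triangle `0, k, k+1` of `y`, giving a 3-simplex `Q` on
`0, k, k+1, k+2`. Passing to the other diagonal replaces these two triangles by `0, k, k+1` and `0,
k+1, k+2`. With the remaining fan triangles of `y` they form a fan of the larger polygon, and this
fan determines `w`. -/
theorem IsFanSegal.hasEarFillers {X : SSet.{u}} (hX : IsFanSegal X) : HasEarFillers X := by
  intro m k y t hyt
  have hk := k.isLt
  have hdeg : ∀ i : Fin 2,
      ((SimplexCategory.δ 0 ≫ cone 2 (m + 2) k.val (by omega) : ⦋1⦌ ⟶ ⦋m + 2⦌) i).val =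
        (SimplexCategory.mkOfSucc k i).val := by
    intro i
    simp only [comp_val, δ_val, cone_val, mkOfSucc_val, Fin.val_zero]
    split_ifs <;> first | omega | contradiction
  -- the square with vertices `0, k, k + 1, k + 2`
  have hQ₁ : ∃! Q : X _⦋3⦌, X.δ 2 Q = X.map (cone 2 (m + 2) k.val (by omega)).op y ∧
      X.δ 0 Q = t := by
    apply hX.square
    rw [map_δ, ← hyt]
    exact map_congr X hdeg y
  obtain ⟨Q, ⟨hQ2, hQ0⟩, hQ⟩ := hQ₁
  -- For `k = 0` the square has vertices `0, 0, 1, 2`, so by uniqueness `Q` is the degenerate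
  -- simplex `s₀ t`. This case is separate because the fan then has no triangle `0, k, k+1`.
  have hQk : k.val = 0 → X.δ 1 Q = t := by
    intro hk0
    rw [← hQ (X.σ 0 t) ⟨?_, deg_face X (by decide) t⟩]
    · exact deg_face X (by decide) t
    · rw [face_deg X (i' := 1) (j' := 0) (by decide) t, ← hyt]
      refine (map_map_op X _ _ y).trans (map_congr X ?_ y)
      intro i
      simp only [comp_val, σ_val, cone_val, mkOfSucc_val, Fin.val_zero]
      split_ifs <;> omega
  have hquad : ∀ w : X _⦋m + 3⦌, X.δ k.succ.castSucc w = y → X.map (earTriangle k).op w = t →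
      X.map (cone 3 (m + 3) k.val (by omega)).op w = Q := by
    intro w h1 h2
    apply hQ
    constructor
    · rw [map_δ, ← h1, map_δ']
      apply map_congr
      intro i
      have := i.isLt
      simp only [SimplexCategory.len_mk] at this
      simp only [comp_val, δ_val, cone_val, Fin.val_castSucc, Fin.val_succ, Fin.val_two]
      split_ifs <;> omega
    · rw [map_δ, ← h2]
      apply map_congr
      intro i
      simp only [comp_val, δ_val, cone_val, earTriangle_val, Fin.val_zero]
      split_ifs <;> first | omega | contradiction
  -- the triangles of the fan at `0` in terms of the square and of `y`
  have fan_lt : ∀ (w : X _⦋m + 3⦌) (j : ℕ) (hj : j + 1 < k.val),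
      X.map (cone 2 (m + 3) (j + 1) (by omega)).op w =
        X.map (cone 2 (m + 2) (j + 1) (by omega)).op (X.δ k.succ.castSucc w) := by
    intro w j hj
    rw [map_δ']
    apply map_congr
    intro i
    have := i.isLt
    simp only [SimplexCategory.len_mk] at this
    simp only [comp_val, δ_val, cone_val, Fin.val_castSucc, Fin.val_succ]
    split_ifs <;> omega
  have fan_gt : ∀ (w : X _⦋m + 3⦌) (j : ℕ) (hj : k.val ≤ j) (hj' : j ≤ m),
      X.map (cone 2 (m + 3) (j + 1 + 1) (by omega)).op w =
        X.map (cone 2 (m + 2) (j + 1) (by omega)).op (X.δ k.succ.castSucc w) := by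
    intro w j hj hj'
    rw [map_δ']
    apply map_congr
    intro i
    simp only [comp_val, δ_val, cone_val, Fin.val_castSucc, Fin.val_succ]
    split_ifs <;> omega
  have fan_eq : ∀ (w : X _⦋m + 3⦌), X.map (cone 2 (m + 3) (k.val + 1) (by omega)).op w =
        X.δ 1 (X.map (cone 3 (m + 3) k.val (by omega)).op w) := by
    intro w
    rw [map_δ]
    apply map_congr
    intro i
    simp only [comp_val, δ_val, cone_val, Fin.val_one]
    split_ifs <;> first | omega | contradiction
  have fan_pred : ∀ (w : X _⦋m + 3⦌) (j : ℕ) (hj : j + 1 = k.val),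
      X.map (cone 2 (m + 3) (j + 1) (by omega)).op w =
        X.δ 3 (X.map (cone 3 (m + 3) k.val (by omega)).op w) := by
    intro w j hj
    rw [map_δ]
    apply map_congr
    intro i
    have := i.isLt
    simp only [SimplexCategory.len_mk] at this
    simp only [comp_val, δ_val, cone_val, show ((3 : Fin 4) : ℕ) = 3 from rfl]
    split_ifs <;> omega
  have huniq : ∀ w w' : X _⦋m + 3⦌, X.δ k.succ.castSucc w = y → X.map (earTriangle k).op w = t →
      X.δ k.succ.castSucc w' = y → X.map (earTriangle k).op w' = t → w = w' := by
    intro w w' h1 h2 h1' h2'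
    have hq := (hquad w h1 h2).trans (hquad w' h1' h2').symm
    apply hX.ext (m + 1)
    rintro ⟨j, hj⟩
    simp only
    rcases lt_trichotomy (j + 1) k.val with h | h | h
    · rw [fan_lt w j h, fan_lt w' j h, h1, h1']
    · rw [fan_pred w j h, fan_pred w' j h, hq]
    · by_cases h' : j = k.val
      · subst h'
        rw [fan_eq, fan_eq, hq]
      · obtain ⟨j, rfl⟩ : ∃ j', j = j' + 1 := ⟨j - 1, by omega⟩
        rw [fan_gt w j (by omega) (by omega), fan_gt w' j (by omega) (by omega), h1, h1']
  have fan_y : ∀ i j : ℕ, ∀ (hi : i + 1 + 2 ≤ m + 2 + 1) (hj : j + 1 + 2 ≤ m + 2 + 1), j = i + 1 →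
      X.δ 1 (X.map (cone 2 (m + 2) (i + 1) hi).op y) =
        X.δ 2 (X.map (cone 2 (m + 2) (j + 1) hj).op y) := by
    rintro i j hi hj rfl
    rw [map_δ, map_δ]
    apply map_congr
    intro l
    have := l.isLt
    simp only [SimplexCategory.len_mk] at this
    simp only [comp_val, δ_val, cone_val, Fin.val_one, Fin.val_two]
    split_ifs <;> first | omega | contradiction
  -- The prescribed fan of `w`: entry `j` is the triangle `0, j+1, j+2`. Before `k` it is that of
  -- `y`; at `k - 1` and `k` it comes from `Q`; beyond `k` it is that of `y` with index lowered by
  -- one, since `y` lacks the vertex `k + 1`. In the last branch `j > k`, so the subtraction does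
  -- not truncate.
  let t' : Fin (m + 2) → X _⦋2⦌ := fun j =>
    if h : j.val + 1 < k.val then X.map (cone 2 (m + 2) (j + 1) (by omega)).op y
    else if j.val + 1 = k.val then X.δ (3 : Fin 4) Q
    else if h' : j.val = k.val then X.δ (1 : Fin 4) Q
    else X.map (cone 2 (m + 2) (j - 1 + 1) (by omega)).op y
  have t'_lt : ∀ j : Fin (m + 2), ∀ h : j.val + 1 < k.val,
      t' j = X.map (cone 2 (m + 2) (j + 1) (by omega)).op y := fun j h => dif_pos h
  have t'_pred : ∀ j : Fin (m + 2), j.val + 1 = k.val → t' j = X.δ (3 : Fin 4) Q := fun j h =>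
    (dif_neg (by omega)).trans (if_pos h)
  have t'_eq : ∀ j : Fin (m + 2), j.val = k.val → t' j = X.δ (1 : Fin 4) Q := fun j h =>
    (dif_neg (by omega)).trans ((if_neg (by omega)).trans (dif_pos h))
  have t'_gt : ∀ j : Fin (m + 2), ∀ h : k.val < j.val,
      t' j = X.map (cone 2 (m + 2) (j - 1 + 1) (by omega)).op y := fun j h =>
    (dif_neg (by omega)).trans ((if_neg (by omega)).trans (dif_neg (by omega)))
  obtain ⟨w, hw⟩ := hX.fill (m + 1) t' (by
    intro i j hij
    rcases lt_trichotomy (j.val + 1) k.val with h | h | h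
    · rw [t'_lt i (by omega), t'_lt j h]
      exact fan_y _ _ _ _ hij
    · rw [t'_lt i (by omega), t'_pred j h, face_face X (i' := 2) (j' := 2) (by decide) Q, hQ2,
        map_δ, map_δ]
      apply map_congr
      intro l
      have := l.isLt
      simp only [SimplexCategory.len_mk] at this
      simp only [comp_val, δ_val, cone_val, Fin.val_one, Fin.val_two]
      split_ifs <;> first | omega | contradiction
    · rcases lt_trichotomy j.val k.val with h' | h' | h'
      · omega
      · rw [t'_pred i (by omega), t'_eq j h']
        exact face_face X (by decide) Q
      · by_cases h'' : i.val = k.val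
        · rw [t'_eq i h'', t'_gt j h', face_face X (i' := 1) (j' := 2) (by decide) Q, hQ2,
            map_δ, map_δ]
          apply map_congr
          intro l
          have := l.isLt
          simp only [SimplexCategory.len_mk] at this
          simp only [comp_val, δ_val, cone_val, Fin.val_one, Fin.val_two]
          split_ifs <;> first | omega | contradiction
        · rw [t'_gt i (by omega), t'_gt j h']
          exact fan_y _ _ _ _ (by omega))
  -- A 3-simplex is determined by its fan triangles `d₃` and `d₁`, which are the entries `k - 1` and
  -- `k` of the fan of `w`.
  have hwquad : 0 < k.val → X.map (cone 3 (m + 3) k.val (by omega)).op w = Q := by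
    intro hk0
    apply hX.ext 1
    intro j
    have h3 : ∀ q : X _⦋3⦌, X.map (cone 2 3 (0 + 1) (by omega)).op q = X.δ 3 q := fun q =>
      by rw [cone_two_three_one]; rfl
    have h1 : ∀ q : X _⦋3⦌, X.map (cone 2 3 (1 + 1) (by omega)).op q = X.δ 1 q := fun q =>
      by rw [cone_two_three_two]; rfl
    fin_cases j
    · refine (h3 _).trans (Eq.trans ?_ (h3 _).symm)
      rw [← fan_pred w (k.val - 1) (by omega)]
      exact (hw ⟨k.val - 1, by omega⟩).trans (t'_pred _ (by simp only; omega))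
    · refine (h1 _).trans (Eq.trans ?_ (h1 _).symm)
      rw [← fan_eq w]
      exact (hw ⟨k.val, by omega⟩).trans (t'_eq _ rfl)
  have hw1 : X.δ k.succ.castSucc w = y := by
    apply hX.ext m
    rintro ⟨j, hj⟩
    simp only
    rcases lt_trichotomy (j + 1) k.val with h | h | h
    · rw [← fan_lt w j h]
      exact (hw ⟨j, by omega⟩).trans (t'_lt _ h)
    · have e : X.map (cone 2 (m + 2) (j + 1) (by omega)).op y = X.δ 2 Q := by
        rw [hQ2]
        apply map_congr
        intro i
        simp only [cone_val, h]
      rw [e, ← hwquad (by omega), map_δ, map_δ']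
      apply map_congr
      intro i
      have := i.isLt
      simp only [SimplexCategory.len_mk] at this
      simp only [comp_val, δ_val, cone_val, Fin.val_castSucc, Fin.val_succ, Fin.val_two]
      split_ifs <;> omega
    · rw [← fan_gt w j (by omega) (by omega)]
      exact (hw ⟨j + 1, by omega⟩).trans (t'_gt _ (by simp only; omega))
  have hw2 : X.map (earTriangle k).op w = t := by
    by_cases hk0 : k.val = 0
    · rw [← hQk hk0, ← t'_eq ⟨0, by omega⟩ hk0.symm, ← hw ⟨0, by omega⟩]
      apply map_congr
      intro i
      simp only [cone_val, earTriangle_val]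
      split_ifs <;> omega
    · rw [← hQ0, ← hwquad (by omega), map_δ]
      apply map_congr
      intro i
      simp only [comp_val, δ_val, cone_val, earTriangle_val, Fin.val_zero]
      split_ifs <;> first | omega | contradiction
  exact ⟨w, ⟨hw1, hw2⟩, fun w' h' => huniq w' w h'.1 h'.2 hw1 hw2⟩

/-! ### Combinatorics of polygon triangulations: ears, and triangles over sides. -/

namespace IsPolygonTriangulation

variable {n : ℕ} {E : Fin (n + 1) → Fin (n + 1) → Prop}

theorem side (hE : IsPolygonTriangulation E) (i j : Fin (n + 1)) (h : j.val = i.val + 1) :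
    E i j := by
  apply hE.maximal
  · rw [Fin.lt_def]
    omega
  · intro k l _
    simp only [Fin.lt_def]
    omega

/-- Induction on the length of `i j`. If `i, i+2` is not in `E`, maximality yields a segment of `E`
crossing it. As that segment does not cross `i j`, it starts at `i + 1` and ends at or before `j`;
it is shorter and of length at least `2`, so the induction applies to it. -/
theorem exists_ear_below (hE : IsPolygonTriangulation E) (d : ℕ) :
    ∀ i j : Fin (n + 1), E i j → j.val = i.val + d + 2 →
    ∃ k l, E k l ∧ l.val = k.val + 2 := by
  induction d using Nat.strong_induction_on with
  | _ d ih =>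
    intro i j h hij
    by_contra hc
    have hd : d ≠ 0 := by
      rintro rfl
      exact hc ⟨i, j, h, by omega⟩
    let j' : Fin (n + 1) := ⟨i.val + 2, by omega⟩
    have h2 : ¬ E i j' := fun h' => hc ⟨i, j', h', rfl⟩
    apply h2
    apply hE.maximal
    · rw [Fin.lt_def]
      simp only [j']
      omega
    · intro k l hkl
      have h₁ := hE.noncrossing _ _ _ _ h hkl
      have h₂ := hE.noncrossing _ _ _ _ hkl h
      have h₃ := fun hd' hl => ih (l.val - k.val - 2) hd' k l hkl hl
      simp only [Fin.lt_def, j'] at h₁ h₂ ⊢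
      refine ⟨fun h' => hc (h₃ (by omega) (by omega)), by omega⟩

theorem exists_ear (hE : IsPolygonTriangulation E) (hn : 2 ≤ n) :
    ∃ k l, E k l ∧ l.val = k.val + 2 := by
  apply hE.exists_ear_below (n - 2) 0 (Fin.last n)
  · apply hE.maximal
    · rw [Fin.lt_def, Fin.val_last, Fin.val_zero]
      omega
    · intro k l _
      simp only [Fin.lt_def, Fin.val_last, Fin.val_zero]
      omega
  · rw [Fin.val_last, Fin.val_zero]
    omega

/-- Shrinks a segment `i j` of `E` lying over the side `a b` until it shares exactly one endpoint
with it. If `i b` is not in `E`, a segment of `E` crosses it; this one stays inside `i j` and still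
lies over `a b`, so it is shorter. -/
theorem exists_apex_below (hE : IsPolygonTriangulation E) (a b : Fin (n + 1))
    (hab : b.val = a.val + 1) (d : ℕ) :
    ∀ i j : Fin (n + 1), E i j → i ≤ a → b ≤ j → j.val = i.val + d + 2 →
      (∃ k, k < a ∧ E k b) ∨ (∃ l, b < l ∧ E a l) := by
  induction d using Nat.strong_induction_on with
  | _ d ih =>
    intro i j h hi hj hij
    by_cases hia : i = a
    · subst hia
      exact Or.inr ⟨j, by rw [Fin.lt_def]; omega, h⟩
    by_cases hjb : j = b
    · subst hjb
      exact Or.inl ⟨i, by rw [Fin.lt_def]; omega, h⟩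
    have hi' : i.val < a.val := by
      have := Fin.val_ne_of_ne hia
      rw [Fin.le_def] at hi
      omega
    have hj' : b.val < j.val := by
      have := Fin.val_ne_of_ne hjb
      rw [Fin.le_def] at hj
      omega
    by_contra hc
    apply hc
    refine Or.inl ⟨i, hi', ?_⟩
    apply hE.maximal
    · rw [Fin.lt_def]
      omega
    · intro k l hkl
      have h₁ := hE.noncrossing _ _ _ _ h hkl
      have h₂ := hE.noncrossing _ _ _ _ hkl h
      have h₃ := fun hd' hk hl hkl' => ih (l.val - k.val - 2) hd' k l hkl hk hl hkl'
      simp only [Fin.lt_def, Fin.le_def] at h₁ h₂ h₃ ⊢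
      refine ⟨fun h' => hc (h₃ (by omega) (by omega) (by omega) (by omega)), by omega⟩

/-- Every side `a < a + 1` is the side of a triangle. -/
theorem exists_apex (hE : IsPolygonTriangulation E) (hn : 2 ≤ n) (a b : Fin (n + 1))
    (hab : b.val = a.val + 1) :
    (∃ k, k < a ∧ E k a ∧ E k b) ∨ (∃ l, b < l ∧ E a l ∧ E b l) := by
  classical
  have h : (∃ k, k < a ∧ E k b) ∨ (∃ l, b < l ∧ E a l) := by
    apply hE.exists_apex_below a b hab (n - 2) 0 (Fin.last n)
    · apply hE.maximal
      · rw [Fin.lt_def, Fin.val_last, Fin.val_zero]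
        omega
      · intro k l _
        simp only [Fin.lt_def, Fin.val_last, Fin.val_zero]
        omega
    · exact Fin.zero_le _
    · exact Fin.le_last _
    · rw [Fin.val_last, Fin.val_zero]
      omega
  rcases h with ⟨k, hk⟩ | ⟨l, hl⟩
  -- Take the neighbour `k` of `b` closest to `a`. A segment `p q` crossing `k a` cannot cross `k
  -- b`, so it ends at `b` with `k < p < a`, against the choice of `k`.
  · obtain ⟨k, ⟨hk, hkb⟩, hmax⟩ := (Set.toFinite {k | k < a ∧ E k b}).exists_maximal ⟨k, hk⟩
    refine Or.inl ⟨k, hk, ?_, hkb⟩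
    apply hE.maximal _ _ hk
    intro p q hpq
    have h₁ := hE.noncrossing _ _ _ _ hkb hpq
    have h₂ := hE.noncrossing _ _ _ _ hpq hkb
    refine ⟨?_, ?_⟩
    · rintro ⟨h3, h4, h5⟩
      by_cases hq : q = b
      · subst hq
        exact absurd (hmax ⟨h4, hpq⟩ h3.le) (not_le_of_gt h3)
      · have := Fin.val_ne_of_ne hq
        simp only [Fin.lt_def] at *
        omega
    · simp only [Fin.lt_def] at *
      omega
  · obtain ⟨l, ⟨hl, hal⟩, hmin⟩ := (Set.toFinite {l | b < l ∧ E a l}).exists_minimal ⟨l, hl⟩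
    refine Or.inr ⟨l, hl, hal, ?_⟩
    apply hE.maximal _ _ hl
    intro p q hpq
    have h₁ := hE.noncrossing _ _ _ _ hal hpq
    have h₂ := hE.noncrossing _ _ _ _ hpq hal
    refine ⟨?_, ?_⟩
    · simp only [Fin.lt_def] at *
      omega
    · rintro ⟨h3, h4, h5⟩
      by_cases hp : p = a
      · subst hp
        exact absurd (hmin ⟨h4, hpq⟩ h5.le) (not_le_of_gt h5)
      · have := Fin.val_ne_of_ne hp
        simp only [Fin.lt_def] at *
        omega

end IsPolygonTriangulation

namespace IsPolygonTriangulation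

variable {m : ℕ} {E : Fin (m + 4) → Fin (m + 4) → Prop}

/-- The vertex cut off by a segment `k, k + 2` only belongs to two sides. -/
theorem eq_of_ear (hE : IsPolygonTriangulation (n := m + 3) E) {a b i j : Fin (m + 4)} (h : E a b)
    (hab : b.val = a.val + 2) (hij : E i j) :
    (i.val = a.val + 1 → j.val = a.val + 2) ∧ (j.val = a.val + 1 → i.val = a.val) := by
  have h₀ := hE.lt _ _ hij
  have h₁ := hE.noncrossing _ _ _ _ h hij
  have h₂ := hE.noncrossing _ _ _ _ hij h
  simp only [Fin.lt_def] at h₀ h₁ h₂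
  omega

/-- Maximality survives because the segments of `E` lost with the vertex `k + 1` are sides, by
`eq_of_ear`, and a side crosses nothing. -/
theorem removeEar (hE : IsPolygonTriangulation (n := m + 3) E) (k : Fin (m + 2)) {a b : Fin (m + 4)}
    (h : E a b) (ha : a.val = k.val) (hb : b.val = k.val + 2) :
    IsPolygonTriangulation (n := m + 2) (fun i j =>
      E ((SimplexCategory.δ k.succ.castSucc : ⦋m + 2⦌ ⟶ ⦋m + 3⦌) i)
        ((SimplexCategory.δ k.succ.castSucc : ⦋m + 2⦌ ⟶ ⦋m + 3⦌) j)) where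
  lt i j hij := by
    have := hE.lt _ _ hij
    simp only [Fin.lt_def, δ_val, Fin.val_castSucc, Fin.val_succ] at this ⊢
    split_ifs at this <;> omega
  noncrossing i j p q hij hpq := by
    have := hE.noncrossing _ _ _ _ hij hpq
    simp only [Fin.lt_def, δ_val, Fin.val_castSucc, Fin.val_succ] at this ⊢
    split_ifs at this <;> omega
  maximal i j hij H := by
    apply hE.maximal
    · simp only [Fin.lt_def, δ_val, Fin.val_castSucc, Fin.val_succ] at hij ⊢
      split_ifs <;> omega
    · intro p q hpq
      have h₁ := hE.eq_of_ear h (by omega) hpq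
      have hlt := hE.lt _ _ hpq
      by_cases hc : p.val = k.val + 1 ∨ q.val = k.val + 1
      · rw [Fin.lt_def] at hlt
        simp only [Fin.lt_def]
        omega
      · have key : ∀ r : Fin (m + 4), r.val ≠ k.val + 1 → ∃ r' : Fin (m + 3),
            (SimplexCategory.δ k.succ.castSucc : ⦋m + 2⦌ ⟶ ⦋m + 3⦌) r' = r := by
          intro r hr
          refine ⟨⟨if r.val < k.val + 1 then r.val else r.val - 1, by split_ifs <;> omega⟩, ?_⟩
          apply Fin.ext
          simp only [δ_val, Fin.val_castSucc, Fin.val_succ]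
          split_ifs <;> omega
        obtain ⟨p, rfl⟩ := key p (by omega)
        obtain ⟨q, rfl⟩ := key q (by omega)
        have := H p q hpq
        simp only [Fin.lt_def, δ_val, Fin.val_castSucc, Fin.val_succ] at this ⊢
        split_ifs <;> omega

end IsPolygonTriangulation

/-! ### All triangulations from gluing ears. -/

/-- The triangle with given vertices. -/
def triangle {n : ℕ} (a b c : Fin (n + 1)) (hab : a ≤ b) (hbc : b ≤ c) : ⦋2⦌ ⟶ ⦋n⦌ :=
  SimplexCategory.mkHom
    { toFun := ![a, b, c]
      monotone' := Fin.monotone_iff_le_succ.2 (by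
        intro i
        fin_cases i
        · exact hab
        · exact hbc) }

theorem IsPolygonTriangulation.polygonTriangle_two {E : Fin 3 → Fin 3 → Prop}
    (hE : IsPolygonTriangulation (n := 2) E) (t : PolygonTriangle (n := 2) E) : t.1 = 𝟙 _ := by
  have h01 := hE.lt _ _ t.2.1
  have h12 := hE.lt _ _ t.2.2.1
  rw [Fin.lt_def] at h01 h12
  have h2 := (t.1 2).isLt
  simp only [SimplexCategory.len_mk] at h2
  apply simplexHom_ext
  intro i
  fin_cases i
  · change (t.1 0).val = 0
    omega
  · change (t.1 1).val = 1
    omega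
  · change (t.1 2).val = 2
    omega

/-- Induction on the number of vertices, removing an ear: every triangle of `E` is either the ear or
comes from the smaller polygon. The induction starts at the triangle, where the Segal map is a
bijection for every simplicial set. -/
theorem HasEarFillers.isTwoSegal {X : SSet.{u}} (hX : HasEarFillers X) : IsTwoSegal X := by
  suffices H : ∀ (n : ℕ) (E : Fin (n + 2 + 1) → Fin (n + 2 + 1) → Prop),
      IsPolygonTriangulation E → Function.Bijective (segalMap X E) by
    intro n hn E hE
    obtain ⟨n, rfl⟩ : ∃ n', n = n' + 2 := ⟨n - 2, by omega⟩
    exact H n E hE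
  intro m
  induction m with
  | zero =>
    intro E hE
    have ht := hE.polygonTriangle_two
    have hid : E ((𝟙 ⦋2⦌ : ⦋2⦌ ⟶ ⦋2⦌) 0) ((𝟙 ⦋2⦌ : ⦋2⦌ ⟶ ⦋2⦌) 1) ∧
        E ((𝟙 ⦋2⦌ : ⦋2⦌ ⟶ ⦋2⦌) 1) ((𝟙 ⦋2⦌ : ⦋2⦌ ⟶ ⦋2⦌) 2) ∧
        E ((𝟙 ⦋2⦌ : ⦋2⦌ ⟶ ⦋2⦌) 0) ((𝟙 ⦋2⦌ : ⦋2⦌ ⟶ ⦋2⦌) 2) := by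
      refine ⟨hE.side _ _ rfl, hE.side _ _ rfl, hE.maximal _ _ (by decide) ?_⟩
      intro k l hkl
      have := hE.lt _ _ hkl
      change ¬ ((0 : Fin 3) < k ∧ k < (2 : Fin 3) ∧ (2 : Fin 3) < l) ∧
        ¬ (k < (0 : Fin 3) ∧ (0 : Fin 3) < l ∧ l < (2 : Fin 3))
      simp only [Fin.lt_def, Fin.val_zero, Fin.val_two]
      omega
    let t₀ : PolygonTriangle (n := 2) E := ⟨𝟙 _, hid⟩
    have ht₀ : ∀ t, t = t₀ := fun t => Subtype.ext (ht t)
    constructor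
    · intro y y' h
      have := congrFun (congrArg Subtype.val h) t₀
      change X.map (𝟙 ⦋2⦌).op y = X.map (𝟙 ⦋2⦌).op y' at this
      simpa using this
    · intro x
      refine ⟨x.1 t₀, ?_⟩
      apply Subtype.ext
      funext t
      rw [ht₀ t]
      exact map_id_op X _
  | succ m ih =>
    intro E hE
    obtain ⟨a, b, hab, hb⟩ := hE.exists_ear (by omega)
    let k : Fin (m + 2) := ⟨a.val, by omega⟩
    have hE' := hE.removeEar k hab rfl hb
    let d : ⦋m + 2⦌ ⟶ ⦋m + 3⦌ := SimplexCategory.δ k.succ.castSucc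
    have d_val : ∀ i, (d i).val = if i.val < a.val + 1 then i.val else i.val + 1 := fun i => by
      simp only [d, δ_val, Fin.val_castSucc, Fin.val_succ, k]
    obtain ⟨hinj, hsurj⟩ := ih _ hE'
    have hear : E (earTriangle k 0) (earTriangle k 1) ∧ E (earTriangle k 1) (earTriangle k 2) ∧
        E (earTriangle k 0) (earTriangle k 2) := by
      refine ⟨hE.side _ _ ?_, hE.side _ _ ?_, ?_⟩
      · simp only [earTriangle_val, Fin.val_zero, Fin.val_one]
        omega
      · simp only [earTriangle_val, Fin.val_two, Fin.val_one]
        omega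
      · convert hab using 1
        · apply Fin.ext
          simp only [earTriangle_val, Fin.val_zero, k]
          omega
        · apply Fin.ext
          simp only [earTriangle_val, Fin.val_two, k]
          omega
    let te : PolygonTriangle (n := m + 3) E := ⟨earTriangle k, hear⟩
    let up : PolygonTriangle (n := m + 2) (fun i j => E (d i) (d j)) →
        PolygonTriangle (n := m + 3) E := fun t => ⟨t.1 ≫ d, t.2⟩
    have hcases : ∀ t : PolygonTriangle (n := m + 3) E, t = te ∨ ∃ t', t = up t' := by
      intro t
      have h01 := hE.eq_of_ear hab hb t.2.1
      have h12 := hE.eq_of_ear hab hb t.2.2.1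
      have h02 := hE.eq_of_ear hab hb t.2.2.2
      have l01 := hE.lt _ _ t.2.1
      have l12 := hE.lt _ _ t.2.2.1
      rw [Fin.lt_def] at l01 l12
      by_cases h : (t.1 1).val = a.val + 1
      · left
        apply Subtype.ext
        apply simplexHom_ext
        intro i
        change _ = (earTriangle k i).val
        rw [earTriangle_val]
        fin_cases i
        · change (t.1 0).val = 0 + a.val
          omega
        · change (t.1 1).val = 1 + a.val
          omega
        · change (t.1 2).val = 2 + a.val
          omega
      · right
        have e : t.1 = (t.1 ≫ SimplexCategory.σ k.castSucc) ≫ d := by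
          apply simplexHom_ext
          intro i
          have hi : (t.1 i).val ≠ a.val + 1 := by
            fin_cases i
            · change (t.1 0).val ≠ a.val + 1
              omega
            · exact h
            · change (t.1 2).val ≠ a.val + 1
              omega
          simp only [comp_val, d_val, σ_val, Fin.val_castSucc, k]
          split_ifs <;> omega
        refine ⟨⟨t.1 ≫ SimplexCategory.σ k.castSucc, ?_⟩, Subtype.ext e⟩
        have := t.2
        rw [e] at this
        exact this
    have hup : ∀ (w : X _⦋m + 3⦌) t', X.map (up t').1.op w = X.map t'.1.op (X.map d.op w) :=
      fun w t' => (map_map_op X _ _ w).symm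
    constructor
    · intro y y' h
      have h' : ∀ t : PolygonTriangle (n := m + 3) E, X.map t.1.op y = X.map t.1.op y' :=
        fun t => congrFun (congrArg Subtype.val h) t
      have hd : X.map d.op y = X.map d.op y' := by
        apply hinj
        apply Subtype.ext
        funext t
        exact (hup y t).symm.trans ((h' (up t)).trans (hup y' t))
      refine (hX k (X.map d.op y') (X.map (earTriangle k).op y') ?_).unique
        ⟨hd, h' te⟩ ⟨rfl, rfl⟩
      rw [map_δ, map_map_op]
      apply map_congr
      intro i
      have := i.isLt
      simp only [SimplexCategory.len_mk] at this
      simp only [comp_val, d_val, δ_val, earTriangle_val, mkOfSucc_val, Fin.val_one, k]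
      split_ifs <;> omega
    · intro x
      obtain ⟨y, hy⟩ := hsurj ⟨fun t => x.1 (up t), fun t t' i j h => by
        apply x.2
        change SimplexCategory.δ i ≫ t.1 ≫ d = SimplexCategory.δ j ≫ t'.1 ≫ d
        rw [← Category.assoc, h, Category.assoc]⟩
      have hy' : ∀ t, X.map t.1.op y = x.1 (up t) := fun t => congrFun (congrArg Subtype.val hy) t
      -- An element of `SegalLimit` only records agreement between triangles, so the edge `k, k+1`
      -- of `y` has to be seen through some triangle of the smaller polygon; `exists_apex` provides
      -- one.
      have hglue : X.map (SimplexCategory.mkOfSucc k).op y = X.δ 1 (x.1 te) := by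
        -- a triangle over the side `k, k + 1` of the smaller polygon
        obtain ⟨t, i, hti⟩ : ∃ (t : PolygonTriangle (n := m + 2) (fun i j => E (d i) (d j)))
            (i : Fin 3), SimplexCategory.δ i ≫ t.1 = SimplexCategory.mkOfSucc k := by
          rcases hE'.exists_apex (by omega) k.castSucc k.succ (by simp) with
            ⟨l, hl, h1, h2⟩ | ⟨l, hl, h1, h2⟩
          · refine ⟨⟨triangle l k.castSucc k.succ hl.le (Fin.castSucc_lt_succ).le, h1,
              hE'.side _ _ rfl, h2⟩, 0, ?_⟩
            apply simplexHom_ext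
            intro i
            rw [mkOfSucc_val]
            fin_cases i <;> rfl
          · refine ⟨⟨triangle k.castSucc k.succ l (Fin.castSucc_lt_succ).le hl.le,
              hE'.side _ _ rfl, h2, h1⟩, 2, ?_⟩
            apply simplexHom_ext
            intro i
            rw [mkOfSucc_val]
            fin_cases i <;> rfl
        have h2 := x.2 (up t) te i 1 (by
          change SimplexCategory.δ i ≫ t.1 ≫ d = SimplexCategory.δ 1 ≫ earTriangle k
          rw [← Category.assoc, hti]
          apply simplexHom_ext
          intro i
          have := i.isLt
          simp only [SimplexCategory.len_mk] at this
          simp only [comp_val, d_val, δ_val, earTriangle_val, mkOfSucc_val, Fin.val_one, k]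
          split_ifs <;> omega)
        rw [← h2, ← hy', map_δ, hti]
      obtain ⟨w, ⟨hw1, hw2⟩, -⟩ := hX k y (x.1 te) hglue
      refine ⟨w, ?_⟩
      apply Subtype.ext
      funext t
      rcases hcases t with rfl | ⟨t', rfl⟩
      · exact hw2
      · refine (hup w t').trans (Eq.trans ?_ (hy' t'))
        rw [← hw1]
        rfl

/-! ### Simplices of the Waldhausen construction as sequences of horizontal morphisms. -/

namespace AugDoubleFunctor

variable {D : AugStDoubleCat.{u}} {n : ℕ} {F F' : AugDoubleFunctor (W n) D}

theorem wHor_congr (F : AugDoubleFunctor (W n) D) {i j l i' j' l' : Fin (n + 1)} (hij : i ≤ j)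
    (hjl : j ≤ l) (hi : i = i') (hj : j = j') (hl : l = l') :
    F.wHor i j l hij hjl = F.wHor i' j' l' (hi ▸ hj ▸ hij) (hj ▸ hl ▸ hjl) := by
  subst hi hj hl
  rfl

theorem wOb_congr (F : AugDoubleFunctor (W n) D) {i j i' j' : Fin (n + 1)} (hij : i ≤ j)
    (hi : i = i') (hj : j = j') : F.wOb i j hij = F.wOb i' j' (hi ▸ hj ▸ hij) := by
  subst hi hj
  rfl

/-- The first arrow `(0,0) → (0,1)` is the augmentation morphism of the object `(0,1)`, so the value
at that object replaces it. -/
theorem ext_of_wOb_one {F F' : AugDoubleFunctor (W (n + 1)) D}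
    (h₁ : F.wOb 0 1 (Fin.zero_le _) = F'.wOb 0 1 (Fin.zero_le _))
    (h : ∀ j l hj hl, 1 ≤ j.val → l.val = j.val + 1 → F.wHor 0 j l hj hl = F'.wHor 0 j l hj hl) :
    F = F' := by
  have h01 : F.wHor 0 0 1 le_rfl (Fin.zero_le _) = F'.wHor 0 0 1 le_rfl (Fin.zero_le _) := by
    rw [wHor_aug, wHor_aug, h₁]
  apply ext_wHor_succ
  · rw [← F.src_wHor 0 0 1 le_rfl (Fin.zero_le _), h01, src_wHor]
  · intro j l hj hl hjl
    by_cases h0 : j.val = 0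
    · obtain rfl : j = 0 := Fin.ext h0
      obtain rfl : l = 1 := Fin.ext hjl
      exact h01
    · exact h j l hj hl (by omega) hjl

theorem ext_zero {F F' : AugDoubleFunctor (W 0) D} (h : F.wOb 0 0 le_rfl = F'.wOb 0 0 le_rfl) :
    F = F' :=
  ext_wHor_succ h fun j l _ _ hjl => by omega

theorem ext_one {F F' : AugDoubleFunctor (W 1) D}
    (h : F.wOb 0 1 (Fin.zero_le _) = F'.wOb 0 1 (Fin.zero_le _)) : F = F' :=
  ext_of_wOb_one h fun j l _ _ hj hjl => by omega

theorem ext_two {F F' : AugDoubleFunctor (W 2) D}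
    (h : F.wHor 0 1 2 (Fin.zero_le _) (by decide) = F'.wHor 0 1 2 (Fin.zero_le _) (by decide)) :
    F = F' := by
  apply ext_of_wOb_one
  · rw [← F.src_wHor 0 1 2 (Fin.zero_le _) (by decide), h, src_wHor]
  · intro j l hj hl hj1 hjl
    obtain rfl : j = 1 := Fin.ext (by rw [Fin.val_one]; omega)
    obtain rfl : l = 2 := Fin.ext hjl
    exact h

/-- Double functors from `W n` with a given sequence of horizontal morphisms in the first row. -/
theorem exists_wHor_eq (n : ℕ) (f : ℕ → D.Hor) (hf : ∀ j, D.hor.tgt (f j) = D.hor.src (f (j + 1)))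
    (h₀ : D.hor.src (f 0) ∈ D.A) : ∃ F : AugDoubleFunctor (W n) D,
      (∀ j h, F.wOb 0 j h = D.hor.src (f j)) ∧
        ∀ j l hj hl, l.val = j.val + 1 → F.wHor 0 j l hj hl = f j := by
  refine ⟨(Chain.ofSeq D.hor f hf).toDoubleFunctor n, fun j h => ?_, fun j l hj hl h => ?_⟩
  · rw [Chain.toDoubleFunctor_wOb_zero _ h₀]
    rfl
  · rw [Chain.toDoubleFunctor_wHor_zero _ h₀, Chain.ofSeq_hor_succ _ _ _ _ _ h]

/-- The augmentation morphism into the source of `f 0` is put in front of the sequence. This removes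
the condition that the chain starts in the augmentation set and shifts the index by one. -/
theorem exists_wHor_succ_eq (n : ℕ) (f : ℕ → D.Hor)
    (hf : ∀ j, D.hor.tgt (f j) = D.hor.src (f (j + 1))) : ∃ F : AugDoubleFunctor (W n) D,
      (∀ j h (k : ℕ), j.val = k + 1 → F.wOb 0 j h = D.hor.src (f k)) ∧
        ∀ j l hj hl (k : ℕ), j.val = k + 1 → l.val = k + 2 → F.wHor 0 j l hj hl = f k := by
  let g : ℕ → D.Hor := fun j => Nat.casesOn j (D.augHor (D.hor.src (f 0))) f
  obtain ⟨F, h₁, h₂⟩ := exists_wHor_eq n g (fun j => by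
    cases j with
    | zero => exact tgt_augHor _
    | succ j => exact hf j) (src_augHor _)
  refine ⟨F, fun j h k hk => ?_, fun j l hj hl k hk hk' => ?_⟩
  · rw [h₁, hk]
  · rw [h₂ j l hj hl (by omega), hk]

/-- If `F (i, j)` is in the augmentation set then the horizontal morphism `(0, i, j)` is mapped to
an identity. -/
theorem wHor_eq_one_of_mem (F : AugDoubleFunctor (W n) D) (i j : Fin (n + 1)) (hij : i ≤ j)
    (h : F.wOb i j hij ∈ D.A) : F.wHor 0 i j (Fin.zero_le _) hij =
      D.hor.one (F.wOb 0 j (Fin.zero_le _)) := by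
  -- The bottom of this square is the augmentation morphism of an object of the augmentation set,
  -- hence an identity. A square is determined by its right and bottom sides, so this one is a
  -- horizontal identity, and so is its top.
  have : F.wSq 0 i i j (Fin.zero_le _) le_rfl hij =
      D.hsq.one (F.wVer 0 i j (Fin.zero_le _) hij) := by
    apply sq_ext_cospan
    · rw [wSq_right, D.hsq.tgt_one]
    · rw [wSq_bottom, D.one_functor.tgt, tgt_wVer, wHor_aug, augHor_of_mem h]
  rw [← F.wSq_top 0 i i j (Fin.zero_le _) le_rfl hij, this, D.one_functor.src, src_wVer]

end AugDoubleFunctor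

open AugDoubleFunctor

/-! ### The Waldhausen construction is unital 2-Segal. -/

section Simplices

variable {D : AugStDoubleCat.{u}}

/-- The double functor underlying a simplex of the Waldhausen construction. -/
def asFunctor {n : ℕ} (F : (waldhausenConstruction.obj D) _⦋n⦌) : AugDoubleFunctor (W n) D := F

theorem asFunctor_injective {n : ℕ} {F F' : (waldhausenConstruction.obj D) _⦋n⦌}
    (h : asFunctor F = asFunctor F') : F = F' := h

theorem wHor_map {m n : ℕ} (f : ⦋m⦌ ⟶ ⦋n⦌) (F : (waldhausenConstruction.obj D) _⦋n⦌)
    (i j l : Fin (m + 1)) (hij : i ≤ j) (hjl : j ≤ l) :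
    (asFunctor ((waldhausenConstruction.obj D).map f.op F)).wHor i j l hij hjl =
      (asFunctor F).wHor (f i) (f j) (f l) (f.toOrderHom.monotone hij)
        (f.toOrderHom.monotone hjl) := rfl

theorem wOb_map {m n : ℕ} (f : ⦋m⦌ ⟶ ⦋n⦌) (F : (waldhausenConstruction.obj D) _⦋n⦌)
    (i j : Fin (m + 1)) (hij : i ≤ j) :
    (asFunctor ((waldhausenConstruction.obj D).map f.op F)).wOb i j hij =
      (asFunctor F).wOb (f i) (f j) (f.toOrderHom.monotone hij) := rfl

variable (D)

/-- Here `f` is the triangle `0, 1, 3` and `g` the triangle `1, 2, 3` of the wanted `z`. They supply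
row `1` and the right-hand vertical morphism; the first row is recovered by filling squares from
right to left with `cospan`. -/
theorem exists_square_filler (f g : (waldhausenConstruction.obj D) _⦋2⦌)
    (h : (waldhausenConstruction.obj D).δ 0 f = (waldhausenConstruction.obj D).δ 1 g) :
    ∃ z : (waldhausenConstruction.obj D) _⦋3⦌, (waldhausenConstruction.obj D).δ 2 z = f ∧
      (waldhausenConstruction.obj D).δ 0 z = g := by
  have hob : (asFunctor f).wOb 1 2 (by decide) = (asFunctor g).wOb 0 2 (by decide) :=
    congrArg (fun F => (asFunctor F).wOb 0 1 (by decide)) h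
  -- `a` is to be the square `(0,1,2,3)` of `z`, and `b` below the square `(0,1,1,2)` to its left.
  -- Their tops are the arrows `(0,1) → (0,2) → (0,3)`.
  obtain ⟨a, ⟨ha₁, ha₂⟩, -⟩ := D.stable.cospan ((asFunctor f).wVer 0 1 2 (by decide) (by decide))
    ((asFunctor g).wHor 0 1 2 (by decide) (by decide)) (by rw [tgt_wVer, tgt_wHor, hob])
  obtain ⟨b, ⟨hb₁, hb₂⟩, -⟩ := D.stable.cospan (D.hsq.src a)
    ((asFunctor g).wHor 0 0 1 (by decide) (by decide))
    (by rw [tgt_wHor, ← hor_src_bottom, ha₂, src_wHor])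
  have hba : D.hor.tgt (D.vsq.src b) = D.hor.src (D.vsq.src a) := by
    rw [← ver_src_right, hb₁, hor_src_top]
  -- Two arrows, continued by identities because `exists_wHor_succ_eq` expects an infinite sequence.
  let s : ℕ → D.Hor := fun j => Nat.casesOn j (D.vsq.src b) fun j =>
    Nat.casesOn j (D.vsq.src a) fun _ => D.hor.one (D.hor.tgt (D.vsq.src a))
  obtain ⟨z, hz₁, hz₂⟩ := exists_wHor_succ_eq (D := D) 3 s (by
    rintro (_ | _ | j)
    · exact hba
    · exact (D.hor.src_one _).symm
    · exact (D.hor.tgt_one _).trans (D.hor.src_one _).symm)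
  have z01 : z.wOb 0 1 (by decide) = D.hor.src (D.vsq.src b) := hz₁ 1 (by decide) 0 rfl
  have z12 : z.wHor 0 1 2 (by decide) (by decide) = D.vsq.src b :=
    hz₂ 1 2 (by decide) (by decide) 0 rfl rfl
  have z23 : z.wHor 0 2 3 (by decide) (by decide) = D.vsq.src a :=
    hz₂ 2 3 (by decide) (by decide) 1 rfl rfl
  have eb : z.wSq 0 1 1 2 (by decide) (by decide) (by decide) = b := by
    apply sq_ext_span
    · rw [wSq_top, z12]
    · rw [wSq_left, wVer_aug, z01]
      symm
      apply eq_augVer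
      · rw [← hor_src_top]
      · rw [← hor_src_bottom, hb₂, src_wHor]
        exact wOb_self_mem _ _
  have ea : z.wSq 0 1 2 3 (by decide) (by decide) (by decide) = a := by
    apply sq_ext_span
    · rw [wSq_top, z23]
    · rw [← hb₁, ← eb, wSq_left, wSq_right]
  refine ⟨z, ?_, ?_⟩
  · apply asFunctor_injective
    apply ext_two
    change z.wHor 0 1 3 _ _ = _
    have hab : D.hsq.tgt b = D.hsq.src a := hb₁
    -- Both squares have the same right side, and as bottom the augmentation morphism into `(1,3)`.
    -- Comparing tops identifies the composite `(0,1) → (0,3)` with the arrow that determines `f`.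
    have : D.hsq.comp b a hab = (asFunctor f).wSq 0 1 1 2 (by decide) (by decide) (by decide) := by
      apply sq_ext_cospan
      · rw [D.hsq.tgt_comp, ha₁, wSq_right]
      · rw [D.comp_tgt _ _ _ (by rw [hb₂, ha₂, tgt_wHor, src_wHor]),
          D.hor.comp_congr hb₂ ha₂ _ (by rw [tgt_wHor, src_wHor]), wHor_comp, wSq_bottom, wHor_aug,
          wHor_aug, hob]
    rw [← wSq_top _ 0 1 1 2 (by decide) (by decide) (by decide), ← this, D.comp_src _ _ _ hba,
      ← D.hor.comp_congr z12 z23 (by rw [tgt_wHor, src_wHor]) hba, wHor_comp]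
  · apply asFunctor_injective
    apply ext_two
    refine (show z.wHor 1 2 3 (by decide) (by decide) = _ from ?_)
    rw [← z.wSq_bottom 0 1 2 3 (by decide) (by decide) (by decide), ea, ha₂]

theorem cone_two_one_val (n k : ℕ) (h : k + 2 ≤ n + 1) : (cone 2 n k h 1).val = k := rfl

theorem cone_two_two_val (n k : ℕ) (h : k + 2 ≤ n + 1) : (cone 2 n k h 2).val = k + 1 := rfl

/-- The fan triangle `0, j+1, j+2` carries exactly the arrow `(0,j+1) → (0,j+2)`, by `ext_two`, and
these arrows may be any composable sequence. For `square`, uniqueness recovers the squares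
`(0,1,2,3)` and `(0,1,1,2)` from their right and bottom sides. -/
theorem waldhausen_isFanSegal : IsFanSegal (waldhausenConstruction.obj D) where
  ext n y y' h := by
    have h' : ∀ j l hj hl, 1 ≤ j.val → l.val = j.val + 1 →
        (asFunctor y).wHor 0 j l hj hl = (asFunctor y').wHor 0 j l hj hl := by
      intro j l hj hl hj1 hjl
      have e := congrArg (fun F => (asFunctor F).wHor 0 1 2 (by decide) (by decide))
        (h ⟨j.val - 1, by omega⟩)
      simp only [wHor_map] at e
      have h1 : (cone 2 (n + 2) (j.val - 1 + 1) (by omega)) 1 = j := by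
        apply Fin.ext
        rw [cone_two_one_val]
        omega
      have h2 : (cone 2 (n + 2) (j.val - 1 + 1) (by omega)) 2 = l := by
        apply Fin.ext
        rw [cone_two_two_val]
        omega
      rw [wHor_congr _ _ _ rfl h1 h2, wHor_congr (asFunctor y') _ _ rfl h1 h2] at e
      exact e
    apply asFunctor_injective
    apply ext_of_wOb_one _ h'
    rw [← src_wHor _ 0 1 ⟨2, by omega⟩ (Fin.zero_le _) (by rw [Fin.le_def]; simp),
      h' _ _ _ _ (by simp) (by simp), src_wHor]
  fill n t ht := by
    -- Beyond the given arrows the sequence continues with identities of the last target, which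
    -- keeps it composable.
    let f : ℕ → D.Hor := fun j => if h : j < n + 1 then
      (asFunctor (t ⟨j, h⟩)).wHor 0 1 2 (by decide) (by decide) else D.hor.one ((asFunctor (t (Fin.last n))).wOb 0 2 (by decide))
    have f_lt : ∀ j (h : j < n + 1),
        f j = (asFunctor (t ⟨j, h⟩)).wHor 0 1 2 (by decide) (by decide) := fun j h => dif_pos h
    have f_ge : ∀ j (_ : ¬ j < n + 1),
        f j = D.hor.one ((asFunctor (t (Fin.last n))).wOb 0 2 (by decide)) := fun j h => dif_neg h
    obtain ⟨F, -, hF⟩ := exists_wHor_succ_eq (n + 2) f (by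
      intro j
      by_cases h : j < n + 1
      · rw [f_lt j h, tgt_wHor]
        by_cases h' : j + 1 < n + 1
        · rw [f_lt _ h', src_wHor]
          exact congrArg (fun F => (asFunctor F).wOb 0 1 (by decide)) (ht ⟨j, h⟩ ⟨j + 1, h'⟩ rfl)
        · rw [f_ge _ h', D.hor.src_one]
          congr
          omega
      · rw [f_ge j h, f_ge _ (by omega), D.hor.tgt_one, D.hor.src_one])
    refine ⟨F, fun j => ?_⟩
    apply asFunctor_injective
    apply ext_two
    exact (hF (cone 2 (n + 2) (j + 1) (by omega) 1) (cone 2 (n + 2) (j + 1) (by omega) 2)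
      (Fin.zero_le _) ((cone 2 (n + 2) (j + 1) (by omega)).toOrderHom.monotone (by decide)) j.val
      (cone_two_one_val ..) (cone_two_two_val ..)).trans (f_lt j j.isLt)
  square f g h := by
    refine existsUnique_of_exists_of_unique (exists_square_filler D f g h) ?_
    rintro z z' ⟨rfl, rfl⟩ ⟨h₁, h₂⟩
    have e13 : (asFunctor z').wVer 0 1 3 (by decide) (by decide) =
        (asFunctor z).wVer 0 1 3 (by decide) (by decide) :=
      congrArg (fun F => (asFunctor F).wVer 0 1 2 (by decide) (by decide)) h₁
    have e123 : (asFunctor z').wHor 1 2 3 (by decide) (by decide) =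
        (asFunctor z).wHor 1 2 3 (by decide) (by decide) :=
      congrArg (fun F => (asFunctor F).wHor 0 1 2 (by decide) (by decide)) h₂
    have e112 : (asFunctor z').wHor 1 1 2 (by decide) (by decide) =
        (asFunctor z).wHor 1 1 2 (by decide) (by decide) :=
      congrArg (fun F => (asFunctor F).wHor 0 0 1 (by decide) (by decide)) h₂
    have e0123 : (asFunctor z').wSq 0 1 2 3 (by decide) (by decide) (by decide) =
        (asFunctor z).wSq 0 1 2 3 (by decide) (by decide) (by decide) := by
      apply sq_ext_cospan
      · rw [wSq_right, wSq_right, e13]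
      · rw [wSq_bottom, wSq_bottom, e123]
    have e0112 : (asFunctor z').wSq 0 1 1 2 (by decide) (by decide) (by decide) =
        (asFunctor z).wSq 0 1 1 2 (by decide) (by decide) (by decide) := by
      apply sq_ext_cospan
      · rw [wSq_right, wSq_right, ← wSq_left _ 0 1 2 3 (by decide) (by decide) (by decide), e0123,
          wSq_left]
      · rw [wSq_bottom, wSq_bottom, e112]
    have e012 : (asFunctor z').wHor 0 1 2 (by decide) (by decide) =
        (asFunctor z).wHor 0 1 2 (by decide) (by decide) := by
      rw [← wSq_top _ 0 1 1 2 (by decide) (by decide) (by decide), e0112, wSq_top]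
    have e023 : (asFunctor z').wHor 0 2 3 (by decide) (by decide) =
        (asFunctor z).wHor 0 2 3 (by decide) (by decide) := by
      rw [← wSq_top _ 0 1 2 3 (by decide) (by decide) (by decide), e0123, wSq_top]
    symm
    apply asFunctor_injective
    apply ext_of_wOb_one
    · rw [← src_wHor _ 0 1 2 (by decide) (by decide), e012, src_wHor]
    · intro j l hj hl hj1 hjl
      by_cases h : j.val = 1
      · obtain rfl : j = 1 := Fin.ext h
        obtain rfl : l = 2 := Fin.ext hjl
        exact e012
      · obtain rfl : j = 2 := Fin.ext (by rw [Fin.val_two]; omega)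
        obtain rfl : l = 3 := Fin.ext hjl
        exact e023

/-- The endomorphism `θ` of `[n+2]` sends `i + 1` to `i` and fixes the other vertices. Since
`(0,i,i+1)` is mapped to an identity, the first row of `F` does not change under `θ`, and the first
row determines `F`. -/
theorem σ_eq_of_mem {n : ℕ} (i : Fin (n + 2)) (F : (waldhausenConstruction.obj D) _⦋n + 2⦌)
    (h : (asFunctor F).wOb i.castSucc i.succ (Fin.castSucc_lt_succ).le ∈ D.A) :
    (waldhausenConstruction.obj D).σ i ((waldhausenConstruction.obj D).δ i.succ F) = F := by
  have h1 := wHor_eq_one_of_mem _ _ _ _ h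
  have h2 : (asFunctor F).wOb 0 i.castSucc (Fin.zero_le _) =
      (asFunctor F).wOb 0 i.succ (Fin.zero_le _) := by
    rw [← src_wHor _ 0 i.castSucc i.succ (Fin.zero_le _) (Fin.castSucc_lt_succ).le, h1,
      D.hor.src_one]
  have hθ : ∀ j : Fin (n + 3),
      (((SimplexCategory.σ i : ⦋n + 2⦌ ⟶ ⦋n + 1⦌) ≫ SimplexCategory.δ i.succ) j).val =
        if j.val = i.val + 1 then i.val else j.val := by
    intro j
    simp only [comp_val, σ_val, δ_val, Fin.val_succ]
    split_ifs <;> omega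
  have e : (waldhausenConstruction.obj D).σ i ((waldhausenConstruction.obj D).δ i.succ F) =
      (waldhausenConstruction.obj D).map
        ((SimplexCategory.σ i : ⦋n + 2⦌ ⟶ ⦋n + 1⦌) ≫ SimplexCategory.δ i.succ).op F :=
    map_map_op _ _ _ _
  rw [e]
  generalize (SimplexCategory.σ i : ⦋n + 2⦌ ⟶ ⦋n + 1⦌) ≫ SimplexCategory.δ i.succ = θ at hθ
  have θ_ne : ∀ j : Fin (n + 3), j.val ≠ i.val + 1 → θ j = j := fun j hj =>
    Fin.ext ((hθ j).trans (if_neg hj))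
  have θ_eq : ∀ j : Fin (n + 3), j.val = i.val + 1 → θ j = i.castSucc := fun j hj =>
    Fin.ext ((hθ j).trans (if_pos hj))
  have θ_zero : θ 0 = 0 := θ_ne 0 (by simp)
  apply asFunctor_injective
  apply ext_wHor_succ
  · rw [wOb_map]
    exact wOb_congr _ _ θ_zero θ_zero
  · intro j l hj hl hjl
    rw [wHor_map]
    by_cases hji : j.val = i.val
    · obtain rfl : j = i.castSucc := Fin.ext hji
      obtain rfl : l = i.succ := Fin.ext (by rw [hjl]; simp)
      rw [wHor_congr _ _ _ θ_zero (θ_ne _ (by simp)) (θ_eq _ (by simp)), wHor_one, h1, h2]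
    · by_cases hji' : j.val = i.val + 1
      -- Under `θ` this arrow becomes `(0,i,l)`, the composite of the identity `(0,i,i+1)` with
      -- `(0,i+1,l)`.
      · obtain rfl : j = i.succ := Fin.ext (by rw [hji']; simp)
        rw [wHor_congr _ _ _ θ_zero (θ_eq _ hji') (θ_ne l (by omega)),
          ← wHor_comp _ 0 i.castSucc i.succ l (Fin.zero_le _) (Fin.castSucc_lt_succ).le hl
            (by rw [tgt_wHor, src_wHor]),
          D.hor.comp_congr (h1.trans (congrArg _ (src_wHor _ 0 i.succ l hj hl).symm)) rfl _
            (D.hor.tgt_one _), D.hor.one_comp]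
      · exact wHor_congr _ _ _ θ_zero (θ_ne _ hji') (θ_ne _ (by omega))

theorem waldhausen_isUnitalTwoSegal : IsUnitalTwoSegal (waldhausenConstruction.obj D) where
  twoSegal := HasEarFillers.isTwoSegal (waldhausen_isFanSegal D).hasEarFillers
  unital n i := by
    rw [Limits.Types.isPullback_iff]
    refine ⟨?_, ?_, ?_⟩
    · change _ ≫ (waldhausenConstruction.obj D).map _ =
        (waldhausenConstruction.obj D).map _ ≫ _
      rw [← Functor.map_comp, ← Functor.map_comp, ← op_comp, ← op_comp]
      congr 2
      apply simplexHom_ext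
      intro j
      have := j.isLt
      simp only [SimplexCategory.len_mk] at this
      simp only [comp_val, σ_val, mkOfSucc_val]
      change i.val = _
      split_ifs <;> omega
    · rintro F F' ⟨-, h⟩
      have := congrArg ((waldhausenConstruction.obj D).δ i.succ) h
      rwa [deg_face _ SimplexCategory.δ_comp_σ_succ,
        deg_face _ SimplexCategory.δ_comp_σ_succ] at this
    · intro z F h
      have hob : (asFunctor z).wOb 0 0 le_rfl =
          (asFunctor F).wOb i.castSucc i.succ (Fin.castSucc_lt_succ).le :=
        congrArg (fun F => (asFunctor F).wOb 0 1 (by decide)) h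
      have hA : (asFunctor F).wOb i.castSucc i.succ (Fin.castSucc_lt_succ).le ∈ D.A := by
        rw [← hob]
        exact wOb_self_mem _ _
      have hF := σ_eq_of_mem D i F hA
      refine ⟨(waldhausenConstruction.obj D).δ i.succ F, ?_, hF⟩
      apply asFunctor_injective
      apply ext_zero
      rw [hob, wOb_map]
      change (asFunctor F).wOb (SimplexCategory.δ i.succ _) (SimplexCategory.δ i.succ _) _ = _
      have hi : (SimplexCategory.δ i.succ : ⦋n + 1⦌ ⟶ ⦋n + 2⦌) i = i.castSucc := by
        apply Fin.ext
        simp [δ_val]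
      refine (wOb_congr _ _ hi hi).trans ?_
      -- `F (i,i)` equals `F (i,i+1)`: the arrow between them is the augmentation morphism of an
      -- object of the augmentation set, hence an identity.
      rw [← src_wHor _ i.castSucc i.castSucc i.succ le_rfl (Fin.castSucc_lt_succ).le, wHor_aug,
        augHor_of_mem hA, D.hor.src_one]

end Simplices


/-! ### The isomorphism between a unital 2-Segal set and `S_•` of its path construction. -/

/-- A map between 2-Segal sets is bijective if it is in degrees `1` and `2`. -/
theorem IsTwoSegal.bijective_app {X Y : SSet.{u}} (hX : IsTwoSegal X) (hY : IsTwoSegal Y)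
    (φ : X ⟶ Y) (h₁ : Function.Injective (φ.app (op ⦋1⦌)))
    (h₂ : Function.Bijective (φ.app (op ⦋2⦌))) {n : ℕ} (hn : 3 ≤ n) :
    Function.Bijective (φ.app (op ⦋n⦌)) := by
  have hE := earChords_isTriangulation n 0 (by omega)
  have hnat : ∀ (t : ⦋2⦌ ⟶ ⦋n⦌) (y : X _⦋n⦌),
      φ.app (op ⦋2⦌) (X.map t.op y) = Y.map t.op (φ.app (op ⦋n⦌) y) :=
    fun t y => NatTrans.naturality_apply φ t.op y
  obtain ⟨hXi, hXs⟩ := hX n hn _ hE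
  constructor
  · intro y y' h
    apply hXi
    apply Subtype.ext
    funext t
    apply h₂.1
    change φ.app _ (X.map t.1.op y) = φ.app _ (X.map t.1.op y')
    rw [hnat, hnat, h]
  · intro z
    -- `g` inverts the map in degree `2`. Injectivity in degree `1` is what makes the preimages of
    -- the triangles of `z` agree along common edges.
    choose g hg using h₂.2
    obtain ⟨y, hy⟩ := hXs ⟨fun t => g (Y.map t.1.op z), fun t t' i j h => by
      apply h₁
      rw [← nat_face, ← nat_face, hg, hg, map_δ, map_δ, h]⟩
    refine ⟨y, ?_⟩
    apply (hY n hn _ hE).1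
    apply Subtype.ext
    funext t
    have hy' : X.map t.1.op y = g (Y.map t.1.op z) := congrFun (congrArg Subtype.val hy) t
    change Y.map t.1.op _ = Y.map t.1.op z
    rw [← hnat, hy', hg]

section

variable {n : ℕ}

/-- The vertex `a`. -/
def simplex₀ (a : Fin (n + 1)) : ⦋0⦌ ⟶ ⦋n⦌ := SimplexCategory.const ⦋0⦌ ⦋n⦌ a

/-- The edge with given vertices. -/
def simplex₁ (a b : Fin (n + 1)) (h₁ : a ≤ b) : ⦋1⦌ ⟶ ⦋n⦌ :=
  SimplexCategory.mkHom
    { toFun := ![a, b]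
      monotone' := Fin.monotone_iff_le_succ.2 (by
        intro i
        fin_cases i
        exact h₁) }

/-- The 3-simplex with given vertices. -/
def simplex₃ (a b c d : Fin (n + 1)) (h₁ : a ≤ b) (h₂ : b ≤ c) (h₃ : c ≤ d) : ⦋3⦌ ⟶ ⦋n⦌ :=
  SimplexCategory.mkHom
    { toFun := ![a, b, c, d]
      monotone' := Fin.monotone_iff_le_succ.2 (by
        intro i
        fin_cases i
        · exact h₁
        · exact h₂
        · exact h₃) }

/-- The 4-simplex with given vertices. -/
def simplex₄ (a b c d e : Fin (n + 1)) (h₁ : a ≤ b) (h₂ : b ≤ c) (h₃ : c ≤ d) (h₄ : d ≤ e) :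
    ⦋4⦌ ⟶ ⦋n⦌ :=
  SimplexCategory.mkHom
    { toFun := ![a, b, c, d, e]
      monotone' := Fin.monotone_iff_le_succ.2 (by
        intro i
        fin_cases i
        · exact h₁
        · exact h₂
        · exact h₃
        · exact h₄) }

variable {X : SSet.{u}}

theorem face_map_eq {m : ℕ} {i : Fin (m + 2)} {f : ⦋m + 1⦌ ⟶ ⦋n⦌} {g : ⦋m⦌ ⟶ ⦋n⦌}
    (h : ∀ j, f ((SimplexCategory.δ i : ⦋m⦌ ⟶ ⦋m + 1⦌) j) = g j) (y : X _⦋n⦌) :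
    X.δ i (X.map f.op y) = X.map g.op y :=
  (map_map_op X _ _ y).trans (map_congr X (fun j => congrArg Fin.val (h j)) y)

theorem map_eq_deg {m : ℕ} {i : Fin (m + 1)} {f : ⦋m + 1⦌ ⟶ ⦋n⦌} {g : ⦋m⦌ ⟶ ⦋n⦌}
    (h : ∀ j, f j = g ((SimplexCategory.σ i : ⦋m + 1⦌ ⟶ ⦋m⦌) j)) (y : X _⦋n⦌) :
    X.map f.op y = X.σ i (X.map g.op y) :=
  (map_congr X (fun j => congrArg Fin.val (h j)) y).trans (map_map_op X _ _ y).symm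

/-- The double functor attached to a simplex of a unital 2-Segal set. -/
noncomputable def pathFunctor (hX : IsUnitalTwoSegal X) (y : X _⦋n⦌) :
    AugDoubleFunctor (W n) (pathObj X hX) :=
  AugDoubleFunctor.ofValues (D := pathObj X hX)
    (fun i j hij => X.map (simplex₁ i j hij).op y)
    (fun i j l hij hjl => X.map (triangle i j l hij hjl).op y)
    (fun i k j hik hkj => X.map (triangle i k j hik hkj).op y)
    (fun i k j l hik hkj hjl => X.map (simplex₃ i k j l hik hkj hjl).op y)
    (fun _ _ _ _ _ => face_map_eq (by intro j; fin_cases j <;> rfl) y)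
    (fun _ _ _ _ _ => face_map_eq (by intro j; fin_cases j <;> rfl) y)
    (fun _ _ _ => map_eq_deg (by intro j; fin_cases j <;> rfl) y)
    -- Composition in the path construction is defined by unique fillers, and the restriction of `y`
    -- to the listed vertices is such a filler. The other three composition laws use the same
    -- argument, with 4-simplices for squares.
    (fun i j l m hij hjl hlm h =>
      (pathHor_comp hX.twoSegal (X.map (simplex₃ i j l m hij hjl hlm).op y)
        (face_map_eq (by intro j; fin_cases j <;> rfl) y)
        (face_map_eq (by intro j; fin_cases j <;> rfl) y) h).trans
        (face_map_eq (by intro j; fin_cases j <;> rfl) y))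
    (fun _ _ _ _ _ => face_map_eq (by intro j; fin_cases j <;> rfl) y)
    (fun _ _ _ _ _ => face_map_eq (by intro j; fin_cases j <;> rfl) y)
    (fun _ _ _ => map_eq_deg (by intro j; fin_cases j <;> rfl) y)
    (fun i k m j hik hkm hmj h =>
      (pathVer_comp hX.twoSegal (X.map (simplex₃ i k m j hik hkm hmj).op y)
        (face_map_eq (by intro j; fin_cases j <;> rfl) y)
        (face_map_eq (by intro j; fin_cases j <;> rfl) y) h).trans
        (face_map_eq (by intro j; fin_cases j <;> rfl) y))
    (fun _ _ _ _ _ _ _ => face_map_eq (by intro j; fin_cases j <;> rfl) y)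
    (fun _ _ _ _ _ _ _ => face_map_eq (by intro j; fin_cases j <;> rfl) y)
    (fun _ _ _ _ _ => map_eq_deg (by intro j; fin_cases j <;> rfl) y)
    (fun i k j l m hik hkj hjl hlm h =>
      (pathHsq_comp hX.twoSegal (X.map (simplex₄ i k j l m hik hkj hjl hlm).op y)
        (face_map_eq (by intro j; fin_cases j <;> rfl) y)
        (face_map_eq (by intro j; fin_cases j <;> rfl) y) h).trans
        (face_map_eq (by intro j; fin_cases j <;> rfl) y))
    (fun _ _ _ _ _ _ _ => face_map_eq (by intro j; fin_cases j <;> rfl) y)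
    (fun _ _ _ _ _ _ _ => face_map_eq (by intro j; fin_cases j <;> rfl) y)
    (fun _ _ _ _ _ => map_eq_deg (by intro j; fin_cases j <;> rfl) y)
    (fun i k m j l hik hkm hmj hjl h =>
      (pathVsq_comp hX.twoSegal (X.map (simplex₄ i k m j l hik hkm hmj hjl).op y)
        (face_map_eq (by intro j; fin_cases j <;> rfl) y)
        (face_map_eq (by intro j; fin_cases j <;> rfl) y) h).trans
        (face_map_eq (by intro j; fin_cases j <;> rfl) y))
    (fun i => ⟨X.map (simplex₀ i).op y, (map_eq_deg (by intro j; fin_cases j <;> rfl) y).symm⟩)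

end

/-- The comparison map from a unital 2-Segal set to the Waldhausen construction of its path
construction. -/
noncomputable def pathUnitApp (X : SSet.{u}) (hX : IsUnitalTwoSegal X) :
    X ⟶ waldhausenConstruction.obj (pathObj X hX) where
  app a := ↾(fun y => pathFunctor (n := a.unop.len) hX y)
  naturality a b f := by
    ext y
    apply ext_wHor (F := pathFunctor hX (X.map f y))
    intro i j l hij hjl
    refine (map_map_op X _ f.unop y).trans (map_congr X ?_ y)
    intro k
    fin_cases k <;> rfl

theorem simplex₁_zero_one : simplex₁ (n := 1) 0 1 (Fin.zero_le _) = 𝟙 _ :=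
  simplexHom_ext _ _ (by intro j; fin_cases j <;> rfl)

theorem triangle_zero_one_two : triangle (n := 2) 0 1 2 (Fin.zero_le _) (by decide) = 𝟙 _ :=
  simplexHom_ext _ _ (by intro j; fin_cases j <;> rfl)

theorem simplex₁_zero_zero : simplex₁ (n := 0) 0 0 le_rfl = SimplexCategory.σ 0 :=
  simplexHom_ext _ _ (by intro j; fin_cases j <;> rfl)

/-- A double functor from `W 0`, `W 1` or `W 2` is determined by an augmentation object, an object
or a horizontal morphism; in the path construction these form `X₀`, `X₁` and `X₂`. Higher degrees
follow because both sides are 2-Segal. -/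
theorem pathUnitApp_bijective (X : SSet.{u}) (hX : IsUnitalTwoSegal X) (n : ℕ) :
    Function.Bijective ((pathUnitApp X hX).app (op ⦋n⦌)) := by
  have hinj : Function.Injective ((pathUnitApp X hX).app (op ⦋1⦌)) := by
    intro y y' h
    have := congrArg (fun F : AugDoubleFunctor (W 1) (pathObj X hX) =>
      F.wOb 0 1 (Fin.zero_le _)) h
    change X.map (simplex₁ 0 1 (Fin.zero_le _)).op y =
      X.map (simplex₁ 0 1 (Fin.zero_le _)).op y' at this
    rwa [simplex₁_zero_one, map_id_op, map_id_op] at this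
  have hbij : Function.Bijective ((pathUnitApp X hX).app (op ⦋2⦌)) := by
    constructor
    · intro y y' h
      have := congrArg (fun F : AugDoubleFunctor (W 2) (pathObj X hX) =>
        F.wHor 0 1 2 (Fin.zero_le _) (by decide)) h
      change X.map (triangle 0 1 2 (Fin.zero_le _) (by decide)).op y =
        X.map (triangle 0 1 2 (Fin.zero_le _) (by decide)).op y' at this
      rwa [triangle_zero_one_two, map_id_op, map_id_op] at this
    · intro F
      refine ⟨(asFunctor F).wHor 0 1 2 (Fin.zero_le _) (by decide), ?_⟩
      apply asFunctor_injective
      apply ext_two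
      refine (show X.map (triangle (n := 2) 0 1 2 (Fin.zero_le _) (by decide)).op _ = _ from ?_)
      rw [triangle_zero_one_two]
      exact map_id_op X _
  match n with
  | 0 =>
    constructor
    · intro y y' h
      have := congrArg (fun F : AugDoubleFunctor (W 0) (pathObj X hX) =>
        F.wOb 0 0 le_rfl) h
      change X.map (simplex₁ 0 0 le_rfl).op y = X.map (simplex₁ 0 0 le_rfl).op y' at this
      rw [simplex₁_zero_zero] at this
      have h' := congrArg (X.δ 0) this
      exact (deg_face X (by decide) y).symm.trans (h'.trans (deg_face X (by decide) y'))
    · intro F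
      obtain ⟨z, hz⟩ := (asFunctor F).wOb_self_mem 0
      refine ⟨z, ?_⟩
      apply asFunctor_injective
      apply ext_zero
      refine (show X.map (simplex₁ (n := 0) 0 0 le_rfl).op z = _ from ?_)
      rw [simplex₁_zero_zero]
      exact hz
  | 1 =>
    refine ⟨hinj, ?_⟩
    intro F
    refine ⟨(asFunctor F).wOb 0 1 (Fin.zero_le _), ?_⟩
    apply asFunctor_injective
    apply ext_one
    refine (show X.map (simplex₁ (n := 1) 0 1 (Fin.zero_le _)).op _ = _ from ?_)
    rw [simplex₁_zero_one]
    exact map_id_op X _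
  | 2 => exact hbij
  | n + 3 =>
    exact hX.twoSegal.bijective_app (waldhausen_isUnitalTwoSegal _).twoSegal _ hinj hbij (by omega)

/-- The natural map from unital 2-Segal sets to the Waldhausen construction of the path
construction. -/
noncomputable def pathUnit :
    unitalTwoSegal.{u}.ι ⟶ pathConstruction.{u} ⋙ waldhausenConstruction.{u} where
  app X := pathUnitApp X.obj X.property
  naturality X Y φ := by
    ext a y
    apply ext_wHor (F := pathFunctor Y.property (φ.hom.app a y))
    intro i j l hij hjl
    exact (NatTrans.naturality_apply φ.hom (triangle i j l hij hjl).op y).symm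

instance : IsIso pathUnit.{u} := by
  have : ∀ X, IsIso (pathUnit.{u}.app X) := fun X => by
    have : ∀ a, IsIso ((pathUnit.{u}.app X).app a) := fun a => by
      rw [isIso_iff_bijective]
      exact pathUnitApp_bijective X.obj X.property a.unop.len
    exact NatIso.isIso_of_isIso_app _
  exact NatIso.isIso_of_isIso_app _

/-- The augmented double nerve of the path construction is the restriction along `p`. -/
noncomputable def pathNerveIso : pathConstruction.{u} ⋙ augNerve.{u} ≅
    unitalTwoSegal.{u}.ι ⋙ pUpper.{u} :=
  -- `augNerve` is `waldhausenConstruction ⋙ pUpper` by unfolding, so whiskering with `pUpper` gives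
  -- the required source.
  (Functor.isoWhiskerRight (asIso pathUnit.{u}) pUpper.{u}).symm

/-! ### Unital 2-Segal sets are right Kan extended along `p`. -/

/-- The ordinal sum of two morphisms of the simplex category. -/
def join {q r q' r' : ℕ} (f₁ : ⦋q⦌ ⟶ ⦋q'⦌) (f₂ : ⦋r⦌ ⟶ ⦋r'⦌) : ⦋q + 1 + r⦌ ⟶ ⦋q' + 1 + r'⦌ :=
  SimplexCategory.mkHom (ordinalSumHom f₁.toOrderHom f₂.toOrderHom)

theorem join_val_lt {q r q' r' : ℕ} (f₁ : ⦋q⦌ ⟶ ⦋q'⦌) (f₂ : ⦋r⦌ ⟶ ⦋r'⦌) (i : Fin (q + 1 + r + 1))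
    (h : i.val < q + 1) : (join f₁ f₂ i).val = (f₁ ⟨i.val, h⟩).val :=
  congrArg Fin.val (dif_pos h)

theorem join_val_ge {q r q' r' : ℕ} (f₁ : ⦋q⦌ ⟶ ⦋q'⦌) (f₂ : ⦋r⦌ ⟶ ⦋r'⦌) (i : Fin (q + 1 + r + 1))
    (h : ¬ i.val < q + 1) :
    (join f₁ f₂ i).val = q' + 1 + (f₂ (⟨i.val - (q + 1), by omega⟩ : Fin (r + 1))).val :=
  congrArg Fin.val (dif_neg h)

/-- The map `[m] → [n]` that repeats the value `c`. -/
def collapse (m n c : ℕ) (h : m = n + 1) (hc : c ≤ n) : ⦋m⦌ ⟶ ⦋n⦌ :=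
  SimplexCategory.mkHom
    { toFun := fun i => ⟨if i.val ≤ c then i.val else i.val - 1, by split_ifs <;> omega⟩
      monotone' := fun i j hij => by
        rw [Fin.le_def] at hij ⊢
        dsimp only
        split_ifs <;> omega }

theorem collapse_val (m n c : ℕ) (h : m = n + 1) (hc : c ≤ n) (i : Fin (m + 1)) :
    (collapse m n c h hc i).val = if i.val ≤ c then i.val else i.val - 1 := rfl

/-- The map `[m] → [n]`, `i ↦ i`, for `m ≤ n`. -/
def incl (m n : ℕ) (h : m ≤ n) : ⦋m⦌ ⟶ ⦋n⦌ :=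
  SimplexCategory.mkHom
    { toFun := fun i => ⟨i.val, by omega⟩
      monotone' := fun _ _ hij => hij }

theorem incl_val (m n : ℕ) (h : m ≤ n) (i : Fin (m + 1)) : (incl m n h i).val = i.val := rfl

theorem exists_eq_collapse {X : SSet.{u}} (hX : IsUnitalTwoSegal X) {m n : ℕ} (c : ℕ)
    (h : m = n + 1 + 1) (hc : c ≤ n + 1) (e : ⦋1⦌ ⟶ ⦋m⦌)
    (he : ∀ i : Fin 2, (e i).val = c + i.val) (y : X _⦋m⦌) (z : X _⦋0⦌)
    (hz : X.σ 0 z = X.map e.op y) : ∃ w, X.map (collapse m (n + 1) c h hc).op w = y := by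
  subst h
  have e₁ : e = SimplexCategory.mkOfSucc (⟨c, by omega⟩ : Fin (n + 2)) :=
    simplexHom_ext _ _ fun i => by rw [mkOfSucc_val, he]
  have e₂ : collapse (n + 1 + 1) (n + 1) c rfl hc =
      SimplexCategory.σ (⟨c, by omega⟩ : Fin (n + 2)) :=
    simplexHom_ext _ _ fun i => by rw [σ_val, collapse_val]
  rw [e₂]
  exact eq_of_degenerate_edge hX ⟨c, by omega⟩ y z (by rw [hz, e₁])

/-- A natural transformation between the restrictions along `p` of two simplicial sets. -/
structure SumTransformation (G X : SSet.{u}) where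
  sum : ∀ q r : ℕ, G _⦋q + 1 + r⦌ → X _⦋q + 1 + r⦌
  point : G _⦋0⦌ → X _⦋0⦌
  sum_join : ∀ {q r q' r' : ℕ} (f₁ : ⦋q⦌ ⟶ ⦋q'⦌) (f₂ : ⦋r⦌ ⟶ ⦋r'⦌) (g : G _⦋q' + 1 + r'⦌),
    sum q r (G.map (join f₁ f₂).op g) = X.map (join f₁ f₂).op (sum q' r' g)
  sum_point : ∀ {q r : ℕ} (f : ⦋q + 1 + r⦌ ⟶ ⦋0⦌) (g : G _⦋0⦌),
    sum q r (G.map f.op g) = X.map f.op (point g)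

namespace SumTransformation

variable {G X : SSet.{u}} (α : SumTransformation G X)

/-- The edge `c < c+1` of `[c+1+d]` is an ordinal sum of vertices of `[c]` and `[d]`, so `α` is
natural for it. On the degenerate simplex that edge factors through `[0]`, so by naturality for
`(0,0) → [-1]` its image is degenerate too, and unitality applies. -/
theorem exists_eq_collapse (hX : IsUnitalTwoSegal X) {n c d : ℕ} (h : c + d = n + 1)
    (g : G _⦋n + 1⦌) :
    ∃ w, X.map (collapse (c + 1 + d) (n + 1) c (by omega) (by omega)).op w =
      α.sum c d (G.map (collapse (c + 1 + d) (n + 1) c (by omega) (by omega)).op g) := by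
  let e : ⦋0 + 1 + 0⦌ ⟶ ⦋c + 1 + d⦌ :=
    join (SimplexCategory.const ⦋0⦌ ⦋c⦌ (Fin.last c)) (SimplexCategory.const ⦋0⦌ ⦋d⦌ 0)
  have he : ∀ i : Fin 2, (e i).val = c + i.val := by
    intro i
    fin_cases i <;> rfl
  let v : ⦋0⦌ ⟶ ⦋n + 1⦌ := SimplexCategory.const ⦋0⦌ ⦋n + 1⦌ (⟨c, by omega⟩ : Fin (n + 2))
  have hev : e ≫ collapse (c + 1 + d) (n + 1) c (by omega) (by omega) =
      (SimplexCategory.σ 0 : ⦋0 + 1⦌ ⟶ ⦋0⦌) ≫ v := by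
    apply simplexHom_ext
    intro i
    rw [comp_val, collapse_val, he]
    change _ = c
    have := i.isLt
    simp only [SimplexCategory.len_mk] at this
    split_ifs <;> omega
  refine Waldhausen.exists_eq_collapse hX c (by omega) (by omega) e he _ (α.point (G.map v.op g)) ?_
  change X.map (SimplexCategory.σ 0).op _ = _
  rw [← α.sum_join, map_map_op]
  change _ = α.sum 0 0 (G.map (e ≫ _).op g)
  rw [hev, ← map_map_op]
  exact (α.sum_point (q := 0) (r := 0) (SimplexCategory.σ 0) _).symm

/-- The previous lemma writes the left side as a degeneracy of some `w`; the point is that `w =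
α.sum n 0 g`. Induction on `d` moves the cut one place at a time, since the components for `(c+1,d)`
and `(c,d+1)` both restrict to the one for `(c,d)`. -/
theorem sum_collapse (hX : IsUnitalTwoSegal X) {n : ℕ} (g : G _⦋n + 1⦌) (d : ℕ) :
    ∀ c (h : c + d = n + 1),
      α.sum c d (G.map (collapse (c + 1 + d) (n + 1) c (by omega) (by omega)).op g) =
        X.map (collapse (c + 1 + d) (n + 1) c (by omega) (by omega)).op (α.sum n 0 g) := by
  induction d with
  | zero =>
    intro c h
    obtain rfl : c = n + 1 := by omega
    obtain ⟨w, hw⟩ := α.exists_eq_collapse hX h g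
    -- A section of the degeneracy that is itself an ordinal sum, so that `α` commutes with it.
    have hj : join (incl n (n + 1) (by omega)) (𝟙 ⦋0⦌) ≫
        collapse (n + 1 + 1 + 0) (n + 1) (n + 1) (by omega) (by omega) = 𝟙 ⦋n + 1⦌ := by
      apply simplexHom_ext
      intro i
      have := i.isLt
      simp only [SimplexCategory.len_mk] at this
      rw [comp_val, collapse_val]
      change _ = i.val
      by_cases hi : i.val < n + 1
      · rw [join_val_lt _ _ _ hi, incl_val, if_pos (by simp only; omega)]
      · rw [join_val_ge _ _ _ hi]
        change (if n + 1 + 1 + (i.val - (n + 1)) ≤ n + 1 then _ else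
          n + 1 + 1 + (i.val - (n + 1)) - 1) = _
        split_ifs <;> omega
    have hw' := congrArg (X.map (join (incl n (n + 1) (by omega)) (𝟙 ⦋0⦌)).op) hw
    rw [← α.sum_join, map_map_op, map_map_op, hj, map_id_op] at hw'
    rw [← hw, hw']
    congr 2
    exact map_id_op G g
  | succ d ih =>
    intro c h
    obtain ⟨w, hw⟩ := α.exists_eq_collapse hX h g
    have h₁ : join (incl c (c + 1) (by omega)) (𝟙 ⦋d⦌) ≫
        collapse (c + 1 + 1 + d) (n + 1) (c + 1) (by omega) (by omega) =
          incl (c + 1 + d) (n + 1) (by omega) := by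
      apply simplexHom_ext
      intro i
      rw [comp_val, collapse_val, incl_val]
      by_cases hi : i.val < c + 1
      · rw [join_val_lt _ _ _ hi, incl_val, if_pos (by simp only; omega)]
      · rw [join_val_ge _ _ _ hi]
        change (if c + 1 + 1 + (i.val - (c + 1)) ≤ c + 1 then _ else
          c + 1 + 1 + (i.val - (c + 1)) - 1) = _
        split_ifs <;> omega
    have h₂ : join (𝟙 ⦋c⦌) (SimplexCategory.δ 0 : ⦋d⦌ ⟶ ⦋d + 1⦌) ≫
        collapse (c + 1 + (d + 1)) (n + 1) c (by omega) (by omega) =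
          incl (c + 1 + d) (n + 1) (by omega) := by
      apply simplexHom_ext
      intro i
      rw [comp_val, collapse_val, incl_val]
      by_cases hi : i.val < c + 1
      · rw [join_val_lt _ _ _ hi]
        change (if i.val ≤ c then i.val else _) = _
        rw [if_pos (by omega)]
      · rw [join_val_ge _ _ _ hi]
        change (if c + 1 + (i.val - (c + 1) + 1) ≤ c then _ else
          c + 1 + (i.val - (c + 1) + 1) - 1) = _
        split_ifs <;> omega
    have e₁ := congrArg (X.map (join (incl c (c + 1) (by omega)) (𝟙 ⦋d⦌)).op)
      (ih (c + 1) (by omega))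
    rw [← α.sum_join, map_map_op, map_map_op, h₁] at e₁
    have e₂ := congrArg (X.map (join (𝟙 ⦋c⦌) (SimplexCategory.δ 0 : ⦋d⦌ ⟶ ⦋d + 1⦌)).op) hw
    rw [← α.sum_join, map_map_op, map_map_op, h₂, e₁] at e₂
    -- Here `c + 1 + d` and `n + 1` are equal but not syntactically, so `incl` is the identity in
    -- disguise and can be cancelled.
    have hid : incl (n + 1) (c + 1 + d) (by omega) ≫ incl (c + 1 + d) (n + 1) (by omega) =
        𝟙 ⦋n + 1⦌ := simplexHom_ext _ _ fun _ => rfl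
    have e₃ := congrArg (X.map (incl (n + 1) (c + 1 + d) (by omega)).op) e₂
    rw [map_map_op, map_map_op, hid, map_id_op] at e₃
    rw [← hw, e₃]
    congr 1
    exact map_id_op X _

/-- Cut the target at `c = f q`. Then `f` is an ordinal sum `[q] + [r] → [c] + [d]` followed by the
degeneracy that repeats `c`: naturality handles the first factor and `sum_collapse` the second. -/
theorem sum_map (hX : IsUnitalTwoSegal X) {n q r : ℕ} (f : ⦋q + 1 + r⦌ ⟶ ⦋n + 1⦌)
    (g : G _⦋n + 1⦌) : α.sum q r (G.map f.op g) = X.map f.op (α.sum n 0 g) := by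
  have hmono : ∀ i j : Fin (q + 1 + r + 1), i.val ≤ j.val → (f i).val ≤ (f j).val :=
    fun i j h => f.toOrderHom.monotone h
  have hlt : ∀ i : Fin (q + 1 + r + 1), (f i).val < n + 2 := fun i => (f i).isLt
  obtain ⟨c, hc⟩ : ∃ c, c = (f (⟨q, by omega⟩ : Fin (q + 1 + r + 1))).val := ⟨_, rfl⟩
  have hcn : c < n + 2 := hc ▸ hlt _
  obtain ⟨d, hd⟩ : ∃ d, c + d = n + 1 := ⟨n + 1 - c, by omega⟩
  let f₁ : ⦋q⦌ ⟶ ⦋c⦌ := SimplexCategory.mkHom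
    { toFun := fun i => ⟨(f (⟨i.val, by omega⟩ : Fin (q + 1 + r + 1))).val, by
        have := hmono ⟨i.val, by omega⟩ ⟨q, by omega⟩ (by simp only; omega)
        omega⟩
      monotone' := fun i j hij => hmono _ _ hij }
  let f₂ : ⦋r⦌ ⟶ ⦋d⦌ := SimplexCategory.mkHom
    { toFun := fun i => ⟨(f (⟨q + 1 + i.val, by omega⟩ : Fin (q + 1 + r + 1))).val - c, by
        have := hlt (⟨q + 1 + i.val, by omega⟩ : Fin (q + 1 + r + 1))
        omega⟩
      monotone' := fun i j hij => Nat.sub_le_sub_right (hmono _ _ (Nat.add_le_add_left hij _)) _ }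
  have hf : f = join f₁ f₂ ≫ collapse (c + 1 + d) (n + 1) c (by omega) (by omega) := by
    apply simplexHom_ext
    intro i
    have hi' := i.isLt
    simp only [SimplexCategory.len_mk] at hi'
    rw [comp_val, collapse_val]
    by_cases hi : i.val < q + 1
    · rw [join_val_lt _ _ _ hi]
      change _ = if (f i).val ≤ c then (f i).val else _
      rw [if_pos]
      rw [hc]
      exact hmono _ _ (by simp only; omega)
    · rw [join_val_ge _ _ _ hi]
      have h₁ := hmono ⟨q, by omega⟩ i (by simp only; omega)
      have h₂ : (f₂ (⟨i.val - (q + 1), by omega⟩ : Fin (r + 1))).val = (f i).val - c := by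
        change (f ⟨q + 1 + (i.val - (q + 1)), _⟩).val - c = _
        congr 3
        apply Fin.ext
        simp only
        omega
      rw [h₂]
      split_ifs <;> omega
  rw [hf, ← map_map_op, ← map_map_op, α.sum_join, α.sum_collapse hX g d c hd]

/-- The components of the extension of `α` to a map of simplicial sets. -/
def extend : ∀ n : ℕ, G _⦋n⦌ → X _⦋n⦌ :=
  fun n => Nat.casesOn n α.point (fun n => α.sum n 0)

theorem sum_extend (hX : IsUnitalTwoSegal X) {n q r : ℕ} (f : ⦋q + 1 + r⦌ ⟶ ⦋n⦌) (g : G _⦋n⦌) :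
    α.sum q r (G.map f.op g) = X.map f.op (α.extend n g) := by
  cases n with
  | zero => exact α.sum_point f g
  | succ n => exact α.sum_map hX f g

/-- For a source `[m]` with `m > 0` this is `sum_extend`, as `[m] = p(m-1,0)`. The object `[0]` is
not an ordinal sum; the claim is checked after applying the injective map `s₀`, which moves it to
`[1] = p(0,0)`. -/
theorem extend_map (hX : IsUnitalTwoSegal X) {m n : ℕ} (f : ⦋m⦌ ⟶ ⦋n⦌) (g : G _⦋n⦌) :
    α.extend m (G.map f.op g) = X.map f.op (α.extend n g) := by
  cases m with
  | succ m => exact α.sum_extend hX (q := m) (r := 0) f g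
  | zero =>
    have h : X.σ 0 (α.extend 0 (G.map f.op g)) = X.σ 0 (X.map f.op (α.extend n g)) := by
      refine (α.sum_point (q := 0) (r := 0) (SimplexCategory.σ 0) (G.map f.op g)).symm.trans ?_
      rw [map_map_op]
      exact (α.sum_extend hX (q := 0) (r := 0) (SimplexCategory.σ 0 ≫ f) g).trans
        (map_map_op X _ _ _).symm
    have h' := congrArg (X.δ 0) h
    exact (deg_face X (by decide) _).symm.trans (h'.trans (deg_face X (by decide) _))

end SumTransformation

/-- The object `(q, r)` of `Σ`. -/
def sumObj (q r : ℕ) : SigmaCat := WithTerminal.of (⦋q⦌, ⦋r⦌)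

/-- The components of a natural transformation between restrictions along `p`. -/
def SumTransformation.ofNatTrans {G X : SSet.{u}}
    (α : ordinalSumExt.op ⋙ G ⟶ ordinalSumExt.op ⋙ X) : SumTransformation G X where
  sum q r := α.app (op (sumObj q r))
  point := α.app (op WithTerminal.star)
  sum_join {q r q' r'} f₁ f₂ g :=
    NatTrans.naturality_apply α (X := op (sumObj q' r')) (Y := op (sumObj q r))
      (WithTerminal.incl.map
        (show ((⦋q⦌, ⦋r⦌) : SimplexCategory × SimplexCategory) ⟶ (⦋q'⦌, ⦋r'⦌) from (f₁, f₂))).op g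
  sum_point {q r} f g := by
    have hf : f = ordinalSumExt.map (WithTerminal.starTerminal.from (sumObj q r)) :=
      SimplexCategory.isTerminalZero.hom_ext _ _
    rw [hf]
    exact NatTrans.naturality_apply α (X := op WithTerminal.star) (Y := op (sumObj q r))
      (WithTerminal.starTerminal.from (sumObj q r)).op g

/-- Existence is `extend`, whose restriction along `p` is `α` by `sum_extend`. Uniqueness holds
because every object of the simplex category is in the image of `p`, namely `[n+1] = p(n,0)` and
`[0] = p([-1])`. -/
theorem existsUnique_extension {X : SSet.{u}} (hX : IsUnitalTwoSegal X) (G : SSet.{u})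
    (α : ordinalSumExt.op ⋙ G ⟶ ordinalSumExt.op ⋙ X) :
    ∃! β : G ⟶ X, Functor.whiskerLeft ordinalSumExt.op β = α := by
  let α' := SumTransformation.ofNatTrans α
  refine ⟨{ app := fun a => ↾(α'.extend a.unop.len), naturality := ?_ }, ?_, ?_⟩
  · intro a b f
    ext g
    exact α'.extend_map hX (m := b.unop.len) (n := a.unop.len) f.unop g
  · ext a g
    induction a with
    | op a =>
    cases a with
    | star => rfl
    | of x =>
      have h : ∀ g : G _⦋x.1.len + 1 + x.2.len⦌,
          α'.extend _ g = α'.sum x.1.len x.2.len g := fun g => by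
        have := α'.sum_extend hX (𝟙 ⦋x.1.len + 1 + x.2.len⦌) g
        rw [map_id_op, map_id_op] at this
        exact this.symm
      exact h g
  · rintro β rfl
    ext a g
    induction a with
    | op a =>
    induction a using SimplexCategory.rec with
    | _ n =>
    cases n with
    | zero => rfl
    | succ n => rfl

/-- The universal property among right extensions of `p^* X` is precisely the unique extension of
maps `p^* G → p^* X`. -/
theorem isRightKanExtension {X : SSet.{u}} (hX : IsUnitalTwoSegal X) :
    X.IsRightKanExtension (𝟙 (ordinalSumExt.op ⋙ X)) where
  nonempty_isUniversal := by
    choose β hβ hβ' using fun E : ordinalSumExt.op.RightExtension (ordinalSumExt.op ⋙ X) =>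
      existsUnique_extension hX E.left E.hom
    exact ⟨Limits.IsTerminal.ofUniqueHom
      (fun E => CostructuredArrow.homMk (β E) ((Category.comp_id _).trans (hβ E)))
      (fun E f => CostructuredArrow.hom_ext _ _
        (hβ' E f.left ((Category.comp_id _).symm.trans (CostructuredArrow.w f))))⟩

theorem isIso_unit_app {X : SSet.{u}} (hX : IsUnitalTwoSegal X) :
    IsIso (pAdjunction.{u}.unit.app X) :=
  (ordinalSumExt.op.isIso_ranAdjunction_unit_app_iff X).2 (isRightKanExtension hX)

theorem isIso_whiskerLeft_unit :
    IsIso (Functor.whiskerLeft waldhausenConstruction.{u} pAdjunction.{u}.unit) := by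
  have : ∀ D, IsIso ((Functor.whiskerLeft waldhausenConstruction.{u} pAdjunction.{u}.unit).app D) :=
    fun D => isIso_unit_app (waldhausen_isUnitalTwoSegal D)
  exact NatIso.isIso_of_isIso_app _

/-- The Waldhausen construction is the generalized Waldhausen construction of the nerve. -/
noncomputable def waldhausenIso :
    waldhausenConstruction.{u} ≅ augNerve.{u} ⋙ pLower.{u} :=
  -- The target of the whiskered unit is `S_•` followed by `p^*` and `p_*`, and the first two
  -- compose to `augNerve` by unfolding.
  @asIso _ _ _ _ (Functor.whiskerLeft waldhausenConstruction.{u} pAdjunction.{u}.unit)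
    isIso_whiskerLeft_unit

end Waldhausen

/-! ### The theorem. -/

theorem proposition3p5 :
    ∃ hS : ∀ D : Waldhausen.AugStDoubleCat.{u},
        Waldhausen.IsUnitalTwoSegal (Waldhausen.waldhausenConstruction.obj D),
      Nonempty
        (Waldhausen.pathConstruction.{u} ⋙ Waldhausen.augNerve.{u} ≅
          Waldhausen.unitalTwoSegal.{u}.ι ⋙ Waldhausen.pUpper.{u}) ∧
      Nonempty
        (Waldhausen.unitalTwoSegal.{u}.lift Waldhausen.waldhausenConstruction.{u} hS ⋙
            Waldhausen.unitalTwoSegal.{u}.ι ≅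
          Waldhausen.augNerve.{u} ⋙ Waldhausen.pLower.{u}) :=
  ⟨Waldhausen.waldhausen_isUnitalTwoSegal, ⟨Waldhausen.pathNerveIso⟩,
    ⟨Waldhausen.unitalTwoSegal.liftCompιIso _ _ ≪≫ Waldhausen.waldhausenIso⟩⟩
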